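/- Let $\Bbbk$ be a field and let $A=A_{\bar 0}\oplus A_{\bar 1}$ be a symmetric Frobenius superalgebra over $\Bbbk$: an associative unital superalgebra with a parity-preserving linear map $\mathrm{tr}\colon A\to\Bbbk$ satisfying $\mathrm{tr}(ab)=(-1)^{\bar a\bar b}\mathrm{tr}(ba)$ for homogeneous $a,b$, together with a finite homogeneous basis $\mathbf B_A$ of $A$ and a left dual basis $\{b^\vee: b\in\mathbf B_A\}$, $\mathrm{tr}(b^\vee c)=\delta_{b,c}$. *The category $\mathcal{OB}(A)$.* The oriented Frobenius Brauer category $\mathcal{OB}(A)$ is the strict $\Bbbk$-linear monoidal supercategory generated by objects $\uparrow,\downarrow$, even morphisms $s\colon\uparrow\otimes\uparrow\,\to\,\uparrow\otimes\uparrow$ (upward crossing), $c_r\colon\mathbf 1\to\,\downarrow\otimes\uparrow$ (right cup), $d_r\colon\uparrow\otimes\downarrow\,\to\mathbf 1$ (right cap), $c_l\colon\mathbf 1\to\,\uparrow\otimes\downarrow$ (left cup), $d_l\colon\downarrow\otimes\uparrow\,\to\mathbf 1$ (left cap), and tokens $t_a\colon\uparrow\,\to\,\uparrow$ for $a\in A$,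 of parity $\bar a$, subject to the following relations for $a,b\in A$, $\lambda,\mu\in\Bbbk$ (tensor products with identities being written $f\otimes 1$, $1\otimes f$, and $\circ$ denoting composition): * $t_1=1_\uparrow$, $\ \lambda t_a+\mu t_b=t_{\lambda a+\mu b}$, $\ t_a\circ t_b=t_{ab}$; * $s\circ s=1$, $\ (s\otimes 1_\uparrow)(1_\uparrow\otimes s)(s\otimes 1_\uparrow)=(1_\uparrow\otimes s)(s\otimes 1_\uparrow)(1_\uparrow\otimes s)$, $\ s\circ(t_a\otimes 1_\uparrow)=(1_\uparrow\otimes t_a)\circ s$; * $s_l\circ s_r=1_{\uparrow\otimes\downarrow}$ and $s_r\circ s_l=1_{\downarrow\otimes\uparrow}$, where $s_r=(1_{\downarrow\otimes\uparrow}\otimes d_r)(1_\downarrow\otimes s\otimes 1_\downarrow)(c_r\otimes 1_{\uparrow\otimes\downarrow})$ and $s_l=(d_l\otimes 1_{\uparrow\otimes\downarrow})(1_\downarrow\otimes s\otimes 1_\downarrow)(1_{\downarrow\otimes\uparrow}\otimes c_l)$; * $(d_l\otimes 1_\uparrow)(1_\downarrow\otimes s)(c_r\otimes 1_\uparrow)=1_\uparrow=(1_\uparrow\otimes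 d_r)(s\otimes 1_\downarrow)(1_\uparrow\otimes c_l)$; * $(d_r\otimes 1_\uparrow)(1_\uparrow\otimes c_r)=1_\uparrow$ and $(1_\downarrow\otimes d_r)(c_r\otimes 1_\downarrow)=1_\downarrow$. In a strict monoidal supercategory one has $(f'\otimes g)\circ(f\otimes g')=(-1)^{\bar f\bar g}(f'\circ f)\otimes(g\circ g')$. *The modules.* Let $m,n\ge 0$, put $p(i)=\bar 0$ for $1\le i\le m$ and $p(i)=\bar 1$ for $m<i\le m+n$, and let $\mathfrak g=\mathfrak{gl}_{m|n}(A)$ be the Lie superalgebra of $(m+n)\times(m+n)$ matrices over $A$, where the matrix $a_{(i,j)}$ with single nonzero entry $a$ in position $(i,j)$ has parity $\bar a+p(i)+p(j)$, and $[M,N]=MN-(-1)^{\bar M\bar N}NM$. Let $\mathrm{smod}\text{-}\mathfrak g$ be the monoidal supercategory of right $\mathfrak g$-supermodules, whose morphisms (of either parity) are the linear maps $f$ with $f(v\cdot M)=f(v)\cdot M$, with $(v\otimes w)\cdot M=v\otimes (w\cdot M)+(-1)^{\bar w\bar M}(v\cdot M)\otimes w$, $(f\otimes g)(v\otimes w)=(-1)^{\bar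 g\bar v}f(v)\otimes g(w)$, and unit object the trivial module $\Bbbk$. Let $V_+$ be the space of row vectors and $V_-$ the space of column vectors of length $m+n$ over $A$; in both, the vector $a_{i,\pm}$ with single nonzero entry $a$ in position $i$ has parity $\bar a+p(i)$. These are right $\mathfrak g$-supermodules by $v\cdot M=vM$ on $V_+$ and $v\cdot M=-(-1)^{\bar v\bar M}Mv$ on $V_-$. Let $B\colon V_-\otimes V_+\to\Bbbk$ be given by $B(v\otimes w)=(-1)^{\bar v\bar w}\mathrm{tr}(wv)$. Let $\mathbf B_+=\{b_{i,+}: b\in\mathbf B_A,\ 1\le i\le m+n\}$, a basis of $V_+$, and for $v=b_{i,+}\in\mathbf B_+$ let $v^\vee=(-1)^{p(i)}\,b^\vee_{i,-}\in V_-$; this is the dual basis with respect to $B$, i.e. $B(v^\vee\otimes w)=\delta_{v,w}$ for $v,w\in\mathbf B_+$. **Theorem.** There is a monoidal superfunctor $\psi\colon\mathcal{OB}(A)\to\mathrm{smod}\text{-}\mathfrak g$ given on objects by $\uparrow\,\mapsto V_+$, $\downarrow\,\mapsto V_-$ and on morphisms (with $\psi(X\otimes Y)$ and $\psi(\mathbf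 1)$ identified with $\psi(X)\otimes\psi(Y)$ and $\Bbbk$ through the coherence isomorphisms of $\psi$) by $$\begin{aligned} \psi(s)&\colon V_+\otimes V_+\to V_+\otimes V_+,& v\otimes w&\mapsto(-1)^{\bar v\bar w}w\otimes v,\\ \psi(t_a)&\colon V_+\to V_+,& v&\mapsto av,\\ \psi(c_r)&\colon \Bbbk\to V_-\otimes V_+,& 1&\mapsto\sum_{v\in\mathbf B_+}(-1)^{\bar v}v^\vee\otimes v,\\ \psi(c_l)&\colon \Bbbk\to V_+\otimes V_-,& 1&\mapsto\sum_{v\in\mathbf B_+}v\otimes v^\vee,\\ \psi(d_r)&\colon V_+\otimes V_-\to\Bbbk,& v\otimes w&\mapsto(-1)^{\bar v\bar w}B(w\otimes v),\\ \psi(d_l)&\colon V_-\otimes V_+\to\Bbbk,& v\otimes w&\mapsto B(v\otimes w). \end{aligned}$$ Formulas with signs are for homogeneous elements and are extended linearly. -/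

import Mathlib

set_option linter.unusedSectionVars false

open CategoryTheory TensorProduct

universe u

namespace FrobBrauer

/-! ### Signs and superspaces -/

section Super

variable (k : Type u) [Field k]

theorem parity_cases (p : ZMod 2) : p = 0 ∨ p = 1 := by decide +revert

/-- The sign `(-1)^p` as a scalar, for a parity `p`. -/
def sgn (p : ZMod 2) : k := if p = 0 then 1 else -1

theorem sgn_zero : sgn k 0 = 1 := rfl

theorem sgn_add (p q : ZMod 2) : sgn k (p + q) = sgn k p * sgn k q := by
  have h : (1 + 1 : ZMod 2) = 0 := by decide
  rcases parity_cases p with rfl | rfl <;> rcases parity_cases q with rfl | rfl <;>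
    simp [sgn, h]

theorem sgn_mul_self (p : ZMod 2) : sgn k p * sgn k p = 1 := by
  rcases parity_cases p with rfl | rfl <;> simp [sgn]

variable {k}
variable {V : Type*} [AddCommGroup V] [Module k V]

/-- A superspace structure on `V` is a family `gr : ZMod 2 → Submodule k V` together with
`DirectSum.Decomposition gr`.  This is the projection to the part of parity `p`. -/
noncomputable def pr (gr : ZMod 2 → Submodule k V) [DirectSum.Decomposition gr] (p : ZMod 2) :
    V →ₗ[k] V :=
  (gr p).subtype ∘ₗ DirectSum.component k (ZMod 2) (fun i => gr i) p ∘ₗ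
    (DirectSum.decomposeLinearEquiv gr).toLinearMap

section

variable (gr : ZMod 2 → Submodule k V) [DirectSum.Decomposition gr]

theorem pr_eq (p : ZMod 2) (v : V) : pr gr p v = (DirectSum.decompose gr v p : V) := rfl

theorem pr_mem (p : ZMod 2) (v : V) : pr gr p v ∈ gr p := by
  rw [pr_eq]; exact Subtype.property _

theorem pr_of_mem {p q : ZMod 2} {v : V} (h : v ∈ gr q) :
    pr gr p v = if p = q then v else 0 := by
  rw [pr_eq]
  split_ifs with hpq
  · subst hpq; exact DirectSum.decompose_of_mem_same gr h
  · exact DirectSum.decompose_of_mem_ne gr h (fun e => hpq e.symm)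

theorem pr_add (v : V) : pr gr 0 v + pr gr 1 v = v := by
  classical
  have h := DirectSum.sum_support_decompose gr v
  conv_rhs => rw [← h]
  rw [pr_eq, pr_eq]
  have : ∑ i ∈ DFinsupp.support (DirectSum.decompose gr v), (DirectSum.decompose gr v i : V)
      = ∑ i : ZMod 2, (DirectSum.decompose gr v i : V) := by
    apply Finset.sum_subset (Finset.subset_univ _)
    intro i _ hi
    simpa using hi
  rw [this]
  exact (Fin.sum_univ_two (fun i : Fin 2 => (DirectSum.decompose gr v (i : ZMod 2) : V))).symm

/-- The linear map `v ↦ (-1)^{q v̄} v`. -/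
noncomputable def tw (q : ZMod 2) : V →ₗ[k] V := pr gr 0 + sgn k q • pr gr 1

theorem tw_of_mem {p : ZMod 2} (q : ZMod 2) {v : V} (h : v ∈ gr p) :
    tw gr q v = sgn k (p * q) • v := by
  have h0 := pr_of_mem gr (p := 0) h
  have h1 := pr_of_mem gr (p := 1) h
  simp only [tw, LinearMap.add_apply, LinearMap.smul_apply, h0, h1]
  rcases parity_cases p with rfl | rfl <;> simp [sgn]

variable {gr}

theorem ext_homog {W : Type*} [AddCommGroup W] [Module k W] {f g : V →ₗ[k] W}
    (h : ∀ p v, v ∈ gr p → f v = g v) : f = g := by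
  ext v
  rw [← pr_add gr v, map_add, map_add, h 0 _ (pr_mem gr 0 v), h 1 _ (pr_mem gr 1 v)]

end

/-- A decomposition given by projections. -/
@[reducible] noncomputable def decompositionOfProj (gr : ZMod 2 → Submodule k V)
    (P : ZMod 2 → V →ₗ[k] V)
    (hmem : ∀ p v, P p v ∈ gr p) (hadd : ∀ v, P 0 v + P 1 v = v)
    (hproj : ∀ p q v, v ∈ gr q → P p v = if p = q then v else 0) :
    DirectSum.Decomposition gr :=
  DirectSum.Decomposition.ofLinearMap gr
    (DirectSum.lof k (ZMod 2) (fun i => gr i) 0 ∘ₗ (P 0).codRestrict (gr 0) (hmem 0) +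
      DirectSum.lof k (ZMod 2) (fun i => gr i) 1 ∘ₗ (P 1).codRestrict (gr 1) (hmem 1))
    (by ext v; simp [hadd])
    (by
      ext i ⟨x, hx⟩ : 2
      have e0 := hproj 0 i x hx
      have e1 := hproj 1 i x hx
      rcases parity_cases i with rfl | rfl
      · have f0 : (P 0).codRestrict (gr 0) (hmem 0) x = ⟨x, hx⟩ := Subtype.ext (by simpa using e0)
        have f1 : (P 1).codRestrict (gr 1) (hmem 1) x = 0 := Subtype.ext (by simpa using e1)
        simp [f0, f1]
      · have f0 : (P 0).codRestrict (gr 0) (hmem 0) x = 0 := Subtype.ext (by simpa using e0)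
        have f1 : (P 1).codRestrict (gr 1) (hmem 1) x = ⟨x, hx⟩ := Subtype.ext (by simpa using e1)
        simp [f0, f1])

end Super

section TensorSuper

variable {k : Type u} [Field k]
variable {V : Type*} [AddCommGroup V] [Module k V] (gr : ZMod 2 → Submodule k V)
variable {W : Type*} [AddCommGroup W] [Module k W] (gr' : ZMod 2 → Submodule k W)

/-- The grading on the tensor product of superspaces: `v ⊗ w` has parity `v̄ + w̄`. -/
def tensorGr (p : ZMod 2) : Submodule k (V ⊗[k] W) :=
  Submodule.span k {t | ∃ a b v w, a + b = p ∧ v ∈ gr a ∧ w ∈ gr' b ∧ t = v ⊗ₜ[k] w}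

variable {gr gr'}

theorem tmul_mem {a b : ZMod 2} {v : V} {w : W} (hv : v ∈ gr a) (hw : w ∈ gr' b) :
    v ⊗ₜ[k] w ∈ tensorGr gr gr' (a + b) :=
  Submodule.subset_span ⟨a, b, v, w, rfl, hv, hw, rfl⟩

theorem tmul_mem' {a b c : ZMod 2} {v : V} {w : W} (hv : v ∈ gr a) (hw : w ∈ gr' b)
    (h : a + b = c) : v ⊗ₜ[k] w ∈ tensorGr gr gr' c := h ▸ tmul_mem hv hw

/-- To check that a linear map sends `tensorGr gr gr' c` into `S`, look at pure tensors. -/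
theorem tensorGr_le {U : Type*} [AddCommGroup U] [Module k U] {S : Submodule k U} {c : ZMod 2}
    (f : V ⊗[k] W →ₗ[k] U)
    (h : ∀ a b v w, a + b = c → v ∈ gr a → w ∈ gr' b → f (v ⊗ₜ w) ∈ S) :
    ∀ t ∈ tensorGr gr gr' c, f t ∈ S := by
  intro t ht
  have : tensorGr gr gr' c ≤ S.comap f := by
    refine Submodule.span_le.2 ?_
    rintro _ ⟨a, b, v, w, hc, hv, hw, rfl⟩
    exact h a b v w hc hv hw
  exact this ht

variable [DirectSum.Decomposition gr] [DirectSum.Decomposition gr']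

theorem ext_tensor {U : Type*} [AddCommGroup U] [Module k U] {f g : V ⊗[k] W →ₗ[k] U}
    (h : ∀ a b v w, v ∈ gr a → w ∈ gr' b → f (v ⊗ₜ w) = g (v ⊗ₜ w)) : f = g := by
  apply TensorProduct.ext
  refine ext_homog (gr := gr) fun a v hv => ext_homog (gr := gr') fun b w hw => h a b v w hv hw

variable (gr gr')

/-- The projection of a tensor product of superspaces to its part of parity `p`. -/
noncomputable def tensorPr (p : ZMod 2) : V ⊗[k] W →ₗ[k] V ⊗[k] W :=
  TensorProduct.map (pr gr 0) (pr gr' p) + TensorProduct.map (pr gr 1) (pr gr' (p + 1))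

noncomputable instance tensorDec : DirectSum.Decomposition (tensorGr gr gr') :=
  decompositionOfProj _ (tensorPr gr gr')
    (by
      intro p t
      induction t using TensorProduct.induction_on with
      | zero => simp
      | add x y hx hy => rw [map_add]; exact add_mem hx hy
      | tmul v w =>
        simp only [tensorPr, LinearMap.add_apply, TensorProduct.map_tmul]
        have h : 1 + (p + 1) = p := by decide +revert
        exact add_mem (tmul_mem' (pr_mem _ _ _) (pr_mem _ _ _) (zero_add p))
          (tmul_mem' (pr_mem _ _ _) (pr_mem _ _ _) h))
    (by
      intro t
      induction t using TensorProduct.induction_on with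
      | zero => simp
      | add x y hx hy =>
        rw [map_add, map_add]
        conv_rhs => rw [← hx, ← hy]
        abel
      | tmul v w =>
        have h : (1 + 1 : ZMod 2) = 0 := by decide
        simp only [tensorPr, LinearMap.add_apply, TensorProduct.map_tmul, zero_add, h]
        conv_rhs => rw [← pr_add gr v, ← pr_add gr' w]
        simp only [TensorProduct.tmul_add, TensorProduct.add_tmul]
        abel)
    (by
      intro p q
      have key : ∀ t ∈ tensorGr gr gr' q,
          (tensorPr gr gr' p - (if p = q then LinearMap.id else 0 : V ⊗[k] W →ₗ[k] V ⊗[k] W)) t ∈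
            (⊥ : Submodule k (V ⊗[k] W)) := by
        apply tensorGr_le
        intro a b v w hc hv hw
        rw [Submodule.mem_bot]
        subst hc
        simp only [tensorPr, LinearMap.sub_apply, LinearMap.add_apply, TensorProduct.map_tmul,
          pr_of_mem gr hv, pr_of_mem gr' hw]
        have h : (1 + 1 : ZMod 2) = 0 := by decide
        rcases parity_cases a with rfl | rfl <;> rcases parity_cases b with rfl | rfl <;>
          rcases parity_cases p with rfl | rfl <;> simp [h]
      intro t ht
      have := key t ht
      rw [Submodule.mem_bot, LinearMap.sub_apply, sub_eq_zero] at this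
      rw [this]
      split_ifs <;> rfl)

end TensorSuper

/-! ### Monoidal supercategories -/

section Supercategories

/-- A supercategory: a category enriched in superspaces over `k`. -/
class Supercategory (k : Type*) [Field k] (C : Type*) [Category C] [Preadditive C]
    [Linear k C] where
  /-- the morphisms of a given parity -/
  homGr (X Y : C) : ZMod 2 → Submodule k (X ⟶ Y)
  homDec (X Y : C) : DirectSum.Decomposition (homGr X Y)
  id_mem (X : C) : 𝟙 X ∈ homGr X X 0
  comp_mem {X Y Z : C} {p q : ZMod 2} {f : X ⟶ Y} {g : Y ⟶ Z} :
    f ∈ homGr X Y p → g ∈ homGr Y Z q → f ≫ g ∈ homGr X Z (p + q)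

attribute [reducible, instance] Supercategory.homDec

open Supercategory (homGr)

/-- A monoidal supercategory (with associativity and unit constraints). Composition is written
in diagrammatic order, so that `f ≫ g` is `g ∘ f`. -/
class MonoidalSupercategory (k : Type*) [Field k] (C : Type*) [Category C] [Preadditive C]
    [Linear k C] [Supercategory k C] where
  tObj : C → C → C
  tUnit : C
  tHom {X X' Y Y' : C} : (X ⟶ X') →ₗ[k] (Y ⟶ Y') →ₗ[k] (tObj X Y ⟶ tObj X' Y')
  tHom_mem {X X' Y Y' : C} {p q : ZMod 2} {f : X ⟶ X'} {g : Y ⟶ Y'} :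
    f ∈ homGr (k := k) X X' p → g ∈ homGr (k := k) Y Y' q →
      tHom f g ∈ homGr (k := k) (tObj X Y) (tObj X' Y') (p + q)
  tHom_id (X Y : C) : tHom (𝟙 X) (𝟙 Y) = 𝟙 (tObj X Y)
  /-- the super interchange law `(f' ⊗ g) ∘ (f ⊗ g') = (-1)^{f̄ ḡ} (f' ∘ f) ⊗ (g ∘ g')` -/
  interchange {X₁ X₂ X₃ Y₁ Y₂ Y₃ : C} {p q : ZMod 2} (f : X₁ ⟶ X₂) (f' : X₂ ⟶ X₃)
    (g' : Y₁ ⟶ Y₂) (g : Y₂ ⟶ Y₃) :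
    f ∈ homGr (k := k) X₁ X₂ p → g ∈ homGr (k := k) Y₂ Y₃ q →
      tHom f g' ≫ tHom f' g = sgn k (p * q) • tHom (f ≫ f') (g' ≫ g)
  assoc (X Y Z : C) : tObj (tObj X Y) Z ≅ tObj X (tObj Y Z)
  lUnit (X : C) : tObj tUnit X ≅ X
  rUnit (X : C) : tObj X tUnit ≅ X
  assoc_mem (X Y Z : C) : (assoc X Y Z).hom ∈ homGr (k := k) _ _ 0
  lUnit_mem (X : C) : (lUnit X).hom ∈ homGr (k := k) _ _ 0
  rUnit_mem (X : C) : (rUnit X).hom ∈ homGr (k := k) _ _ 0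
  assoc_natural {X X' Y Y' Z Z' : C} (f : X ⟶ X') (g : Y ⟶ Y') (h : Z ⟶ Z') :
    tHom (tHom f g) h ≫ (assoc X' Y' Z').hom = (assoc X Y Z).hom ≫ tHom f (tHom g h)
  lUnit_natural {X X' : C} (f : X ⟶ X') :
    tHom (𝟙 tUnit) f ≫ (lUnit X').hom = (lUnit X).hom ≫ f
  rUnit_natural {X X' : C} (f : X ⟶ X') :
    tHom f (𝟙 tUnit) ≫ (rUnit X').hom = (rUnit X).hom ≫ f
  pentagon (W X Y Z : C) :
    tHom (assoc W X Y).hom (𝟙 Z) ≫ (assoc W (tObj X Y) Z).hom ≫ tHom (𝟙 W) (assoc X Y Z).hom =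
      (assoc (tObj W X) Y Z).hom ≫ (assoc W X (tObj Y Z)).hom
  triangle (X Y : C) :
    (assoc X tUnit Y).hom ≫ tHom (𝟙 X) (lUnit Y).hom = tHom (rUnit X).hom (𝟙 Y)

open MonoidalSupercategory

/-- A monoidal superfunctor: a `k`-linear parity-preserving functor with even coherence
isomorphisms `1 ≅ F 1` and `F X ⊗ F Y ≅ F (X ⊗ Y)` satisfying the usual axioms. -/
structure MonoidalSuperfunctor (k : Type*) [Field k]
    (C : Type*) [Category C] [Preadditive C] [Linear k C] [Supercategory k C]
    [MonoidalSupercategory k C]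
    (D : Type*) [Category D] [Preadditive D] [Linear k D] [Supercategory k D]
    [MonoidalSupercategory k D] extends C ⥤ D where
  map_add {X Y : C} (f g : X ⟶ Y) : map (f + g) = map f + map g
  map_smul {X Y : C} (c : k) (f : X ⟶ Y) : map (c • f) = c • map f
  map_mem {X Y : C} {p : ZMod 2} {f : X ⟶ Y} :
    f ∈ homGr (k := k) X Y p → map f ∈ homGr (k := k) (obj X) (obj Y) p
  unitIso : tUnit k (C := D) ≅ obj (tUnit k)
  tensorIso (X Y : C) : tObj k (obj X) (obj Y) ≅ obj (tObj k X Y)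
  unitIso_mem : unitIso.hom ∈ homGr (k := k) _ _ 0
  tensorIso_mem (X Y : C) : (tensorIso X Y).hom ∈ homGr (k := k) _ _ 0
  tensorIso_natural {X X' Y Y' : C} (f : X ⟶ X') (g : Y ⟶ Y') :
    tHom (k := k) (map f) (map g) ≫ (tensorIso X' Y').hom =
      (tensorIso X Y).hom ≫ map (tHom (k := k) f g)
  associativity (X Y Z : C) :
    tHom (k := k) (tensorIso X Y).hom (𝟙 (obj Z)) ≫ (tensorIso (tObj k X Y) Z).hom ≫
        map (assoc (k := k) X Y Z).hom =
      (assoc (k := k) (obj X) (obj Y) (obj Z)).hom ≫ tHom (k := k) (𝟙 (obj X)) (tensorIso Y Z).hom ≫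
        (tensorIso X (tObj k Y Z)).hom
  left_unitality (X : C) :
    tHom (k := k) unitIso.hom (𝟙 (obj X)) ≫ (tensorIso (tUnit k) X).hom ≫
      map (lUnit (k := k) X).hom = (lUnit (k := k) (obj X)).hom
  right_unitality (X : C) :
    tHom (k := k) (𝟙 (obj X)) unitIso.hom ≫ (tensorIso X (tUnit k)).hom ≫
      map (rUnit (k := k) X).hom = (rUnit (k := k) (obj X)).hom

end Supercategories

/-! ### Lie superalgebras and right supermodules -/

/-- A Lie superalgebra over `k`. -/
structure LieSuperalgebra (k : Type u) [Field k] where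
  carrier : Type u
  [addCommGroup : AddCommGroup carrier]
  [module : Module k carrier]
  gr : ZMod 2 → Submodule k carrier
  [dec : DirectSum.Decomposition gr]
  bracket : carrier →ₗ[k] carrier →ₗ[k] carrier
  bracket_mem {p q : ZMod 2} {x y : carrier} : x ∈ gr p → y ∈ gr q → bracket x y ∈ gr (p + q)
  skew {p q : ZMod 2} {x y : carrier} : x ∈ gr p → y ∈ gr q →
    bracket x y = -(sgn k (p * q) • bracket y x)
  jacobi {p q : ZMod 2} {x y : carrier} (z : carrier) : x ∈ gr p → y ∈ gr q →
    bracket x (bracket y z) = bracket (bracket x y) z + sgn k (p * q) • bracket y (bracket x z)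

attribute [instance] LieSuperalgebra.addCommGroup LieSuperalgebra.module LieSuperalgebra.dec

section Modules

variable {k : Type u} [Field k]

/-- A right supermodule over a Lie superalgebra. Here `act x v` is `v · x`. -/
structure SMod (g : LieSuperalgebra k) where
  carrier : Type u
  [addCommGroup : AddCommGroup carrier]
  [module : Module k carrier]
  gr : ZMod 2 → Submodule k carrier
  [dec : DirectSum.Decomposition gr]
  act : g.carrier →ₗ[k] carrier →ₗ[k] carrier
  act_mem {p q : ZMod 2} {v : carrier} {x : g.carrier} : v ∈ gr p → x ∈ g.gr q →
    act x v ∈ gr (p + q)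
  /-- `v · [x, y] = (v · x) · y - (-1)^{x̄ ȳ} (v · y) · x` -/
  act_bracket {p q : ZMod 2} {x y : g.carrier} (v : carrier) : x ∈ g.gr p → y ∈ g.gr q →
    act (g.bracket x y) v = act y (act x v) - sgn k (p * q) • act x (act y v)

attribute [instance] SMod.addCommGroup SMod.module SMod.dec

namespace SMod

variable {g : LieSuperalgebra k}

/-- Homomorphisms of right supermodules, of arbitrary parity: linear maps with
`f (v · x) = f v · x`. -/
def homs (V W : SMod g) : Submodule k (V.carrier →ₗ[k] W.carrier) where
  carrier := {f | ∀ x v, f (V.act x v) = W.act x (f v)}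
  add_mem' := by
    intro a b ha hb x v
    simp only [LinearMap.add_apply, ha x v, hb x v, map_add]
  zero_mem' := by intro x v; simp
  smul_mem' := by
    intro c a ha x v
    simp only [LinearMap.smul_apply, ha x v, map_smul]

instance : Category (SMod g) where
  Hom V W := homs V W
  id V := ⟨LinearMap.id, fun _ _ => rfl⟩
  comp f h := ⟨h.1 ∘ₗ f.1, fun x v => by
    rw [LinearMap.comp_apply, f.2 x v, h.2 x (f.1 v), LinearMap.comp_apply]⟩

/-- The underlying linear map of a homomorphism. -/
def lin {V W : SMod g} (f : V ⟶ W) : V.carrier →ₗ[k] W.carrier := Subtype.val f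

/-- Make a homomorphism out of a linear map. -/
def ofLin {V W : SMod g} (f : V.carrier →ₗ[k] W.carrier)
    (h : ∀ x v, f (V.act x v) = W.act x (f v)) : V ⟶ W := ⟨f, h⟩

theorem lin_act {V W : SMod g} (f : V ⟶ W) (x : g.carrier) (v : V.carrier) :
    lin f (V.act x v) = W.act x (lin f v) := Subtype.property f x v

theorem hom_ext {V W : SMod g} {f h : V ⟶ W} (e : lin f = lin h) : f = h := Subtype.ext e

@[simp] theorem lin_ofLin {V W : SMod g} (f : V.carrier →ₗ[k] W.carrier)
    (h : ∀ x v, f (V.act x v) = W.act x (f v)) : lin (ofLin f h : V ⟶ W) = f := rfl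

@[simp] theorem lin_id (V : SMod g) : lin (𝟙 V) = LinearMap.id := rfl

@[simp] theorem lin_comp {V W U : SMod g} (f : V ⟶ W) (h : W ⟶ U) :
    lin (f ≫ h) = lin h ∘ₗ lin f := rfl

instance : Preadditive (SMod g) where
  homGroup V W := inferInstanceAs (AddCommGroup (homs V W))
  add_comp _ _ _ f f' h := Subtype.ext (LinearMap.ext fun v => map_add (lin h) (lin f v) (lin f' v))
  comp_add _ _ _ _ _ _ := Subtype.ext (LinearMap.ext fun _ => rfl)

instance : Linear k (SMod g) where
  homModule V W := inferInstanceAs (Module k (homs V W))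
  smul_comp _ _ _ c f h := Subtype.ext (LinearMap.ext fun v => map_smul (lin h) c (lin f v))
  comp_smul _ _ _ _ _ _ := Subtype.ext (LinearMap.ext fun _ => rfl)

@[simp] theorem lin_add {V W : SMod g} (f h : V ⟶ W) : lin (f + h) = lin f + lin h := rfl

@[simp] theorem lin_smul {V W : SMod g} (c : k) (f : V ⟶ W) : lin (c • f) = c • lin f := rfl

@[simp] theorem lin_zero {V W : SMod g} : lin (0 : V ⟶ W) = 0 := rfl

section Linear

variable {V W : Type*} [AddCommGroup V] [Module k V] [AddCommGroup W] [Module k W]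
  (gr : ZMod 2 → Submodule k V) (gr' : ZMod 2 → Submodule k W)
  [DirectSum.Decomposition gr] [DirectSum.Decomposition gr']

/-- The component of parity `q` of a linear map. -/
noncomputable def linPr (q : ZMod 2) : (V →ₗ[k] W) →ₗ[k] (V →ₗ[k] W) where
  toFun f := pr gr' q ∘ₗ f ∘ₗ pr gr 0 + pr gr' (q + 1) ∘ₗ f ∘ₗ pr gr 1
  map_add' f h := by ext v; simp; abel
  map_smul' c f := by ext v; simp

variable {gr gr'}

theorem linPr_apply (q : ZMod 2) (f : V →ₗ[k] W) {p : ZMod 2} {v : V} (hv : v ∈ gr p) :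
    linPr gr gr' q f v = pr gr' (q + p) (f v) := by
  simp only [linPr, LinearMap.coe_mk, AddHom.coe_mk, LinearMap.add_apply, LinearMap.comp_apply,
    pr_of_mem gr hv]
  rcases parity_cases p with rfl | rfl <;> simp

theorem linPr_add (f : V →ₗ[k] W) : linPr gr gr' 0 f + linPr gr gr' 1 f = f := by
  refine ext_homog (gr := gr) fun p v hv => ?_
  rw [LinearMap.add_apply, linPr_apply _ _ hv, linPr_apply _ _ hv]
  have h : (1 + 1 : ZMod 2) = 0 := by decide
  conv_rhs => rw [← pr_add gr' (f v)]
  rcases parity_cases p with rfl | rfl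
  · simp
  · simp only [zero_add, h]; abel

theorem linPr_of (p q : ZMod 2) (f : V →ₗ[k] W) (hf : ∀ a v, v ∈ gr a → f v ∈ gr' (a + q)) :
    linPr gr gr' p f = if p = q then f else 0 := by
  refine ext_homog (gr := gr) fun a v hv => ?_
  rw [linPr_apply _ _ hv, pr_of_mem gr' (hf a v hv), add_comm a q]
  by_cases h : p = q <;> simp [h]

end Linear

/-- The homomorphisms of parity `p`. -/
def homGr (V W : SMod g) (p : ZMod 2) : Submodule k (V ⟶ W) where
  carrier := {f | ∀ q v, v ∈ V.gr q → lin f v ∈ W.gr (q + p)}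
  add_mem' := fun ha hb q v hv => add_mem (ha q v hv) (hb q v hv)
  zero_mem' := fun q _ _ => (W.gr (q + p)).zero_mem
  smul_mem' := fun c _ ha q v hv => (W.gr (q + p)).smul_mem c (ha q v hv)

theorem mem_homGr {V W : SMod g} {p : ZMod 2} {f : V ⟶ W} :
    f ∈ homGr V W p ↔ ∀ q v, v ∈ V.gr q → lin f v ∈ W.gr (q + p) := Iff.rfl

theorem pr_act (V : SMod g) (p q : ZMod 2) (v : V.carrier) {x : g.carrier} (hx : x ∈ g.gr q) :
    pr V.gr (p + q) (V.act x v) = V.act x (pr V.gr p v) := by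
  have : pr V.gr (p + q) ∘ₗ V.act x = V.act x ∘ₗ pr V.gr p := by
    refine ext_homog (gr := V.gr) fun a v hv => ?_
    simp only [LinearMap.comp_apply, pr_of_mem V.gr hv, pr_of_mem V.gr (V.act_mem hv hx)]
    by_cases h : p = a <;> simp [h]
  exact LinearMap.congr_fun this v

/-- To check equivariance, look at homogeneous elements. -/
theorem equivariant_of_homog {V W : SMod g} (f : V.carrier →ₗ[k] W.carrier)
    (h : ∀ p q x v, x ∈ g.gr p → v ∈ V.gr q → f (V.act x v) = W.act x (f v)) :
    ∀ x v, f (V.act x v) = W.act x (f v) := by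
  intro x v
  have : V.act.compr₂ f = (W.act.compl₂ f) := by
    refine ext_homog (gr := g.gr) fun p x hx => ext_homog (gr := V.gr) fun q v hv => ?_
    simpa using h p q x v hx hv
  simpa using LinearMap.congr_fun₂ this x v

/-- The component of parity `p` of a homomorphism. -/
noncomputable def homPr (V W : SMod g) (p : ZMod 2) : (V ⟶ W) →ₗ[k] (V ⟶ W) where
  toFun f := ofLin (linPr V.gr W.gr p (lin f)) (by
    apply equivariant_of_homog
    intro a b x v hx hv
    rw [linPr_apply _ _ hv, linPr_apply _ _ (V.act_mem hv hx), lin_act, ← add_assoc,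
      pr_act _ _ _ _ hx])
  map_add' f h := hom_ext (map_add (linPr V.gr W.gr p) (lin f) (lin h))
  map_smul' c f := hom_ext (map_smul (linPr V.gr W.gr p) c (lin f))

@[simp] theorem lin_homPr {V W : SMod g} (p : ZMod 2) (f : V ⟶ W) :
    lin (homPr V W p f) = linPr V.gr W.gr p (lin f) := rfl

noncomputable instance homDec (V W : SMod g) : DirectSum.Decomposition (homGr V W) :=
  decompositionOfProj _ (homPr V W)
    (by
      intro p f q v hv
      rw [lin_homPr, linPr_apply _ _ hv, add_comm q p]
      exact pr_mem _ _ _)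
    (fun f => hom_ext (linPr_add (lin f)))
    (by
      intro p q f hf
      apply hom_ext
      rw [lin_homPr, linPr_of p q (lin f) hf]
      split_ifs <;> rfl)

noncomputable instance : Supercategory k (SMod g) where
  homGr := homGr
  homDec := homDec
  id_mem V := by intro q v hv; simpa using hv
  comp_mem := by
    intro U V W p q f h hf hh a v hv
    rw [← add_assoc]
    exact hh _ _ (hf _ _ hv)

/-! The tensor product of right supermodules -/

theorem ext_tensor3 {U V W X : Type*} [AddCommGroup U] [Module k U] [AddCommGroup V] [Module k V]
    [AddCommGroup W] [Module k W] [AddCommGroup X] [Module k X]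
    {gU : ZMod 2 → Submodule k U} {gV : ZMod 2 → Submodule k V} {gW : ZMod 2 → Submodule k W}
    [DirectSum.Decomposition gU] [DirectSum.Decomposition gV] [DirectSum.Decomposition gW]
    {f h : (U ⊗[k] V) ⊗[k] W →ₗ[k] X}
    (e : ∀ a b c u v w, u ∈ gU a → v ∈ gV b → w ∈ gW c →
      f ((u ⊗ₜ v) ⊗ₜ w) = h ((u ⊗ₜ v) ⊗ₜ w)) : f = h := by
  apply TensorProduct.ext
  refine ext_tensor (gr := gU) (gr' := gV) fun a b u v hu hv =>
    ext_homog (gr := gW) fun c w hw => e a b c u v w hu hv hw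

/-- The action on the tensor product, `(v ⊗ w) · x = v ⊗ (w · x) + (-1)^{w̄ x̄} (v · x) ⊗ w`. -/
noncomputable def tAct (V W : SMod g) :
    g.carrier →ₗ[k] (V.carrier ⊗[k] W.carrier) →ₗ[k] (V.carrier ⊗[k] W.carrier) where
  toFun x := TensorProduct.map LinearMap.id (W.act x) +
    ∑ q : ZMod 2, TensorProduct.map (V.act (pr g.gr q x)) (tw W.gr q)
  map_add' x y := by
    simp only [map_add, TensorProduct.map_add_left, TensorProduct.map_add_right,
      Finset.sum_add_distrib]
    abel
  map_smul' c x := by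
    simp only [map_smul, TensorProduct.map_smul_left, TensorProduct.map_smul_right, smul_add,
      Finset.smul_sum, RingHom.id_apply]

theorem tAct_tmul (V W : SMod g) {b q : ZMod 2} {x : g.carrier} {v : V.carrier} {w : W.carrier}
    (hx : x ∈ g.gr q) (hw : w ∈ W.gr b) :
    tAct V W x (v ⊗ₜ w) = v ⊗ₜ W.act x w + sgn k (b * q) • (V.act x v ⊗ₜ[k] w) := by
  simp only [tAct, LinearMap.coe_mk, AddHom.coe_mk, LinearMap.add_apply, LinearMap.sum_apply,
    TensorProduct.map_tmul, LinearMap.id_apply, pr_of_mem g.gr hx, tw_of_mem W.gr _ hw]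
  congr 1
  rw [Finset.sum_eq_single q]
  · rw [if_pos rfl, TensorProduct.tmul_smul]
  · intro p _ hp; simp [hp]
  · simp

/-- The tensor product of right supermodules. -/
noncomputable abbrev tensor (V W : SMod g) : SMod g where
  carrier := V.carrier ⊗[k] W.carrier
  gr := tensorGr V.gr W.gr
  dec := tensorDec V.gr W.gr
  act := tAct V W
  act_mem := by
    intro p q t x ht hx
    revert t
    apply tensorGr_le
    intro a b v w h hv hw
    rw [tAct_tmul V W hx hw]
    subst h
    exact add_mem (tmul_mem' hv (W.act_mem hw hx) (by ring))
      (Submodule.smul_mem _ _ (tmul_mem' (V.act_mem hv hx) hw (by ring)))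
  act_bracket := by
    intro p q x y t hx hy
    have : tAct V W (g.bracket x y) =
        tAct V W y ∘ₗ tAct V W x - sgn k (p * q) • (tAct V W x ∘ₗ tAct V W y) := by
      refine ext_tensor (gr := V.gr) (gr' := W.gr) fun a b v w hv hw => ?_
      simp only [LinearMap.sub_apply, LinearMap.smul_apply, LinearMap.comp_apply]
      rw [tAct_tmul V W (g.bracket_mem hx hy) hw, tAct_tmul V W hx hw, tAct_tmul V W hy hw]
      simp only [map_add, map_smul]
      rw [tAct_tmul V W hx hw, tAct_tmul V W hy hw, tAct_tmul V W hy (W.act_mem hw hx),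
        tAct_tmul V W hx (W.act_mem hw hy), W.act_bracket w hx hy, V.act_bracket v hx hy]
      simp only [TensorProduct.tmul_sub, TensorProduct.sub_tmul, TensorProduct.tmul_smul,
        smul_add, smul_sub, TensorProduct.smul_tmul', smul_smul, ← sgn_add]
      have e1 : (b + p) * q = b * q + p * q := by ring
      have e2 : p * q + (b + q) * p = b * p := by
        have : p * q + p * q = 0 := CharTwo.add_self_eq_zero _
        linear_combination this
      have e3 : p * q + b * p = b * p + p * q := by ring
      have e4 : p * q + b * q = b * q + p * q := by ring
      have e5 : b * (p + q) = b * p + b * q := by ring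
      have e6 : b * q + b * p = b * p + b * q := by ring
      have e7 : b * (p + q) + p * q = p * q + (b * q + b * p) := by ring
      rw [e7, e2, e1, e5, e4, e6]
      abel
    rw [this]
    rfl

/-- The purely even grading on the ground field. -/
def unitGr (k : Type u) [Field k] (p : ZMod 2) : Submodule k k := if p = 0 then ⊤ else ⊥

noncomputable instance unitDec (k : Type u) [Field k] : DirectSum.Decomposition (unitGr k) :=
  decompositionOfProj _ (fun p => if p = 0 then LinearMap.id else 0)
    (by intro p v; by_cases h : p = 0 <;> simp [h, unitGr])
    (by intro v; simp)
    (by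
      intro p q v hv
      by_cases h : q = 0
      · subst h; split_ifs <;> rfl
      · rw [unitGr, if_neg h, Submodule.mem_bot] at hv
        subst hv; simp)

/-- The trivial module. -/
noncomputable abbrev unit (g : LieSuperalgebra k) : SMod g where
  carrier := k
  gr := unitGr k
  dec := unitDec k
  act := 0
  act_mem := by intro p q v x _ _; simp
  act_bracket := by intro p q x y v _ _; simp

theorem unit_mem (c : k) : c ∈ (unit g).gr 0 := by
  change c ∈ unitGr k 0
  simp [unitGr]

@[simp] theorem unit_act (x : g.carrier) (c : (unit g).carrier) : (unit g).act x c = 0 := rfl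

section LinTensor

variable {V V' W W' : Type*} [AddCommGroup V] [Module k V] [AddCommGroup W] [Module k W]
  [AddCommGroup V'] [Module k V'] [AddCommGroup W'] [Module k W']
  (gV : ZMod 2 → Submodule k V) (gW : ZMod 2 → Submodule k W) (gW' : ZMod 2 → Submodule k W')
  [DirectSum.Decomposition gV] [DirectSum.Decomposition gW] [DirectSum.Decomposition gW']

/-- The tensor product of linear maps, `(f ⊗ h)(v ⊗ w) = (-1)^{h̄ v̄} f v ⊗ h w`. -/
noncomputable def linTensor :
    (V →ₗ[k] V') →ₗ[k] (W →ₗ[k] W') →ₗ[k] ((V ⊗[k] W) →ₗ[k] (V' ⊗[k] W')) :=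
  LinearMap.mk₂ k
    (fun f h => ∑ q : ZMod 2, TensorProduct.map (f ∘ₗ tw gV q) (linPr gW gW' q h))
    (by
      intro a b h
      rw [← Finset.sum_add_distrib]
      simp only [LinearMap.add_comp, TensorProduct.map_add_left])
    (by
      intro c f h
      rw [Finset.smul_sum]
      simp only [LinearMap.smul_comp, TensorProduct.map_smul_left])
    (by
      intro f a b
      rw [← Finset.sum_add_distrib]
      simp only [map_add, TensorProduct.map_add_right])
    (by
      intro c f h
      rw [Finset.smul_sum]
      simp only [map_smul, TensorProduct.map_smul_right])

variable {gV gW gW'}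

theorem linTensor_tmul (f : V →ₗ[k] V') {h : W →ₗ[k] W'} {a q : ZMod 2} {v : V} (w : W)
    (hv : v ∈ gV a) (hh : ∀ b w, w ∈ gW b → h w ∈ gW' (b + q)) :
    linTensor gV gW gW' f h (v ⊗ₜ[k] w) = sgn k (a * q) • (f v ⊗ₜ[k] h w) := by
  simp only [linTensor, LinearMap.mk₂_apply]
  rw [LinearMap.sum_apply, Finset.sum_eq_single q]
  · rw [TensorProduct.map_tmul, linPr_of q q h hh, if_pos rfl, LinearMap.comp_apply,
      tw_of_mem gV q hv, map_smul, TensorProduct.smul_tmul']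
  · intro p _ hp
    rw [TensorProduct.map_tmul, linPr_of p q h hh, if_neg hp, LinearMap.zero_apply,
      TensorProduct.tmul_zero]
  · simp

end LinTensor

/-- To prove a property of the tensor product of morphisms we may assume them homogeneous. -/
theorem hom_homog {V W : SMod g} {P : (V ⟶ W) → Prop} (hadd : ∀ a b, P a → P b → P (a + b))
    (h : ∀ p f, f ∈ homGr V W p → P f) (f : V ⟶ W) : P f := by
  rw [← pr_add (homGr V W) f]
  exact hadd _ _ (h 0 _ (pr_mem _ _ _)) (h 1 _ (pr_mem _ _ _))

theorem linTensor_equivariant {V V' W W' : SMod g} (f : V ⟶ V') (h : W ⟶ W') :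
    ∀ x t, linTensor V.gr W.gr W'.gr (lin f) (lin h) ((tensor V W).act x t) =
      (tensor V' W').act x (linTensor V.gr W.gr W'.gr (lin f) (lin h) t) := by
  induction h using hom_homog with
  | hadd a b ha hb =>
    intro x t
    simp only [lin_add, map_add, LinearMap.add_apply, ha x t, hb x t]
  | h q h hh =>
    intro x t
    revert x t
    have key : (tensor V W).act.compr₂ (linTensor V.gr W.gr W'.gr (lin f) (lin h)) =
        (tensor V' W').act.compl₂ (linTensor V.gr W.gr W'.gr (lin f) (lin h)) := by
      refine ext_homog (gr := g.gr) fun r x hx =>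
        ext_tensor (gr := V.gr) (gr' := W.gr) fun a b v w hv hw => ?_
      change linTensor V.gr W.gr W'.gr (lin f) (lin h) (tAct V W x (v ⊗ₜ[k] w)) =
        tAct V' W' x (linTensor V.gr W.gr W'.gr (lin f) (lin h) (v ⊗ₜ[k] w))
      rw [tAct_tmul V W hx hw, linTensor_tmul _ _ hv hh, map_add, map_smul, map_smul,
        linTensor_tmul _ _ hv hh, linTensor_tmul _ _ (V.act_mem hv hx) hh,
        tAct_tmul V' W' hx (hh _ _ hw), lin_act, lin_act]
      simp only [smul_add, smul_smul, ← sgn_add]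
      congr 3
      ring
    intro x t
    exact LinearMap.congr_fun₂ key x t

/-- The tensor product of homomorphisms. -/
noncomputable def tensorHom (V V' W W' : SMod g) :
    (V ⟶ V') →ₗ[k] (W ⟶ W') →ₗ[k] (tensor V W ⟶ tensor V' W') :=
  LinearMap.mk₂ k
    (fun f h => ofLin (linTensor V.gr W.gr W'.gr (lin f) (lin h)) (linTensor_equivariant f h))
    (by intro a b h; apply hom_ext; simp only [lin_ofLin, lin_add, map_add, LinearMap.add_apply])
    (by intro c f h; apply hom_ext; simp only [lin_ofLin, lin_smul, map_smul, LinearMap.smul_apply])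
    (by intro f a b; apply hom_ext; simp only [lin_ofLin, lin_add, map_add])
    (by intro c f h; apply hom_ext; simp only [lin_ofLin, lin_smul, map_smul])

theorem tensorHom_tmul {V V' W W' : SMod g} (f : V ⟶ V') {h : W ⟶ W'} {a q : ZMod 2}
    {v : V.carrier} (w : W.carrier) (hv : v ∈ V.gr a) (hh : h ∈ homGr W W' q) :
    lin (tensorHom V V' W W' f h) (v ⊗ₜ[k] w) =
      sgn k (a * q) • (lin f v ⊗ₜ[k] lin h w) := linTensor_tmul _ _ hv hh

theorem tensor_hom_ext {V W U : SMod g} {f h : tensor V W ⟶ U}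
    (e : ∀ a b v w, v ∈ V.gr a → w ∈ W.gr b → lin f (v ⊗ₜ[k] w) = lin h (v ⊗ₜ[k] w)) :
    f = h := hom_ext (ext_tensor e)

theorem tensor_mem {V W : SMod g} {a b : ZMod 2} {v : V.carrier} {w : W.carrier}
    (hv : v ∈ V.gr a) (hw : w ∈ W.gr b) : v ⊗ₜ[k] w ∈ (tensor V W).gr (a + b) := tmul_mem hv hw

theorem id_even (V : SMod g) : 𝟙 V ∈ homGr V V 0 := Supercategory.id_mem (k := k) V

/-- An isomorphism from an equivariant linear equivalence. -/
def isoOfEquiv {V W : SMod g} (e : V.carrier ≃ₗ[k] W.carrier)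
    (h : ∀ x v, e (V.act x v) = W.act x (e v)) : V ≅ W where
  hom := ofLin e.toLinearMap h
  inv := ofLin e.symm.toLinearMap (fun x w => by
    rw [LinearEquiv.coe_coe, LinearEquiv.symm_apply_eq, h, LinearEquiv.apply_symm_apply])
  hom_inv_id := hom_ext (by ext v; simp)
  inv_hom_id := hom_ext (by ext v; simp)

/-- The associativity constraint. -/
noncomputable def assocIso (U V W : SMod g) :
    tensor (tensor U V) W ≅ tensor U (tensor V W) :=
  isoOfEquiv (TensorProduct.assoc k U.carrier V.carrier W.carrier) (by
    apply equivariant_of_homog (V := tensor (tensor U V) W) (W := tensor U (tensor V W))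
      (TensorProduct.assoc k U.carrier V.carrier W.carrier).toLinearMap
    intro p q x t hx _
    have : (TensorProduct.assoc k U.carrier V.carrier W.carrier).toLinearMap ∘ₗ
          tAct (tensor U V) W x =
        tAct U (tensor V W) x ∘ₗ
          (TensorProduct.assoc k U.carrier V.carrier W.carrier).toLinearMap := by
      refine ext_tensor3 (gU := U.gr) (gV := V.gr) (gW := W.gr) fun a b c u v w hu hv hw => ?_
      simp only [LinearMap.comp_apply, LinearEquiv.coe_coe]
      rw [tAct_tmul (tensor U V) W hx hw, tAct_tmul U V hx hv, TensorProduct.assoc_tmul,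
        tAct_tmul U (tensor V W) hx (tmul_mem hv hw), tAct_tmul V W hx hw]
      simp only [map_add, map_smul, TensorProduct.add_tmul, TensorProduct.tmul_add,
        ← TensorProduct.smul_tmul', TensorProduct.tmul_smul, TensorProduct.assoc_tmul, smul_add,
        smul_smul, ← sgn_add]
      rw [add_assoc]
      congr 4
      ring
    exact LinearMap.congr_fun this t)

/-- The left unit constraint. -/
noncomputable def lUnitIso (V : SMod g) : tensor (unit g) V ≅ V :=
  isoOfEquiv (TensorProduct.lid k V.carrier) (by
    apply equivariant_of_homog (V := tensor (unit g) V) (W := V)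
      (TensorProduct.lid k V.carrier).toLinearMap
    intro p q x t hx _
    have : (TensorProduct.lid k V.carrier).toLinearMap ∘ₗ tAct (unit g) V x =
        V.act x ∘ₗ (TensorProduct.lid k V.carrier).toLinearMap := by
      refine ext_tensor (gr := (unit g).gr) (gr' := V.gr) fun a b u v hu hv => ?_
      simp only [LinearMap.comp_apply, LinearEquiv.coe_coe]
      rw [tAct_tmul (unit g) V hx hv, unit_act, TensorProduct.zero_tmul, smul_zero, add_zero,
        TensorProduct.lid_tmul, TensorProduct.lid_tmul, map_smul]
    exact LinearMap.congr_fun this t)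

/-- The right unit constraint. -/
noncomputable def rUnitIso (V : SMod g) : tensor V (unit g) ≅ V :=
  isoOfEquiv (TensorProduct.rid k V.carrier) (by
    apply equivariant_of_homog (V := tensor V (unit g)) (W := V)
      (TensorProduct.rid k V.carrier).toLinearMap
    intro p q x t hx _
    have : (TensorProduct.rid k V.carrier).toLinearMap ∘ₗ tAct V (unit g) x =
        V.act x ∘ₗ (TensorProduct.rid k V.carrier).toLinearMap := by
      apply TensorProduct.ext
      refine LinearMap.ext fun v => LinearMap.ext fun c => ?_
      change TensorProduct.rid k V.carrier (tAct V (unit g) x (v ⊗ₜ c)) =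
        V.act x (TensorProduct.rid k V.carrier (v ⊗ₜ c))
      rw [tAct_tmul V (unit g) hx (unit_mem c), unit_act, TensorProduct.tmul_zero, zero_add,
        zero_mul, sgn_zero, one_smul, TensorProduct.rid_tmul, TensorProduct.rid_tmul, map_smul]
    exact LinearMap.congr_fun this t)

theorem lin_assoc (U V W : SMod g) (u : U.carrier) (v : V.carrier) (w : W.carrier) :
    lin (assocIso U V W).hom ((u ⊗ₜ[k] v) ⊗ₜ[k] w) = u ⊗ₜ[k] (v ⊗ₜ[k] w) := rfl

theorem lin_lUnit (V : SMod g) (c : k) (v : V.carrier) :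
    lin (lUnitIso V).hom (c ⊗ₜ[k] v) = c • v := rfl

theorem lin_rUnit (V : SMod g) (v : V.carrier) (c : k) :
    lin (rUnitIso V).hom (v ⊗ₜ[k] c) = c • v := rfl

theorem tensorHom_mem {V V' W W' : SMod g} {p q : ZMod 2} {f : V ⟶ V'} {h : W ⟶ W'}
    (hf : f ∈ homGr V V' p) (hh : h ∈ homGr W W' q) :
    tensorHom V V' W W' f h ∈ homGr (tensor V W) (tensor V' W') (p + q) := by
  intro c t ht
  revert t
  apply tensorGr_le
  intro a b v w hc hv hw
  rw [tensorHom_tmul f w hv hh]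
  subst hc
  exact Submodule.smul_mem _ _ (tmul_mem' (hf _ _ hv) (hh _ _ hw) (by ring))

theorem tensor_hom_ext3 {U V W X : SMod g} {f h : tensor (tensor U V) W ⟶ X}
    (e : ∀ a b c u v w, u ∈ U.gr a → v ∈ V.gr b → w ∈ W.gr c →
      lin f ((u ⊗ₜ[k] v) ⊗ₜ[k] w) = lin h ((u ⊗ₜ[k] v) ⊗ₜ[k] w)) :
    f = h := hom_ext (ext_tensor3 e)

theorem assoc_mem (U V W : SMod g) : (assocIso U V W).hom ∈ homGr _ _ 0 := by
  intro p
  rw [add_zero]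
  apply tensorGr_le
  intro d c s w h hs hw
  have key : ∀ s ∈ tensorGr U.gr V.gr d,
      (lin (assocIso U V W).hom ∘ₗ
        (TensorProduct.mk k (U.carrier ⊗[k] V.carrier) W.carrier).flip w) s ∈
      (tensor U (tensor V W)).gr p := by
    apply tensorGr_le
    intro a b u v hd hu hv
    change lin (assocIso U V W).hom ((u ⊗ₜ[k] v) ⊗ₜ[k] w) ∈ _
    rw [lin_assoc]
    subst hd; subst h
    exact tmul_mem' hu (tmul_mem hv hw) (by ring)
  exact key s hs

theorem tensorHom_even {V V' W W' : SMod g} (f : V ⟶ V') {h : W ⟶ W'} (hh : h ∈ homGr W W' 0)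
    (v : V.carrier) (w : W.carrier) :
    lin (tensorHom V V' W W' f h) (v ⊗ₜ[k] w) = lin f v ⊗ₜ[k] lin h w := by
  rw [← pr_add V.gr v, TensorProduct.add_tmul, map_add, map_add, TensorProduct.add_tmul,
    tensorHom_tmul f w (pr_mem V.gr 0 v) hh, tensorHom_tmul f w (pr_mem V.gr 1 v) hh,
    mul_zero, mul_zero, sgn_zero, one_smul, one_smul]

theorem lUnit_mem (V : SMod g) : (lUnitIso V).hom ∈ homGr _ _ 0 := by
  intro p
  apply tensorGr_le
  intro a b c v h hc hv
  change lin (lUnitIso V).hom (c ⊗ₜ[k] v) ∈ _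
  rw [lin_lUnit]
  by_cases ha : a = 0
  · subst ha
    rw [zero_add] at h
    subst h
    rw [add_zero]
    exact Submodule.smul_mem _ _ hv
  · have : c = 0 := by
      change c ∈ unitGr k a at hc
      rwa [unitGr, if_neg ha, Submodule.mem_bot] at hc
    subst this
    rw [zero_smul]; exact zero_mem _

theorem rUnit_mem (V : SMod g) : (rUnitIso V).hom ∈ homGr _ _ 0 := by
  intro p
  apply tensorGr_le
  intro b a v c h hv hc
  change lin (rUnitIso V).hom (v ⊗ₜ[k] c) ∈ _
  rw [lin_rUnit]
  by_cases ha : a = 0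
  · subst ha
    rw [add_zero] at h
    subst h
    rw [add_zero]
    exact Submodule.smul_mem _ _ hv
  · have : c = 0 := by
      change c ∈ unitGr k a at hc
      rwa [unitGr, if_neg ha, Submodule.mem_bot] at hc
    subst this
    rw [zero_smul]; exact zero_mem _

noncomputable instance : MonoidalSupercategory k (SMod g) where
  tObj := tensor
  tUnit := unit g
  tHom := tensorHom _ _ _ _
  tHom_mem := tensorHom_mem
  tHom_id V W := tensor_hom_ext fun a b v w hv hw => by
    rw [tensorHom_tmul (𝟙 V) w hv (id_even W), mul_zero, sgn_zero, one_smul]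
    rfl
  interchange := by
    intro X₁ X₂ X₃ Y₁ Y₂ Y₃ p q f f' g' h hf hh
    induction g' using hom_homog with
    | hadd a b ha hb =>
      simp only [map_add, Preadditive.add_comp, ha, hb, smul_add]
    | h r g' hg' =>
      apply tensor_hom_ext
      intro a b v w hv hw
      rw [lin_comp, LinearMap.comp_apply, tensorHom_tmul f w hv hg', map_smul,
        tensorHom_tmul f' _ (hf _ _ hv) hh, lin_smul, LinearMap.smul_apply,
        tensorHom_tmul _ _ hv (Supercategory.comp_mem (k := k) hg' hh), smul_smul, smul_smul,
        ← sgn_add, ← sgn_add, lin_comp, lin_comp, LinearMap.comp_apply, LinearMap.comp_apply]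
      congr 2
      ring
  assoc := assocIso
  lUnit := lUnitIso
  rUnit := rUnitIso
  assoc_mem := assoc_mem
  lUnit_mem := lUnit_mem
  rUnit_mem := rUnit_mem
  assoc_natural := by
    intro X X' Y Y' Z Z' f₁ f₂ f₃
    induction f₂ using hom_homog with
    | hadd a b ha hb =>
      simp only [map_add, LinearMap.add_apply, Preadditive.add_comp, Preadditive.comp_add, ha, hb]
    | h q f₂ h₂ =>
    induction f₃ using hom_homog with
    | hadd a b ha hb =>
      simp only [map_add, Preadditive.add_comp, Preadditive.comp_add, ha, hb]
    | h r f₃ h₃ =>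
      apply tensor_hom_ext3
      intro a b c u v w hu hv hw
      simp only [lin_comp, LinearMap.comp_apply]
      rw [tensorHom_tmul _ w (tmul_mem hu hv) h₃, tensorHom_tmul f₁ v hu h₂, lin_assoc,
        tensorHom_tmul f₁ _ hu (tensorHom_mem h₂ h₃), tensorHom_tmul f₂ w hv h₃]
      simp only [← TensorProduct.smul_tmul', TensorProduct.tmul_smul, map_smul, smul_smul,
        ← sgn_add]
      rw [lin_assoc]
      congr 2
      ring
  lUnit_natural := by
    intro X X' f
    induction f using hom_homog with
    | hadd a b ha hb =>
      simp only [map_add, Preadditive.add_comp, Preadditive.comp_add, ha, hb]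
    | h q f hf =>
      apply hom_ext
      apply TensorProduct.ext
      refine LinearMap.ext fun c => LinearMap.ext fun v => ?_
      change lin (lUnitIso X').hom (lin (tensorHom _ _ _ _ (𝟙 (unit g)) f) (c ⊗ₜ[k] v)) =
        lin f (lin (lUnitIso X).hom (c ⊗ₜ[k] v))
      rw [tensorHom_tmul _ v (unit_mem c) hf, lin_lUnit, map_smul, map_smul, zero_mul, sgn_zero,
        one_smul]
      rfl
  rUnit_natural := by
    intro X X' f
    apply hom_ext
    refine ext_tensor (gr := X.gr) (gr' := (unit g).gr) fun a b v c hv hc => ?_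
    simp only [lin_comp, LinearMap.comp_apply]
    rw [tensorHom_tmul f c hv (id_even (unit g)), mul_zero, sgn_zero, one_smul, lin_rUnit,
      lin_rUnit, map_smul]
    rfl
  pentagon := by
    intro W X Y Z
    apply hom_ext
    apply TensorProduct.ext_fourfold
    intro w x y z
    simp only [lin_comp, LinearMap.comp_apply]
    rw [tensorHom_even _ (id_even Z), lin_assoc, lin_id, LinearMap.id_apply, lin_assoc,
      tensorHom_even _ (assoc_mem X Y Z), lin_id, LinearMap.id_apply, lin_assoc]
    rfl
  triangle := by
    intro X Y
    apply tensor_hom_ext3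
    intro a b c u v w hu hv hw
    simp only [lin_comp, LinearMap.comp_apply]
    rw [tensorHom_even _ (id_even Y), lin_assoc, tensorHom_even _ (lUnit_mem Y), lin_lUnit,
      lin_rUnit, TensorProduct.smul_tmul]
    rfl

end SMod

end Modules

/-! ### General linear Lie superalgebras over superalgebras -/

section GeneralLinear

variable {k : Type u} [Field k]

section Commutator

variable {B : Type u} [Ring B] [Algebra k B] (gB : ZMod 2 → Submodule k B) [GradedAlgebra gB]

/-- The supercommutator `[x, y] = x y - (-1)^{x̄ ȳ} y x`. -/
noncomputable def superBracket : B →ₗ[k] B →ₗ[k] B :=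
  LinearMap.mul k B - ∑ p : ZMod 2, ∑ q : ZMod 2,
    sgn k (p * q) • (LinearMap.mul k B).flip.compl₁₂ (pr gB p) (pr gB q)

theorem superBracket_apply {p q : ZMod 2} {x y : B} (hx : x ∈ gB p) (hy : y ∈ gB q) :
    superBracket gB x y = x * y - sgn k (p * q) • (y * x) := by
  simp only [superBracket, LinearMap.sub_apply, LinearMap.sum_apply, LinearMap.smul_apply,
    LinearMap.compl₁₂_apply, LinearMap.flip_apply, LinearMap.mul_apply', pr_of_mem gB hx,
    pr_of_mem gB hy]
  congr 1
  rw [Finset.sum_eq_single p, Finset.sum_eq_single q]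
  · simp
  · intro r _ hr; simp [hr]
  · simp
  · intro r _ hr; simp [hr]
  · simp

theorem superBracket_mem {p q : ZMod 2} {x y : B} (hx : x ∈ gB p) (hy : y ∈ gB q) :
    superBracket gB x y ∈ gB (p + q) := by
  rw [superBracket_apply gB hx hy]
  refine sub_mem (SetLike.mul_mem_graded hx hy) (Submodule.smul_mem _ _ ?_)
  rw [add_comm]
  exact SetLike.mul_mem_graded hy hx

/-- The Lie superalgebra of an associative superalgebra. -/
noncomputable abbrev lieOfSuperalgebra : LieSuperalgebra k where
  carrier := B
  gr := gB
  dec := inferInstance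
  bracket := superBracket gB
  bracket_mem := superBracket_mem gB
  skew := by
    intro p q x y hx hy
    rw [superBracket_apply gB hx hy, superBracket_apply gB hy hx, mul_comm q p, smul_sub,
      smul_smul, sgn_mul_self, one_smul]
    abel
  jacobi := by
    intro p q x y z hx hy
    have key : superBracket gB x ∘ₗ superBracket gB y =
        superBracket gB (superBracket gB x y) +
          sgn k (p * q) • superBracket gB y ∘ₗ superBracket gB x := by
      refine ext_homog (gr := gB) fun r z hz => ?_
      simp only [LinearMap.add_apply, LinearMap.smul_apply, LinearMap.comp_apply]
      rw [superBracket_apply gB hx (superBracket_mem gB hy hz),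
        superBracket_apply gB (superBracket_mem gB hx hy) hz,
        superBracket_apply gB hy (superBracket_mem gB hx hz),
        superBracket_apply gB hy hz, superBracket_apply gB hx hy, superBracket_apply gB hx hz]
      simp only [mul_sub, sub_mul, smul_sub, mul_smul_comm, smul_mul_assoc, smul_smul, ← sgn_add,
        mul_assoc]
      have d (a : ZMod 2) : a + a = 0 := CharTwo.add_self_eq_zero a
      have e1 : p * q + q * (p + r) = q * r := by linear_combination d (p * q)
      have e2 : (p + q) * r + p * q = p * (q + r) + q * r := by ring
      have e3 : p * q + (q * (p + r) + p * r) = q * r + p * r := by linear_combination d (p * q)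
      have e4 : (p + q) * r = p * r + q * r := by ring
      have e5 : p * (q + r) = p * q + p * r := by ring
      rw [e1, e2, e3, e4, e5, add_comm (q * r) (p * r)]
      abel
    exact LinearMap.congr_fun key z

end Commutator

variable {A : Type u} [Ring A] [Algebra k A] (gA : ZMod 2 → Submodule k A) [GradedAlgebra gA]
variable {I : Type} [Fintype I] [DecidableEq I] (par : I → ZMod 2)

/-- The grading on matrices: `a_(i,j)` has parity `ā + p(i) + p(j)`. -/
def matGr (q : ZMod 2) : Submodule k (Matrix I I A) where
  carrier := {M | ∀ i j, M i j ∈ gA (q + par i + par j)}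
  add_mem' := fun ha hb i j => add_mem (ha i j) (hb i j)
  zero_mem' := fun _ _ => zero_mem _
  smul_mem' := fun c _ ha i j => Submodule.smul_mem _ c (ha i j)

noncomputable instance matDec : DirectSum.Decomposition (matGr gA par) :=
  decompositionOfProj _
    (fun q =>
      { toFun := fun M => Matrix.of fun i j => pr gA (q + par i + par j) (M i j)
        map_add' := by intro M N; ext i j; simp
        map_smul' := by intro c M; ext i j; simp })
    (by intro q M i j; exact pr_mem _ _ _)
    (by
      intro M
      ext i j
      change pr gA (0 + par i + par j) (M i j) + pr gA (1 + par i + par j) (M i j) = M i j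
      have e : (1 + 1 : ZMod 2) = 0 := by decide
      rcases parity_cases (par i) with h | h <;> rcases parity_cases (par j) with h' | h' <;>
        simp only [h, h', add_zero, zero_add, e, pr_add]
      · rw [_root_.add_comm, pr_add]
      · rw [_root_.add_comm, pr_add])
    (by
      intro p q M hM
      ext i j
      change pr gA (p + par i + par j) (M i j) = _
      rw [pr_of_mem gA (hM i j)]
      by_cases h : p = q <;> simp [h])

noncomputable instance matGraded : GradedAlgebra (matGr gA par : ZMod 2 → Submodule k _) where
  one_mem := by
    intro i j
    by_cases h : i = j
    · subst h
      rw [Matrix.one_apply_eq, zero_add, CharTwo.add_self_eq_zero]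
      exact SetLike.GradedOne.one_mem
    · rw [Matrix.one_apply_ne h]; exact zero_mem _
  mul_mem := by
    intro p q M N hM hN i j
    rw [Matrix.mul_apply]
    refine sum_mem fun l _ => ?_
    have := SetLike.mul_mem_graded (hM i l) (hN l j)
    have e : p + par i + par l + (q + par l + par j) = p + q + par i + par j := by
      linear_combination CharTwo.add_self_eq_zero (par l)
    rwa [e] at this

/-- The general linear Lie superalgebra with entries in `A`. -/
noncomputable abbrev gl : LieSuperalgebra k := lieOfSuperalgebra (matGr gA par)

/-- The grading on vectors: `a e_i` has parity `ā + p(i)`. -/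
def vecGr (q : ZMod 2) : Submodule k (I → A) where
  carrier := {v | ∀ i, v i ∈ gA (q + par i)}
  add_mem' := fun ha hb i => add_mem (ha i) (hb i)
  zero_mem' := fun _ => zero_mem _
  smul_mem' := fun c _ ha i => Submodule.smul_mem _ c (ha i)

noncomputable instance vecDec : DirectSum.Decomposition (vecGr gA par) :=
  decompositionOfProj _
    (fun q =>
      { toFun := fun v i => pr gA (q + par i) (v i)
        map_add' := by intro v w; ext i; simp
        map_smul' := by intro c v; ext i; simp })
    (by intro q v i; exact pr_mem _ _ _)
    (by
      intro v
      ext i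
      change pr gA (0 + par i) (v i) + pr gA (1 + par i) (v i) = v i
      have e : (1 + 1 : ZMod 2) = 0 := by decide
      rcases parity_cases (par i) with h | h <;> simp only [h, add_zero, zero_add, e, pr_add]
      rw [_root_.add_comm, pr_add])
    (by
      intro p q v hv
      ext i
      change pr gA (p + par i) (v i) = _
      rw [pr_of_mem gA (hv i)]
      by_cases h : p = q <;> simp [h])

theorem vecMul_mem {p q : ZMod 2} {v : I → A} {M : Matrix I I A} (hv : v ∈ vecGr gA par p)
    (hM : M ∈ matGr gA par q) : Matrix.vecMul v M ∈ vecGr gA par (p + q) := by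
  intro j
  refine sum_mem fun i _ => ?_
  have := SetLike.mul_mem_graded (hv i) (hM i j)
  have e : p + par i + (q + par i + par j) = p + q + par j := by
    linear_combination CharTwo.add_self_eq_zero (par i)
  rwa [e] at this

theorem mulVec_mem {p q : ZMod 2} {v : I → A} {M : Matrix I I A} (hv : v ∈ vecGr gA par p)
    (hM : M ∈ matGr gA par q) : Matrix.mulVec M v ∈ vecGr gA par (p + q) := by
  intro j
  refine sum_mem fun i _ => ?_
  have := SetLike.mul_mem_graded (hM j i) (hv i)
  have e : q + par j + par i + (p + par i) = p + q + par j := by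
    linear_combination CharTwo.add_self_eq_zero (par i)
  rwa [e] at this

/-- `V₊`: row vectors, with action by right multiplication, `v · M = v M`. -/
noncomputable abbrev Vplus : SMod (gl gA par) where
  carrier := I → A
  gr := vecGr gA par
  dec := vecDec gA par
  act := LinearMap.mk₂ k (fun M v => Matrix.vecMul v M)
    (by intro M N v; exact Matrix.vecMul_add _ _ _)
    (by intro c M v; exact Matrix.vecMul_smul _ _ _)
    (by intro M v w; exact Matrix.add_vecMul _ _ _)
    (by intro c M v; exact Matrix.smul_vecMul _ _ _)
  act_mem := fun hv hM => vecMul_mem gA par hv hM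
  act_bracket := by
    intro p q M N v hM hN
    change Matrix.vecMul v (superBracket (matGr gA par) M N) =
      Matrix.vecMul (Matrix.vecMul v M) N -
        sgn k (p * q) • Matrix.vecMul (Matrix.vecMul v N) M
    rw [superBracket_apply _ hM hN, Matrix.vecMul_sub, Matrix.vecMul_smul, Matrix.vecMul_vecMul,
      Matrix.vecMul_vecMul]

/-- Multiplication of matrices and column vectors as a bilinear map. -/
def mulVecₗ : Matrix I I A →ₗ[k] (I → A) →ₗ[k] (I → A) :=
  LinearMap.mk₂ k (fun M v => Matrix.mulVec M v)
    (by intro M N v; exact Matrix.add_mulVec _ _ _)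
    (by intro c M v; exact Matrix.smul_mulVec _ _ _)
    (by intro M v w; exact Matrix.mulVec_add _ _ _)
    (by intro c M v; exact Matrix.mulVec_smul _ _ _)

/-- The action on column vectors, `v · M = -(-1)^{v̄ M̄} M v`. -/
noncomputable def colAct : Matrix I I A →ₗ[k] (I → A) →ₗ[k] (I → A) :=
  -∑ q : ZMod 2, (mulVecₗ (k := k)).compl₁₂ (pr (matGr gA par) q) (tw (vecGr gA par) q)

theorem colAct_apply {p q : ZMod 2} {v : I → A} {M : Matrix I I A} (hv : v ∈ vecGr gA par p)
    (hM : M ∈ matGr gA par q) :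
    colAct gA par M v = -(sgn k (p * q) • Matrix.mulVec M v) := by
  simp only [colAct, LinearMap.neg_apply, LinearMap.sum_apply, LinearMap.compl₁₂_apply,
    pr_of_mem _ hM, tw_of_mem _ _ hv]
  rw [Finset.sum_eq_single q]
  · rw [if_pos rfl, map_smul]; rfl
  · intro r _ hr; simp [hr]
  · simp

/-- `V₋`: column vectors, with action `v · M = -(-1)^{v̄ M̄} M v`. -/
noncomputable abbrev Vminus : SMod (gl gA par) where
  carrier := I → A
  gr := vecGr gA par
  dec := vecDec gA par
  act := colAct gA par
  act_mem := by
    intro p q v M hv hM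
    rw [colAct_apply gA par hv hM]
    exact neg_mem (Submodule.smul_mem _ _ (mulVec_mem gA par hv hM))
  act_bracket := by
    intro p q M N v hM hN
    have key : colAct gA par (superBracket (matGr gA par) M N) =
        colAct gA par N ∘ₗ colAct gA par M -
          sgn k (p * q) • colAct gA par M ∘ₗ colAct gA par N := by
      refine ext_homog (gr := vecGr gA par) fun r v hv => ?_
      simp only [LinearMap.sub_apply, LinearMap.smul_apply, LinearMap.comp_apply]
      rw [colAct_apply gA par hv (superBracket_mem _ hM hN), colAct_apply gA par hv hM,
        colAct_apply gA par hv hN, map_neg, map_neg, map_smul, map_smul,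
        colAct_apply gA par (mulVec_mem gA par hv hM) hN,
        colAct_apply gA par (mulVec_mem gA par hv hN) hM, superBracket_apply _ hM hN,
        Matrix.sub_mulVec, Matrix.smul_mulVec, Matrix.mulVec_mulVec, Matrix.mulVec_mulVec]
      simp only [smul_neg, neg_neg, smul_sub, smul_smul, ← sgn_add]
      have d (a : ZMod 2) : a + a = 0 := CharTwo.add_self_eq_zero a
      have e1 : p * q + (r * q + (r + q) * p) = r * (p + q) := by linear_combination d (p * q)
      have e2 : r * p + (r + p) * q = r * (p + q) + p * q := by ring
      rw [e1, e2]
      abel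
    exact LinearMap.congr_fun key v

end GeneralLinear

section Frobenius

variable {k : Type u} [Field k]
variable {A : Type u} [Ring A] [Algebra k A]

/-- The structure of a symmetric Frobenius superalgebra on the superalgebra `A`: a
parity-preserving supersymmetric trace together with a homogeneous basis, indexed by `ι`, and its
left dual basis. -/
structure SymmetricFrobenius (gA : ZMod 2 → Submodule k A) (ι : Type*) [DecidableEq ι] where
  tr : A →ₗ[k] k
  tr_odd {a : A} : a ∈ gA 1 → tr a = 0
  tr_symm {p q : ZMod 2} {a b : A} : a ∈ gA p → b ∈ gA q →
    tr (a * b) = sgn k (p * q) * tr (b * a)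
  basis : Module.Basis ι k A
  parity : ι → ZMod 2
  basis_mem (b : ι) : basis b ∈ gA (parity b)
  dual : ι → A
  tr_dual (b c : ι) : tr (dual b * basis c) = if b = c then 1 else 0

variable {gA : ZMod 2 → Submodule k A} [GradedAlgebra gA]
variable {ι : Type*} [DecidableEq ι] (F : SymmetricFrobenius gA ι)
variable {I : Type} [Fintype I] [DecidableEq I] (par : I → ZMod 2)

/-- The bilinear form `B(v ⊗ w) = (-1)^{v̄ w̄} tr(w v)`, for a column `v` and a row `w`. -/
noncomputable def form : (Vminus gA par).carrier →ₗ[k] (Vplus gA par).carrier →ₗ[k] k :=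
  ∑ p : ZMod 2, ∑ q : ZMod 2, sgn k (p * q) •
    (LinearMap.mk₂ k (fun v w : I → A => F.tr (w ⬝ᵥ v))
      (by intro v v' w; rw [dotProduct_add, map_add])
      (by intro c v w; rw [dotProduct_smul, map_smul])
      (by intro v w w'; rw [add_dotProduct, map_add])
      (by intro c v w; rw [smul_dotProduct, map_smul])).compl₁₂
      (pr (vecGr gA par) p) (pr (vecGr gA par) q)

theorem form_apply {p q : ZMod 2} {v w : I → A} (hv : v ∈ vecGr gA par p)
    (hw : w ∈ vecGr gA par q) : form F par v w = sgn k (p * q) * F.tr (w ⬝ᵥ v) := by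
  simp only [form, LinearMap.sum_apply, LinearMap.smul_apply,
    LinearMap.compl₁₂_apply, pr_of_mem _ hv, pr_of_mem _ hw]
  rw [Finset.sum_eq_single p, Finset.sum_eq_single q]
  · simp
  · intro r _ hr; simp [hr]
  · simp
  · intro r _ hr; simp [hr]
  · simp

/-- The basis vector `b_{i,+}` of `V₊`. -/
noncomputable def rowVec (x : ι × I) : (Vplus gA par).carrier := Pi.single (M := fun _ => A) x.2 (F.basis x.1)

/-- The vector of `V₋` dual to `b_{i,+}` with respect to the form `B`: it is
`(-1)^{p(i)} b^∨_{i,-}`. -/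
noncomputable def colVec (x : ι × I) : (Vminus gA par).carrier :=
  sgn k (par x.2) • Pi.single (M := fun _ => A) x.2 (F.dual x.1)

/-- The parity of `b_{i,+}`. -/
def rowParity (x : ι × I) : ZMod 2 := F.parity x.1 + par x.2

theorem single_mem {p : ZMod 2} {a : A} (ha : a ∈ gA p) (i : I) :
    Pi.single (M := fun _ => A) i a ∈ vecGr gA par (p + par i) := by
  intro j
  by_cases h : j = i
  · subst h
    rw [Pi.single_eq_same, add_assoc, CharTwo.add_self_eq_zero, add_zero]
    exact ha
  · rw [Pi.single_eq_of_ne h]; exact zero_mem _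

theorem rowVec_mem (x : ι × I) : rowVec F par x ∈ (Vplus gA par).gr (rowParity F par x) :=
  single_mem par (F.basis_mem x.1) x.2

theorem form_eq (v : (Vminus gA par).carrier) (w : (Vplus gA par).carrier) :
    form F par v w = ∑ i, sgn k (par i) * F.tr (v i * w i) := by
  have key : form F par = LinearMap.mk₂ k
      (fun v w : I → A => ∑ i, sgn k (par i) * F.tr (v i * w i))
      (by intro a b c; simp [add_mul, mul_add, Finset.sum_add_distrib])
      (by intro c a b; simp [Finset.mul_sum, mul_left_comm])
      (by intro a b c; simp [mul_add, Finset.sum_add_distrib])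
      (by intro c a b; simp [Finset.mul_sum, mul_left_comm]) := by
    refine ext_homog (gr := vecGr gA par) fun p v hv =>
      ext_homog (gr := vecGr gA par) fun q w hw => ?_
    rw [form_apply F par hv hw, LinearMap.mk₂_apply, dotProduct, map_sum, Finset.mul_sum]
    refine Finset.sum_congr rfl fun i _ => ?_
    by_cases h : p = q
    · subst h
      rw [F.tr_symm (hw i) (hv i), ← mul_assoc, ← sgn_add]
      congr 2
      have e : ∀ a r : ZMod 2, a * a + (a + r) * (a + r) = r := by decide
      exact e p (par i)
    · have hpq : q + p = 1 := by
        have e : ∀ a b : ZMod 2, a ≠ b → b + a = 1 := by decide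
        exact e p q h
      have h1 : w i * v i ∈ gA 1 := by
        have := SetLike.mul_mem_graded (hw i) (hv i)
        have e : q + par i + (p + par i) = 1 := by
          linear_combination hpq + CharTwo.add_self_eq_zero (par i)
        rwa [e] at this
      have h2 : v i * w i ∈ gA 1 := by
        have := SetLike.mul_mem_graded (hv i) (hw i)
        have e : p + par i + (q + par i) = 1 := by
          linear_combination hpq + CharTwo.add_self_eq_zero (par i)
        rwa [e] at this
      rw [F.tr_odd h1, F.tr_odd h2, mul_zero, mul_zero]
  exact LinearMap.congr_fun₂ key v w

/-- `colVec` is indeed the dual family with respect to the form. -/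
theorem form_colVec_rowVec (x y : ι × I) :
    form F par (colVec F par x) (rowVec F par y) = if x = y then 1 else 0 := by
  obtain ⟨b, i⟩ := x
  obtain ⟨c, j⟩ := y
  rw [form_eq, Finset.sum_eq_single i]
  · simp only [colVec, rowVec, Pi.smul_apply, Pi.single_eq_same, smul_mul_assoc, map_smul,
      smul_eq_mul]
    rw [← mul_assoc, sgn_mul_self, one_mul]
    by_cases h : i = j
    · subst h
      rw [Pi.single_eq_same, F.tr_dual]
      simp
    · rw [Pi.single_eq_of_ne h, mul_zero, map_zero]
      simp [h]
  · intro l _ hl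
    simp [colVec, Pi.single_eq_of_ne hl]
  · simp

end Frobenius

/-! ### The oriented Frobenius Brauer category -/

section Brauer

/-- The two generating objects. -/
inductive Orient
  | up
  | down

open Orient

/-- Formal expressions for morphisms between words in the generating objects, built from the
generating morphisms by composition, tensor product and linear combinations.
`comp f g` is "first `f`, then `g`". -/
inductive Term (k A : Type u) : List Orient → List Orient → Type u
  | id (X : List Orient) : Term k A X X
  | comp {X Y Z : List Orient} (f : Term k A X Y) (g : Term k A Y Z) : Term k A X Z
  | tensor {X X' Y Y' : List Orient} (f : Term k A X X') (g : Term k A Y Y') :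
      Term k A (X ++ Y) (X' ++ Y')
  | zero (X Y : List Orient) : Term k A X Y
  | add {X Y : List Orient} (f g : Term k A X Y) : Term k A X Y
  | smul {X Y : List Orient} (c : k) (f : Term k A X Y) : Term k A X Y
  | cross : Term k A [up, up] [up, up]
  | token (a : A) : Term k A [up] [up]
  | rightCup : Term k A [] [down, up]
  | rightCap : Term k A [up, down] []
  | leftCup : Term k A [] [up, down]
  | leftCap : Term k A [down, up] []

namespace Term

variable {k A : Type u}

/-- The identity, between words that are propositionally equal. -/
def eqTo {X Y : List Orient} (h : X = Y) : Term k A X Y := h ▸ Term.id X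

/-- The upward crossing of the first two of three upward strands. -/
def crossL : Term k A [up, up, up] [up, up, up] := (tensor cross (id [up]) :)

/-- The upward crossing of the last two of three upward strands. -/
def crossR : Term k A [up, up, up] [up, up, up] := (tensor (id [up]) cross :)

/-- The right crossing `↑ ⊗ ↓ → ↓ ⊗ ↑`. -/
def rightCross : Term k A [up, down] [down, up] :=
  comp (tensor rightCup (id [up, down]))
    (comp (tensor (id [down]) (tensor cross (id [down]) :) :)
      (tensor (id [down, up]) rightCap))

/-- The left crossing `↓ ⊗ ↑ → ↑ ⊗ ↓`. -/
def leftCross : Term k A [down, up] [up, down] :=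
  comp (tensor (id [down, up]) leftCup)
    (comp (tensor (id [down]) (tensor cross (id [down]) :) :)
      (tensor leftCap (id [up, down])))

/-- An upward strand with a curl on its left. -/
def leftCurl : Term k A [up] [up] :=
  comp (tensor rightCup (id [up]) :)
    (comp (tensor (id [down]) cross :) (tensor leftCap (id [up]) :))

/-- An upward strand with a curl on its right. -/
def rightCurl : Term k A [up] [up] :=
  comp (tensor (id [up]) leftCup :)
    (comp (tensor cross (id [down]) :) (tensor (id [up]) rightCap :))

/-- An upward strand bent by a right cup followed by a right cap. -/
def zigzagUp : Term k A [up] [up] :=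
  comp (tensor (id [up]) rightCup :) (tensor rightCap (id [up]) :)

/-- A downward strand bent by a right cup followed by a right cap. -/
def zigzagDown : Term k A [down] [down] :=
  comp (tensor rightCup (id [down]) :) (tensor (id [down]) rightCap :)

variable [Field k] [Ring A] [Algebra k A] (gA : ZMod 2 → Submodule k A)

/-- The homogeneous expressions and their parities: tokens have the parity of their label, all
other generators are even. -/
inductive HasParity : ∀ {X Y : List Orient}, Term k A X Y → ZMod 2 → Prop
  | id (X : List Orient) : HasParity (id X) 0
  | comp {X Y Z : List Orient} {f : Term k A X Y} {g : Term k A Y Z} {p q : ZMod 2} :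
      HasParity f p → HasParity g q → HasParity (comp f g) (p + q)
  | tensor {X X' Y Y' : List Orient} {f : Term k A X X'} {g : Term k A Y Y'} {p q : ZMod 2} :
      HasParity f p → HasParity g q → HasParity (tensor f g) (p + q)
  | zero (X Y : List Orient) (p : ZMod 2) : HasParity (zero X Y) p
  | add {X Y : List Orient} {f g : Term k A X Y} {p : ZMod 2} :
      HasParity f p → HasParity g p → HasParity (add f g) p
  | smul {X Y : List Orient} {f : Term k A X Y} {p : ZMod 2} (c : k) :
      HasParity f p → HasParity (smul c f) p
  | cross : HasParity cross 0
  | token {a : A} {p : ZMod 2} : a ∈ gA p → HasParity (token a) p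
  | rightCup : HasParity rightCup 0
  | rightCap : HasParity rightCap 0
  | leftCup : HasParity leftCup 0
  | leftCap : HasParity leftCap 0

/-- Equality of morphisms: the congruence generated by the axioms of a strict monoidal
supercategory over `k` and by the defining relations. -/
inductive Rel : ∀ {X Y : List Orient}, Term k A X Y → Term k A X Y → Prop
  | refl {X Y} (f : Term k A X Y) : Rel f f
  | symm {X Y} {f g : Term k A X Y} : Rel f g → Rel g f
  | trans {X Y} {f g h : Term k A X Y} : Rel f g → Rel g h → Rel f h
  | comp_congr {X Y Z} {f f' : Term k A X Y} {g g' : Term k A Y Z} :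
      Rel f f' → Rel g g' → Rel (comp f g) (comp f' g')
  | tensor_congr {X X' Y Y'} {f f' : Term k A X X'} {g g' : Term k A Y Y'} :
      Rel f f' → Rel g g' → Rel (tensor f g) (tensor f' g')
  | add_congr {X Y} {f f' g g' : Term k A X Y} : Rel f f' → Rel g g' → Rel (add f g) (add f' g')
  | smul_congr {X Y} (c : k) {f f' : Term k A X Y} : Rel f f' → Rel (smul c f) (smul c f')
  -- vector spaces
  | add_comm {X Y} (f g : Term k A X Y) : Rel (add f g) (add g f)
  | add_assoc {X Y} (f g h : Term k A X Y) : Rel (add (add f g) h) (add f (add g h))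
  | zero_add {X Y} (f : Term k A X Y) : Rel (add (zero X Y) f) f
  | zero_smul {X Y} (f : Term k A X Y) : Rel (smul 0 f) (zero X Y)
  | one_smul {X Y} (f : Term k A X Y) : Rel (smul 1 f) f
  | mul_smul {X Y} (c d : k) (f : Term k A X Y) : Rel (smul (c * d) f) (smul c (smul d f))
  | smul_add {X Y} (c : k) (f g : Term k A X Y) :
      Rel (smul c (add f g)) (add (smul c f) (smul c g))
  | add_smul {X Y} (c d : k) (f : Term k A X Y) :
      Rel (smul (c + d) f) (add (smul c f) (smul d f))
  -- linear categories
  | id_comp {X Y} (f : Term k A X Y) : Rel (comp (id X) f) f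
  | comp_id {X Y} (f : Term k A X Y) : Rel (comp f (id Y)) f
  | comp_assoc {W X Y Z} (f : Term k A W X) (g : Term k A X Y) (h : Term k A Y Z) :
      Rel (comp (comp f g) h) (comp f (comp g h))
  | add_comp {X Y Z} (f f' : Term k A X Y) (g : Term k A Y Z) :
      Rel (comp (add f f') g) (add (comp f g) (comp f' g))
  | comp_add {X Y Z} (f : Term k A X Y) (g g' : Term k A Y Z) :
      Rel (comp f (add g g')) (add (comp f g) (comp f g'))
  | smul_comp {X Y Z} (c : k) (f : Term k A X Y) (g : Term k A Y Z) :
      Rel (comp (smul c f) g) (smul c (comp f g))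
  | comp_smul {X Y Z} (c : k) (f : Term k A X Y) (g : Term k A Y Z) :
      Rel (comp f (smul c g)) (smul c (comp f g))
  -- strict monoidal supercategories
  | add_tensor {X X' Y Y'} (f f' : Term k A X X') (g : Term k A Y Y') :
      Rel (tensor (add f f') g) (add (tensor f g) (tensor f' g))
  | tensor_add {X X' Y Y'} (f : Term k A X X') (g g' : Term k A Y Y') :
      Rel (tensor f (add g g')) (add (tensor f g) (tensor f g'))
  | smul_tensor {X X' Y Y'} (c : k) (f : Term k A X X') (g : Term k A Y Y') :
      Rel (tensor (smul c f) g) (smul c (tensor f g))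
  | tensor_smul {X X' Y Y'} (c : k) (f : Term k A X X') (g : Term k A Y Y') :
      Rel (tensor f (smul c g)) (smul c (tensor f g))
  | tensor_id (X Y) : Rel (tensor (id X) (id Y)) (id (X ++ Y))
  | interchange {X₁ X₂ X₃ Y₁ Y₂ Y₃} {f : Term k A X₁ X₂} {f' : Term k A X₂ X₃}
      {g' : Term k A Y₁ Y₂} {g : Term k A Y₂ Y₃} {p p' q q' : ZMod 2} :
      HasParity gA f p → HasParity gA f' p' → HasParity gA g q → HasParity gA g' q' →
      Rel (comp (tensor f g') (tensor f' g))
        (smul (sgn k (p * q)) (tensor (comp f f') (comp g' g)))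
  | tensor_assoc {X X' Y Y' Z Z'} (f : Term k A X X') (g : Term k A Y Y') (h : Term k A Z Z') :
      Rel (comp (tensor (tensor f g) h) (eqTo (List.append_assoc X' Y' Z')))
        (comp (eqTo (List.append_assoc X Y Z)) (tensor f (tensor g h)))
  | unit_tensor {X Y} (f : Term k A X Y) : Rel (tensor (id []) f) f
  | tensor_unit {X Y} (f : Term k A X Y) :
      Rel (comp (tensor f (id [])) (eqTo (List.append_nil Y)))
        (comp (eqTo (List.append_nil X)) f)
  -- tokens
  | token_one : Rel (token 1) (id [up])
  | token_linear (c d : k) (a b : A) :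
      Rel (add (smul c (token a)) (smul d (token b))) (token (c • a + d • b))
  | token_mul (a b : A) : Rel (comp (token b) (token a)) (token (a * b))
  -- upward crossings
  | cross_sq : Rel (comp cross cross) (id [up, up])
  | braid : Rel (comp crossL (comp crossR crossL)) (comp crossR (comp crossL crossR))
  | token_cross (a : A) :
      Rel (comp (tensor (token a) (id [up])) cross) (comp cross (tensor (id [up]) (token a)))
  -- the left and right crossings are mutually inverse
  | left_right : Rel (comp rightCross leftCross) (id [up, down])
  | right_left : Rel (comp leftCross rightCross) (id [down, up])
  -- left and right curls
  | left_curl : Rel leftCurl (id [up])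
  | right_curl : Rel rightCurl (id [up])
  -- right adjunction
  | zigzag_up : Rel zigzagUp (id [up])
  | zigzag_down : Rel zigzagDown (id [down])

end Term

variable {k A : Type u} [Field k] [Ring A] [Algebra k A]

/-- The objects of the oriented Frobenius Brauer category of the superalgebra `A` with grading
`gA`: words in the generating objects. -/
structure OB (gA : ZMod 2 → Submodule k A) where
  word : List Orient

namespace OB

variable (gA : ZMod 2 → Submodule k A)

/-- The setoid of the relation `Term.Rel`. -/
def setoid (X Y : List Orient) : Setoid (Term k A X Y) where
  r := Term.Rel gA
  iseqv := ⟨Term.Rel.refl, Term.Rel.symm, Term.Rel.trans⟩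

/-- Morphisms between words. -/
def Mor (X Y : List Orient) : Type u := Quotient (setoid gA X Y)

variable {gA}

/-- The class of an expression. -/
def cls {X Y : List Orient} (f : Term k A X Y) : Mor gA X Y := Quotient.mk (setoid gA X Y) f

theorem sound {X Y : List Orient} {f g : Term k A X Y} (h : Term.Rel gA f g) :
    (cls f : Mor gA X Y) = cls g := Quotient.sound (s := setoid gA X Y) h

theorem mk_surj {X Y : List Orient} (f : Mor gA X Y) : ∃ t, cls t = f :=
  Quotient.exists_rep (s := setoid gA X Y) f

namespace Mor

/-- Composition of morphisms. -/
def comp {X Y Z : List Orient} (f : Mor gA X Y) (g : Mor gA Y Z) : Mor gA X Z :=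
  Quotient.map₂ (sa := setoid gA X Y) (sb := setoid gA Y Z) (sc := setoid gA X Z) Term.comp
    (fun _ _ h _ _ h' => Term.Rel.comp_congr h h') f g

/-- Tensor product of morphisms. -/
def tensor {X X' Y Y' : List Orient} (f : Mor gA X X') (g : Mor gA Y Y') :
    Mor gA (X ++ Y) (X' ++ Y') :=
  Quotient.map₂ (sa := setoid gA X X') (sb := setoid gA Y Y')
    (sc := setoid gA (X ++ Y) (X' ++ Y')) Term.tensor
    (fun _ _ h _ _ h' => Term.Rel.tensor_congr h h') f g

/-- Sum of morphisms. -/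
def add {X Y : List Orient} (f g : Mor gA X Y) : Mor gA X Y :=
  Quotient.map₂ (sa := setoid gA X Y) (sb := setoid gA X Y) (sc := setoid gA X Y) Term.add
    (fun _ _ h _ _ h' => Term.Rel.add_congr h h') f g

/-- Scalar multiple of a morphism. -/
def smul {X Y : List Orient} (c : k) (f : Mor gA X Y) : Mor gA X Y :=
  Quotient.map (sa := setoid gA X Y) (sb := setoid gA X Y) (Term.smul c)
    (fun _ _ h => Term.Rel.smul_congr c h) f

variable {X Y : List Orient}

instance : Add (Mor gA X Y) := ⟨add⟩
instance : SMul k (Mor gA X Y) := ⟨smul⟩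
instance : Zero (Mor gA X Y) := ⟨cls (Term.zero X Y)⟩
instance : Neg (Mor gA X Y) := ⟨fun f => (-1 : k) • f⟩

theorem mk_add (f g : Term k A X Y) : (cls (f.add g) : Mor gA X Y) = cls f + cls g := rfl
theorem mk_smul (c : k) (f : Term k A X Y) : (cls (f.smul c) : Mor gA X Y) = c • cls f := rfl
theorem mk_zero : (cls (Term.zero X Y) : Mor gA X Y) = 0 := rfl

instance : AddCommGroup (Mor gA X Y) where
  add_assoc f g h := by
    obtain ⟨f, rfl⟩ := mk_surj f
    obtain ⟨g, rfl⟩ := mk_surj g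
    obtain ⟨h, rfl⟩ := mk_surj h
    exact sound (Term.Rel.add_assoc f g h)
  add_comm f g := by
    obtain ⟨f, rfl⟩ := mk_surj f
    obtain ⟨g, rfl⟩ := mk_surj g
    exact sound (Term.Rel.add_comm f g)
  zero_add f := by
    obtain ⟨f, rfl⟩ := mk_surj f
    exact sound (Term.Rel.zero_add f)
  add_zero f := by
    obtain ⟨f, rfl⟩ := mk_surj f
    exact sound ((Term.Rel.add_comm _ _).trans (Term.Rel.zero_add f))
  nsmul := nsmulRec
  zsmul := zsmulRec
  neg_add_cancel f := by
    obtain ⟨f, rfl⟩ := mk_surj f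
    refine sound (f := Term.add (Term.smul (-1) f) f) ?_
    refine (Term.Rel.add_congr (Term.Rel.refl _) (Term.Rel.one_smul f).symm).trans ?_
    refine (Term.Rel.add_smul (-1) 1 f).symm.trans ?_
    rw [neg_add_cancel]
    exact Term.Rel.zero_smul f

instance : Module k (Mor gA X Y) where
  one_smul f := by
    obtain ⟨f, rfl⟩ := mk_surj f
    exact sound (Term.Rel.one_smul f)
  mul_smul c d f := by
    obtain ⟨f, rfl⟩ := mk_surj f
    exact sound (Term.Rel.mul_smul c d f)
  smul_zero c := by
    refine sound (f := Term.smul c (Term.zero X Y)) ?_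
    refine (Term.Rel.smul_congr c (Term.Rel.zero_smul (Term.zero X Y)).symm).trans ?_
    refine (Term.Rel.mul_smul c 0 _).symm.trans ?_
    rw [mul_zero]
    exact Term.Rel.zero_smul _
  smul_add c f g := by
    obtain ⟨f, rfl⟩ := mk_surj f
    obtain ⟨g, rfl⟩ := mk_surj g
    exact sound (Term.Rel.smul_add c f g)
  add_smul c d f := by
    obtain ⟨f, rfl⟩ := mk_surj f
    exact sound (Term.Rel.add_smul c d f)
  zero_smul f := by
    obtain ⟨f, rfl⟩ := mk_surj f
    exact sound (Term.Rel.zero_smul f)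

theorem add_comp {X Y Z : List Orient} (f f' : Mor gA X Y) (g : Mor gA Y Z) :
    comp (f + f') g = comp f g + comp f' g := by
  obtain ⟨f, rfl⟩ := mk_surj f
  obtain ⟨f', rfl⟩ := mk_surj f'
  obtain ⟨g, rfl⟩ := mk_surj g
  exact sound (Term.Rel.add_comp f f' g)

theorem comp_add {X Y Z : List Orient} (f : Mor gA X Y) (g g' : Mor gA Y Z) :
    comp f (g + g') = comp f g + comp f g' := by
  obtain ⟨f, rfl⟩ := mk_surj f
  obtain ⟨g', rfl⟩ := mk_surj g'
  obtain ⟨g, rfl⟩ := mk_surj g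
  exact sound (Term.Rel.comp_add f g g')

theorem smul_comp {X Y Z : List Orient} (c : k) (f : Mor gA X Y) (g : Mor gA Y Z) :
    comp (c • f) g = c • comp f g := by
  obtain ⟨f, rfl⟩ := mk_surj f
  obtain ⟨g, rfl⟩ := mk_surj g
  exact sound (Term.Rel.smul_comp c f g)

theorem comp_smul {X Y Z : List Orient} (c : k) (f : Mor gA X Y) (g : Mor gA Y Z) :
    comp f (c • g) = c • comp f g := by
  obtain ⟨f, rfl⟩ := mk_surj f
  obtain ⟨g, rfl⟩ := mk_surj g
  exact sound (Term.Rel.comp_smul c f g)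

theorem comp_assoc {W X Y Z : List Orient} (f : Mor gA W X) (g : Mor gA X Y) (h : Mor gA Y Z) :
    comp (comp f g) h = comp f (comp g h) := by
  obtain ⟨f, rfl⟩ := mk_surj f
  obtain ⟨g, rfl⟩ := mk_surj g
  obtain ⟨h, rfl⟩ := mk_surj h
  exact sound (Term.Rel.comp_assoc f g h)

variable {X' Y' : List Orient}

theorem add_tensor (f f' : Mor gA X X') (g : Mor gA Y Y') :
    tensor (f + f') g = tensor f g + tensor f' g := by
  obtain ⟨f, rfl⟩ := mk_surj f
  obtain ⟨f', rfl⟩ := mk_surj f'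
  obtain ⟨g, rfl⟩ := mk_surj g
  exact sound (Term.Rel.add_tensor f f' g)

theorem tensor_add (f : Mor gA X X') (g g' : Mor gA Y Y') :
    tensor f (g + g') = tensor f g + tensor f g' := by
  obtain ⟨f, rfl⟩ := mk_surj f
  obtain ⟨g', rfl⟩ := mk_surj g'
  obtain ⟨g, rfl⟩ := mk_surj g
  exact sound (Term.Rel.tensor_add f g g')

theorem smul_tensor (c : k) (f : Mor gA X X') (g : Mor gA Y Y') :
    tensor (c • f) g = c • tensor f g := by
  obtain ⟨f, rfl⟩ := mk_surj f
  obtain ⟨g, rfl⟩ := mk_surj g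
  exact sound (Term.Rel.smul_tensor c f g)

theorem tensor_smul (c : k) (f : Mor gA X X') (g : Mor gA Y Y') :
    tensor f (c • g) = c • tensor f g := by
  obtain ⟨f, rfl⟩ := mk_surj f
  obtain ⟨g, rfl⟩ := mk_surj g
  exact sound (Term.Rel.tensor_smul c f g)

@[simp] theorem zero_comp {X Y Z : List Orient} (g : Mor gA Y Z) :
    comp (0 : Mor gA X Y) g = 0 := by
  have h := smul_comp (0 : k) (0 : Mor gA X Y) g
  rwa [zero_smul, zero_smul] at h

@[simp] theorem comp_zero {X Y Z : List Orient} (f : Mor gA X Y) :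
    comp f (0 : Mor gA Y Z) = 0 := by
  have h := comp_smul (0 : k) f (0 : Mor gA Y Z)
  rwa [zero_smul, zero_smul] at h

@[simp] theorem zero_tensor (g : Mor gA Y Y') : tensor (0 : Mor gA X X') g = 0 := by
  have h := smul_tensor (0 : k) (0 : Mor gA X X') g
  rwa [zero_smul, zero_smul] at h

@[simp] theorem tensor_zero (f : Mor gA X X') : tensor f (0 : Mor gA Y Y') = 0 := by
  have h := tensor_smul (0 : k) f (0 : Mor gA Y Y')
  rwa [zero_smul, zero_smul] at h

@[simp] theorem id_comp (f : Mor gA X Y) : comp (cls (.id X)) f = f := by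
  obtain ⟨f, rfl⟩ := mk_surj f
  exact sound (Term.Rel.id_comp f)

@[simp] theorem comp_id (f : Mor gA X Y) : comp f (cls (.id Y)) = f := by
  obtain ⟨f, rfl⟩ := mk_surj f
  exact sound (Term.Rel.comp_id f)

@[simp] theorem unit_tensor (f : Mor gA X Y) : tensor (cls (.id [])) f = f := by
  obtain ⟨f, rfl⟩ := mk_surj f
  exact sound (Term.Rel.unit_tensor f)

theorem tensor_unit (f : Mor gA X Y) :
    comp (tensor f (cls (.id []))) (cls (.eqTo (List.append_nil Y))) =
      comp (cls (.eqTo (List.append_nil X))) f := by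
  obtain ⟨f, rfl⟩ := mk_surj f
  exact sound (Term.Rel.tensor_unit f)

theorem tensor_assoc {Z Z' : List Orient} (f : Mor gA X X') (g : Mor gA Y Y') (h : Mor gA Z Z') :
    comp (tensor (tensor f g) h) (cls (.eqTo (List.append_assoc X' Y' Z'))) =
      comp (cls (.eqTo (List.append_assoc X Y Z))) (tensor f (tensor g h)) := by
  obtain ⟨f, rfl⟩ := mk_surj f
  obtain ⟨g, rfl⟩ := mk_surj g
  obtain ⟨h, rfl⟩ := mk_surj h
  exact sound (Term.Rel.tensor_assoc f g h)

variable (gA X X' Y Y') in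
/-- The tensor product as a bilinear map. -/
def tensorₗ : Mor gA X X' →ₗ[k] Mor gA Y Y' →ₗ[k] Mor gA (X ++ Y) (X' ++ Y') :=
  LinearMap.mk₂ k tensor add_tensor smul_tensor tensor_add tensor_smul

variable (gA X Y) in
/-- The morphisms of parity `p`: the classes of expressions of parity `p`. -/
def gr (p : ZMod 2) : Submodule k (Mor gA X Y) where
  carrier := {f | ∃ t, Term.HasParity gA t p ∧ cls t = f}
  add_mem' := by
    rintro _ _ ⟨s, hs, rfl⟩ ⟨t, ht, rfl⟩
    exact ⟨_, hs.add ht, rfl⟩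
  zero_mem' := ⟨_, .zero _ _ p, rfl⟩
  smul_mem' := by
    rintro c _ ⟨s, hs, rfl⟩
    exact ⟨_, hs.smul c, rfl⟩

theorem comp_mem {X Y Z : List Orient} {p q : ZMod 2} {f : Mor gA X Y} {g : Mor gA Y Z}
    (hf : f ∈ gr gA X Y p) (hg : g ∈ gr gA Y Z q) : comp f g ∈ gr gA X Z (p + q) := by
  obtain ⟨s, hs, rfl⟩ := hf
  obtain ⟨t, ht, rfl⟩ := hg
  exact ⟨_, hs.comp ht, rfl⟩

theorem tensor_mem {p q : ZMod 2} {f : Mor gA X X'} {g : Mor gA Y Y'}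
    (hf : f ∈ gr gA X X' p) (hg : g ∈ gr gA Y Y' q) :
    tensor f g ∈ gr gA (X ++ Y) (X' ++ Y') (p + q) := by
  obtain ⟨s, hs, rfl⟩ := hf
  obtain ⟨t, ht, rfl⟩ := hg
  exact ⟨_, hs.tensor ht, rfl⟩

end Mor

theorem token_zero : (cls (.token 0) : Mor gA _ _) = 0 := by
  have h := sound (Term.Rel.token_linear (gA := gA) 0 0 0 0)
  rw [Mor.mk_add, Mor.mk_smul, zero_smul, zero_smul, zero_add, add_zero] at h
  exact h.symm

theorem token_add (a b : A) :
    (cls (.token (a + b)) : Mor gA _ _) = cls (.token a) + cls (.token b) := by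
  have h := sound (Term.Rel.token_linear (gA := gA) 1 1 a b)
  rw [Mor.mk_add, Mor.mk_smul, Mor.mk_smul, one_smul, one_smul, one_smul, one_smul] at h
  exact h.symm

theorem token_smul (c : k) (a : A) :
    (cls (.token (c • a)) : Mor gA _ _) = c • cls (.token a) := by
  have h := sound (Term.Rel.token_linear (gA := gA) c 0 a 0)
  rw [Mor.mk_add, Mor.mk_smul, Mor.mk_smul, zero_smul, zero_smul, add_zero, add_zero] at h
  exact h.symm

theorem token_comp (a b : A) :
    (cls (.token b) : Mor gA _ _).comp (cls (.token a)) = cls (.token (a * b)) :=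
  sound (Term.Rel.token_mul (gA := gA) a b)

theorem eqTo_parity {X Y : List Orient} (h : X = Y) :
    Term.HasParity gA (Term.eqTo h : Term k A X Y) 0 := by
  subst h; exact .id _

theorem rightCross_parity : Term.HasParity gA (Term.rightCross : Term k A _ _) 0 :=
  .comp (p := 0) (q := 0) (.tensor (p := 0) (q := 0) .rightCup (.id _))
    (.comp (p := 0) (q := 0)
      (.tensor (p := 0) (q := 0) (.id _) (.tensor (p := 0) (q := 0) .cross (.id _)))
      (.tensor (p := 0) (q := 0) (.id _) .rightCap))

theorem leftCross_parity : Term.HasParity gA (Term.leftCross : Term k A _ _) 0 :=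
  .comp (p := 0) (q := 0) (.tensor (p := 0) (q := 0) (.id _) .leftCup)
    (.comp (p := 0) (q := 0)
      (.tensor (p := 0) (q := 0) (.id _) (.tensor (p := 0) (q := 0) .cross (.id _)))
      (.tensor (p := 0) (q := 0) .leftCap (.id _)))

theorem leftCurl_parity : Term.HasParity gA (Term.leftCurl : Term k A _ _) 0 :=
  .comp (p := 0) (q := 0) (.tensor (p := 0) (q := 0) .rightCup (.id _))
    (.comp (p := 0) (q := 0) (.tensor (p := 0) (q := 0) (.id _) .cross)
      (.tensor (p := 0) (q := 0) .leftCap (.id _)))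

theorem rightCurl_parity : Term.HasParity gA (Term.rightCurl : Term k A _ _) 0 :=
  .comp (p := 0) (q := 0) (.tensor (p := 0) (q := 0) (.id _) .leftCup)
    (.comp (p := 0) (q := 0) (.tensor (p := 0) (q := 0) .cross (.id _))
      (.tensor (p := 0) (q := 0) (.id _) .rightCap))

theorem zigzagUp_parity : Term.HasParity gA (Term.zigzagUp : Term k A _ _) 0 :=
  .comp (p := 0) (q := 0) (.tensor (p := 0) (q := 0) (.id _) .rightCup)
    (.tensor (p := 0) (q := 0) .rightCap (.id _))

theorem zigzagDown_parity : Term.HasParity gA (Term.zigzagDown : Term k A _ _) 0 :=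
  .comp (p := 0) (q := 0) (.tensor (p := 0) (q := 0) .rightCup (.id _))
    (.tensor (p := 0) (q := 0) (.id _) .rightCap)

section Projection

variable [GradedAlgebra gA]

variable (gA) in
/-- The component of parity `p` of an expression. -/
noncomputable def proj : ∀ {X Y : List Orient}, Term k A X Y → ZMod 2 → Mor gA X Y
  | _, _, .id X, p => if p = 0 then cls (.id X) else 0
  | _, _, .comp f g, p =>
      (proj f 0).comp (proj g p) + (proj f 1).comp (proj g (p + 1))
  | _, _, .tensor f g, p =>
      (proj f 0).tensor (proj g p) + (proj f 1).tensor (proj g (p + 1))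
  | _, _, .zero _ _, _ => 0
  | _, _, .add f g, p => proj f p + proj g p
  | _, _, .smul c f, p => c • proj f p
  | _, _, .cross, p => if p = 0 then cls .cross else 0
  | _, _, .token a, p => cls (.token (pr gA p a))
  | _, _, .rightCup, p => if p = 0 then cls .rightCup else 0
  | _, _, .rightCap, p => if p = 0 then cls .rightCap else 0
  | _, _, .leftCup, p => if p = 0 then cls .leftCup else 0
  | _, _, .leftCap, p => if p = 0 then cls .leftCap else 0

theorem proj_of_parity {X Y : List Orient} {t : Term k A X Y} {q : ZMod 2}
    (h : Term.HasParity gA t q) (p : ZMod 2) : proj gA t p = if p = q then cls t else 0 := by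
  have e : (1 + 1 : ZMod 2) = 0 := by decide
  induction h generalizing p with
  | @comp _ _ _ f g a b _ _ hf hg =>
    simp only [proj, hf, hg]
    rcases parity_cases a with rfl | rfl <;> rcases parity_cases b with rfl | rfl <;>
      rcases parity_cases p with rfl | rfl <;> simp [e] <;> rfl
  | @tensor _ _ _ _ f g a b _ _ hf hg =>
    simp only [proj, hf, hg]
    rcases parity_cases a with rfl | rfl <;> rcases parity_cases b with rfl | rfl <;>
      rcases parity_cases p with rfl | rfl <;> simp [e] <;> rfl
  | zero X Y q => simp only [proj, ← Mor.mk_zero, ite_self]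
  | add _ _ hf hg =>
    simp only [proj, hf, hg, Mor.mk_add]
    split_ifs <;> simp
  | smul c _ hf =>
    simp only [proj, hf, Mor.mk_smul]
    split_ifs <;> simp
  | @token a q ha =>
    simp only [proj, pr_of_mem gA ha]
    split_ifs
    · rfl
    · exact token_zero
  | _ => rfl

theorem proj_mem {X Y : List Orient} (t : Term k A X Y) (p : ZMod 2) :
    proj gA t p ∈ Mor.gr gA X Y p := by
  induction t generalizing p with
  | comp f g hf hg =>
    refine add_mem ?_ ?_
    · simpa using Mor.comp_mem (hf 0) (hg p)
    · have e : 1 + (p + 1) = p := by decide +revert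
      have := Mor.comp_mem (hf 1) (hg (p + 1))
      rwa [e] at this
  | tensor f g hf hg =>
    refine add_mem ?_ ?_
    · simpa using Mor.tensor_mem (hf 0) (hg p)
    · have e : 1 + (p + 1) = p := by decide +revert
      have := Mor.tensor_mem (hf 1) (hg (p + 1))
      rwa [e] at this
  | zero X Y => exact zero_mem _
  | add f g hf hg => exact add_mem (hf p) (hg p)
  | smul c f hf => exact Submodule.smul_mem _ _ (hf p)
  | token a => exact ⟨_, .token (pr_mem gA p a), rfl⟩
  | id X =>
    simp only [proj]; split_ifs with h
    · subst h; exact ⟨_, .id X, rfl⟩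
    · exact zero_mem _
  | cross =>
    simp only [proj]; split_ifs with h
    · subst h; exact ⟨_, .cross, rfl⟩
    · exact zero_mem _
  | rightCup =>
    simp only [proj]; split_ifs with h
    · subst h; exact ⟨_, .rightCup, rfl⟩
    · exact zero_mem _
  | rightCap =>
    simp only [proj]; split_ifs with h
    · subst h; exact ⟨_, .rightCap, rfl⟩
    · exact zero_mem _
  | leftCup =>
    simp only [proj]; split_ifs with h
    · subst h; exact ⟨_, .leftCup, rfl⟩
    · exact zero_mem _
  | leftCap =>
    simp only [proj]; split_ifs with h
    · subst h; exact ⟨_, .leftCap, rfl⟩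
    · exact zero_mem _

theorem proj_add {X Y : List Orient} (t : Term k A X Y) :
    proj gA t 0 + proj gA t 1 = cls t := by
  have e : (1 + 1 : ZMod 2) = 0 := by decide
  induction t with
  | comp f g hf hg =>
    change _ = Mor.comp (cls f) (cls g)
    rw [← hf, ← hg]
    simp only [proj, Mor.add_comp, Mor.comp_add, zero_add, e]
    abel
  | tensor f g hf hg =>
    change _ = Mor.tensor (cls f) (cls g)
    rw [← hf, ← hg]
    simp only [proj, Mor.add_tensor, Mor.tensor_add, zero_add, e]
    abel
  | zero X Y => simp only [proj, add_zero, Mor.mk_zero]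
  | add f g hf hg =>
    rw [Mor.mk_add, ← hf, ← hg]
    simp only [proj]; abel
  | smul c f hf => rw [Mor.mk_smul, ← hf]; simp only [proj, smul_add]
  | token a => simp only [proj]; rw [← token_add, pr_add]
  | _ => simp [proj]

theorem pr_mul (a b : A) (p : ZMod 2) :
    pr gA p (a * b) = pr gA p a * pr gA 0 b + pr gA (p + 1) a * pr gA 1 b := by
  have key : ∀ q a' r b', a' ∈ gA q → b' ∈ gA r →
      pr gA p (a' * b') = pr gA p a' * pr gA 0 b' + pr gA (p + 1) a' * pr gA 1 b' := by
    intro q a' r b' ha hb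
    have e : (1 + 1 : ZMod 2) = 0 := by decide
    simp only [pr_of_mem gA ha, pr_of_mem gA hb, pr_of_mem gA (SetLike.mul_mem_graded ha hb)]
    rcases parity_cases q with rfl | rfl <;> rcases parity_cases r with rfl | rfl <;>
      rcases parity_cases p with rfl | rfl <;> simp [e]
  have h : (LinearMap.mul k A).compr₂ (pr gA p) =
      (LinearMap.mul k A).compl₁₂ (pr gA p) (pr gA 0) +
        (LinearMap.mul k A).compl₁₂ (pr gA (p + 1)) (pr gA 1) := by
    refine ext_homog (gr := gA) fun q a' ha => ext_homog (gr := gA) fun r b' hb => ?_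
    simpa using key q a' r b' ha hb
  simpa using LinearMap.congr_fun₂ h a b

theorem proj_congr {X Y : List Orient} {s t : Term k A X Y} (h : Term.Rel gA s t) (p : ZMod 2) :
    proj gA s p = proj gA t p := by
  have e : (1 + 1 : ZMod 2) = 0 := by decide
  have homog : ∀ {X Y : List Orient} {s t : Term k A X Y} {q : ZMod 2}, Term.Rel gA s t →
      Term.HasParity gA s q → Term.HasParity gA t q → ∀ p, proj gA s p = proj gA t p := by
    intro X Y s t q h hs ht p
    rw [proj_of_parity hs, proj_of_parity ht, sound h]
  induction h generalizing p with
  | refl f => rfl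
  | symm _ ih => exact (ih p).symm
  | trans _ _ ih ih' => exact (ih p).trans (ih' p)
  | comp_congr _ _ ih ih' => simp only [proj, ih, ih']
  | tensor_congr _ _ ih ih' => simp only [proj, ih, ih']
  | add_congr _ _ ih ih' => simp only [proj, ih, ih']
  | smul_congr c _ ih => simp only [proj, ih]
  | add_comm f g => exact _root_.add_comm _ _
  | add_assoc f g h => exact _root_.add_assoc _ _ _
  | zero_add f => exact _root_.zero_add _
  | zero_smul f => exact _root_.zero_smul _ _
  | one_smul f => exact _root_.one_smul _ _
  | mul_smul c d f => exact (_root_.smul_smul _ _ _).symm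
  | smul_add c f g => exact _root_.smul_add _ _ _
  | add_smul c d f => exact _root_.add_smul _ _ _
  | id_comp f => simp [proj]
  | comp_id f => rcases parity_cases p with rfl | rfl <;> simp [proj, e]
  | comp_assoc f g h =>
    rcases parity_cases p with rfl | rfl <;>
      simp only [proj, Mor.add_comp, Mor.comp_add, Mor.comp_assoc, _root_.zero_add, e] <;> abel
  | add_comp f f' g => simp only [proj, Mor.add_comp]; abel
  | comp_add f g g' => simp only [proj, Mor.comp_add]; abel
  | smul_comp c f g => simp only [proj, Mor.smul_comp, _root_.smul_add]
  | comp_smul c f g => simp only [proj, Mor.comp_smul, _root_.smul_add]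
  | add_tensor f f' g => simp only [proj, Mor.add_tensor]; abel
  | tensor_add f g g' => simp only [proj, Mor.tensor_add]; abel
  | smul_tensor c f g => simp only [proj, Mor.smul_tensor, _root_.smul_add]
  | tensor_smul c f g => simp only [proj, Mor.tensor_smul, _root_.smul_add]
  | tensor_id X Y =>
    exact homog (Term.Rel.tensor_id X Y) ((Term.HasParity.id X).tensor (.id Y)) (.id _) p
  | @interchange _ _ _ _ _ _ f f' g' g a a' b b' hf hf' hg hg' =>
    refine homog (Term.Rel.interchange hf hf' hg hg')
      ((hf.tensor hg').comp (hf'.tensor hg)) (.smul _ ?_) p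
    have e : a + b' + (a' + b) = (a + a') + (b' + b) := by ring
    rw [e]
    exact (hf.comp hf').tensor (hg'.comp hg)
  | @tensor_assoc X X' Y Y' Z Z' f g h =>
    have key (x : Mor gA X X') (y : Mor gA Y Y') (z : Mor gA Z Z') := Mor.tensor_assoc x y z
    simp only [proj, proj_of_parity (eqTo_parity (gA := gA) _)]
    rcases parity_cases p with rfl | rfl <;>
      simp [Mor.add_tensor, Mor.tensor_add, Mor.add_comp, Mor.comp_add, key, e] <;> abel
  | unit_tensor f => simp [proj]
  | @tensor_unit X Y f =>
    have key (x : Mor gA X Y) := Mor.tensor_unit x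
    simp only [proj, proj_of_parity (eqTo_parity (gA := gA) _)]
    rcases parity_cases p with rfl | rfl <;>
      simp [key, e]
  | token_one =>
    have h1 : (1 : A) ∈ gA 0 := SetLike.GradedOne.one_mem
    exact homog Term.Rel.token_one (.token h1) (.id _) p
  | token_linear c d a b =>
    simp only [proj, map_add, map_smul, token_add, token_smul]
  | token_mul a b =>
    simp only [proj, token_comp, pr_mul a b p, token_add]
  | cross_sq => exact homog Term.Rel.cross_sq (.comp .cross .cross) (.id _) p
  | braid =>
    have hL : Term.HasParity gA Term.crossL 0 := .tensor .cross (.id _)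
    have hR : Term.HasParity gA Term.crossR 0 := .tensor (.id _) .cross
    exact homog Term.Rel.braid (hL.comp (hR.comp hL)) (hR.comp (hL.comp hR)) p
  | token_cross a =>
    have key (a : A) := sound (Term.Rel.token_cross (gA := gA) a)
    simp only [proj]
    rcases parity_cases p with rfl | rfl <;> simp [e] <;> exact key _
  | left_right => exact homog Term.Rel.left_right (rightCross_parity.comp leftCross_parity) (.id _) p
  | right_left => exact homog Term.Rel.right_left (leftCross_parity.comp rightCross_parity) (.id _) p
  | left_curl => exact homog Term.Rel.left_curl leftCurl_parity (.id _) p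
  | right_curl => exact homog Term.Rel.right_curl rightCurl_parity (.id _) p
  | zigzag_up => exact homog Term.Rel.zigzag_up zigzagUp_parity (.id _) p
  | zigzag_down => exact homog Term.Rel.zigzag_down zigzagDown_parity (.id _) p

variable (gA) in
/-- The projection to the morphisms of parity `p`. -/
noncomputable def morPr (X Y : List Orient) (p : ZMod 2) : Mor gA X Y →ₗ[k] Mor gA X Y where
  toFun f := Quotient.lift (s := setoid gA X Y) (fun t => proj gA t p)
    (fun _ _ h => proj_congr h p) f
  map_add' f g := by
    obtain ⟨f, rfl⟩ := mk_surj f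
    obtain ⟨g, rfl⟩ := mk_surj g
    rfl
  map_smul' c f := by
    obtain ⟨f, rfl⟩ := mk_surj f
    rfl

noncomputable instance morDec (X Y : List Orient) : DirectSum.Decomposition (Mor.gr gA X Y) :=
  decompositionOfProj _ (morPr gA X Y)
    (by
      intro p f
      obtain ⟨t, rfl⟩ := mk_surj f
      exact proj_mem t p)
    (by
      intro f
      obtain ⟨t, rfl⟩ := mk_surj f
      exact proj_add t)
    (by
      rintro p q _ ⟨t, ht, rfl⟩
      exact proj_of_parity ht p)

end Projection

theorem mor_interchange [GradedAlgebra gA] {X₁ X₂ X₃ Y₁ Y₂ Y₃ : List Orient} {p q : ZMod 2}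
    (f : Mor gA X₁ X₂) (f' : Mor gA X₂ X₃) (g' : Mor gA Y₁ Y₂) (g : Mor gA Y₂ Y₃)
    (hf : f ∈ Mor.gr gA X₁ X₂ p) (hg : g ∈ Mor.gr gA Y₂ Y₃ q) :
    Mor.comp (Mor.tensor f g') (Mor.tensor f' g) =
      sgn k (p * q) • Mor.tensor (Mor.comp f f') (Mor.comp g' g) := by
  have key : ∀ (a b : ZMod 2), ∀ f'₀ ∈ Mor.gr gA X₂ X₃ a, ∀ g'₀ ∈ Mor.gr gA Y₁ Y₂ b,
      Mor.comp (Mor.tensor f g'₀) (Mor.tensor f'₀ g) =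
        sgn k (p * q) • Mor.tensor (Mor.comp f f'₀) (Mor.comp g'₀ g) := by
    rintro a b _ ⟨f', hf', rfl⟩ _ ⟨g', hg', rfl⟩
    obtain ⟨f, hf, rfl⟩ := hf
    obtain ⟨g, hg, rfl⟩ := hg
    exact sound (Term.Rel.interchange hf hf' hg hg')
  have m1 := fun i => pr_mem (Mor.gr gA X₂ X₃) i f'
  have m2 := fun i => pr_mem (Mor.gr gA Y₁ Y₂) i g'
  rw [← pr_add (Mor.gr gA X₂ X₃) f', ← pr_add (Mor.gr gA Y₁ Y₂) g']
  simp only [Mor.comp_add, Mor.add_comp, Mor.tensor_add, Mor.add_tensor, smul_add]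
  rw [key _ _ _ (m1 0) _ (m2 0), key _ _ _ (m1 1) _ (m2 0), key _ _ _ (m1 0) _ (m2 1),
    key _ _ _ (m1 1) _ (m2 1)]
  abel

theorem eqTo_comp {X Y Z : List Orient} (h : X = Y) (h' : Y = Z) :
    Mor.comp (cls (.eqTo h) : Mor gA X Y) (cls (.eqTo h')) = cls (.eqTo (h.trans h')) := by
  subst h; subst h'; exact Mor.id_comp _

theorem eqTo_tensor {X X' Y Y' : List Orient} (h : X = X') (h' : Y = Y') :
    Mor.tensor (cls (.eqTo h) : Mor gA X X') (cls (.eqTo h') : Mor gA Y Y') =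
      cls (.eqTo (h ▸ h' ▸ rfl : X ++ Y = X' ++ Y')) := by
  subst h; subst h'; exact sound (Term.Rel.tensor_id X Y)

section Category

instance : Category (OB gA) where
  Hom X Y := Mor gA X.word Y.word
  id X := cls (.id X.word)
  comp f g := Mor.comp f g
  id_comp f := Mor.id_comp f
  comp_id f := Mor.comp_id f
  assoc f g h := Mor.comp_assoc f g h

instance : Preadditive (OB gA) where
  homGroup X Y := inferInstanceAs (AddCommGroup (Mor gA X.word Y.word))
  add_comp _ _ _ f f' g := Mor.add_comp f f' g
  comp_add _ _ _ f g g' := Mor.comp_add f g g'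

instance : Linear k (OB gA) where
  homModule X Y := inferInstanceAs (Module k (Mor gA X.word Y.word))
  smul_comp _ _ _ c f g := Mor.smul_comp c f g
  comp_smul _ _ _ f c g := Mor.comp_smul c f g

variable [GradedAlgebra gA]

noncomputable instance : Supercategory k (OB gA) where
  homGr X Y := Mor.gr gA X.word Y.word
  homDec X Y := morDec X.word Y.word
  id_mem X := ⟨_, .id X.word, rfl⟩
  comp_mem := Mor.comp_mem

/-- The identity, viewed as an isomorphism between equal objects. -/
def eqIso {X Y : OB gA} (h : X.word = Y.word) : X ≅ Y where
  hom := cls (.eqTo h)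
  inv := cls (.eqTo h.symm)
  hom_inv_id := eqTo_comp h h.symm
  inv_hom_id := eqTo_comp h.symm h

/-- The strict monoidal structure: on objects it is concatenation of words, and the constraints
are identities between equal words. -/
noncomputable instance : MonoidalSupercategory k (OB gA) where
  tObj X Y := ⟨X.word ++ Y.word⟩
  tUnit := ⟨[]⟩
  tHom := Mor.tensorₗ gA _ _ _ _
  tHom_mem := Mor.tensor_mem
  tHom_id X Y := sound (Term.Rel.tensor_id X.word Y.word)
  interchange f f' g' g hf hg := mor_interchange f f' g' g hf hg
  assoc X Y Z := eqIso (List.append_assoc X.word Y.word Z.word)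
  lUnit X := eqIso rfl
  rUnit X := eqIso (List.append_nil X.word)
  assoc_mem _ _ _ := ⟨_, eqTo_parity _, rfl⟩
  lUnit_mem _ := ⟨_, eqTo_parity _, rfl⟩
  rUnit_mem _ := ⟨_, eqTo_parity _, rfl⟩
  assoc_natural f g h := Mor.tensor_assoc f g h
  lUnit_natural f :=
    ((Mor.comp_id _).trans (Mor.unit_tensor f)).trans (Mor.id_comp f).symm
  rUnit_natural f := Mor.tensor_unit f
  pentagon W X Y Z := by
    change Mor.comp (Mor.tensor (cls (.eqTo _)) (cls (.eqTo rfl)))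
      (Mor.comp (cls (.eqTo _)) (Mor.tensor (cls (.eqTo rfl)) (cls (.eqTo _)))) =
      Mor.comp (cls (.eqTo _)) (cls (.eqTo _))
    simp only [eqTo_tensor, eqTo_comp]
  triangle X Y := by
    change Mor.comp (cls (.eqTo _)) (Mor.tensor (cls (.eqTo rfl)) (cls (.eqTo _))) =
      Mor.tensor (cls (.eqTo _)) (cls (.eqTo rfl))
    simp only [eqTo_tensor, eqTo_comp]

end Category

section Generators

variable (gA)

/-- The generating object `↑`. -/
def up : OB gA := ⟨[.up]⟩

/-- The generating object `↓`. -/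
def down : OB gA := ⟨[.down]⟩

variable [GradedAlgebra gA]

open MonoidalSupercategory

/-- The upward crossing. -/
noncomputable def cross : tObj k (up gA) (up gA) ⟶ tObj k (up gA) (up gA) := cls .cross

/-- The token labelled `a`. -/
def token (a : A) : up gA ⟶ up gA := cls (.token a)

/-- The right cup. -/
noncomputable def rightCup : tUnit k ⟶ tObj k (down gA) (up gA) := cls .rightCup

/-- The right cap. -/
noncomputable def rightCap : tObj k (up gA) (down gA) ⟶ tUnit k := cls .rightCap

/-- The left cup. -/
noncomputable def leftCup : tUnit k ⟶ tObj k (up gA) (down gA) := cls .leftCup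

/-- The left cap. -/
noncomputable def leftCap : tObj k (down gA) (up gA) ⟶ tUnit k := cls .leftCap

end Generators

end OB

end Brauer

section Statement

open MonoidalSupercategory

/-- The parity `p(i)`: the first `m` indices are even and the last `n` indices are odd. -/
def indexParity (m n : ℕ) (i : Fin (m + n)) : ZMod 2 := if i.val < m then 0 else 1

/-- For a monoidal superfunctor with `F X = V` and `F Y = W`, the coherence isomorphism
`V ⊗ W ≅ F (X ⊗ Y)`. -/
def MonoidalSuperfunctor.tensorId {k : Type*} [Field k]
    {C : Type*} [Category C] [Preadditive C] [Linear k C] [Supercategory k C]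
    [MonoidalSupercategory k C]
    {D : Type*} [Category D] [Preadditive D] [Linear k D] [Supercategory k D]
    [MonoidalSupercategory k D] (F : MonoidalSuperfunctor k C D) {X Y : C} {V W : D}
    (hX : F.obj X = V) (hY : F.obj Y = W) : tObj k V W ≅ F.obj (tObj k X Y) :=
  eqToIso (congrArg₂ (tObj k) hX.symm hY.symm) ≪≫ F.tensorIso X Y

end Statement

end FrobBrauer

open FrobBrauer

/-!
An even invariant duality between two supermodules, together with an action of `A` on the first
of them, determines a monoidal superfunctor on the oriented Frobenius Brauer category
(`exists_superfunctor_of_dualPair`). The theorem is the case of the row and column vectors over `A`,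
paired by the form `B` (`vectorDualPair`), with `A` acting on rows by left multiplication
(`vectorTokenAction`).

For a dual pair `V`, `W` every generator except the tokens comes from the form and the braiding.
The upward crossing is the flip `v ⊗ w ↦ (-1)^{v̄ w̄} w ⊗ v`; the left cap is the form and the left
cup is the canonical element `∑ v ⊗ v^∨`; the right cap and the right cup are obtained from these
by composing with the flip. The canonical element is invariant because the form is
(`DualPair.act_canonical`). On homogeneous pure tensors each relation reduces to the expansions of
vectors in the dual bases: in a sum `∑ ± B(v^∨, w) v` only the terms with `v̄ = w̄` survive, so the
signs can be evaluated at the parity of `w` (`DualPair.sum_form_vec`, `DualPair.sum_form_dvec`). In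
particular the right and left crossings are again flips (`interp_rightCross`, `interp_leftCross`),
hence inverse to each other.

Morphisms of the source category are classes of formal expressions, and an expression is
interpreted by recursion (`interp`), which respects all relations (`interp_sound`). The source is
strict while the target is not, so words are sent to tensor products bracketed to the right, and
the coherence isomorphisms `wordTensor` move the brackets of a concatenation. They are even and
act on pure tensors without signs, which reduces their coherence to pure tensors.

That the row and column vectors form a dual pair rests on the fact that a left dual basis of a
finite-dimensional `A` is homogeneous and again a basis (`SymmetricFrobenius.dual_mem`,
`SymmetricFrobenius.sum_tr_basis_smul_dual`).
-/

namespace FrobBrauer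

/-! ### Even morphisms of supermodules -/

namespace SMod

variable {k : Type u} [Field k] {g : LieSuperalgebra k}

@[simp] theorem lin_hom_inv {V W : SMod g} (e : V ≅ W) (w : W.carrier) :
    lin e.hom (lin e.inv w) = w := by
  rw [← LinearMap.comp_apply, ← lin_comp, e.inv_hom_id, lin_id, LinearMap.id_apply]

@[simp] theorem lin_inv_hom {V W : SMod g} (e : V ≅ W) (v : V.carrier) :
    lin e.inv (lin e.hom v) = v := by
  rw [← LinearMap.comp_apply, ← lin_comp, e.hom_inv_id, lin_id, LinearMap.id_apply]

theorem pr_lin_of_even {V W : SMod g} {f : V ⟶ W} (hf : f ∈ homGr V W 0) (p : ZMod 2)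
    (v : V.carrier) : pr W.gr p (lin f v) = lin f (pr V.gr p v) := by
  have : pr W.gr p ∘ₗ lin f = lin f ∘ₗ pr V.gr p := by
    refine ext_homog (gr := V.gr) fun a v hv => ?_
    have h := hf a v hv
    rw [add_zero] at h
    simp only [LinearMap.comp_apply, pr_of_mem V.gr hv, pr_of_mem W.gr h]
    by_cases h : p = a <;> simp [h]
  exact LinearMap.congr_fun this v

theorem inv_even {V W : SMod g} {e : V ≅ W} (he : e.hom ∈ homGr V W 0) :
    e.inv ∈ homGr W V 0 := by
  intro p w hw
  have h : lin e.inv w = pr V.gr p (lin e.inv w) := by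
    have h1 := pr_lin_of_even he p (lin e.inv w)
    rw [lin_hom_inv, pr_of_mem W.gr hw, if_pos rfl] at h1
    rw [← lin_inv_hom e (pr V.gr p (lin e.inv w)), ← h1]
  rw [add_zero, h]
  exact pr_mem _ _ _

theorem comp_even {U V W : SMod g} {f : U ⟶ V} {h : V ⟶ W} (hf : f ∈ homGr U V 0)
    (hh : h ∈ homGr V W 0) : f ≫ h ∈ homGr U W 0 := by
  intro p u hu
  simpa using hh _ _ (hf p u hu)

theorem tensorHom_comp_of_right_even {V V' V'' W W' W'' : SMod g} (f : V ⟶ V') (f' : V' ⟶ V'')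
    (h : W ⟶ W') {h' : W' ⟶ W''} (hh : h' ∈ homGr W' W'' 0) :
    tensorHom V V' W W' f h ≫ tensorHom V' V'' W' W'' f' h' =
      tensorHom V V'' W W'' (f ≫ f') (h ≫ h') := by
  induction f using hom_homog with
  | hadd a b ha hb =>
    simp only [map_add, LinearMap.add_apply, Preadditive.add_comp, ha, hb]
  | h p f hf =>
    have := MonoidalSupercategory.interchange (k := k) f f' h h' hf hh
    rwa [mul_zero, sgn_zero, one_smul] at this

theorem tensorHom_comp_of_left_even {V V' V'' W W' W'' : SMod g} {f : V ⟶ V'} (f' : V' ⟶ V'')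
    (h : W ⟶ W') (h' : W' ⟶ W'') (hf : f ∈ homGr V V' 0) :
    tensorHom V V' W W' f h ≫ tensorHom V' V'' W' W'' f' h' =
      tensorHom V V'' W W'' (f ≫ f') (h ≫ h') := by
  induction h' using hom_homog with
  | hadd a b ha hb =>
    simp only [map_add, Preadditive.comp_add, ha, hb]
  | h p h' hh =>
    have := MonoidalSupercategory.interchange (k := k) f f' h h' hf hh
    rwa [zero_mul, sgn_zero, one_smul] at this

theorem tensorHom_id (V W : SMod g) : tensorHom V V W W (𝟙 V) (𝟙 W) = 𝟙 (tensor V W) :=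
  MonoidalSupercategory.tHom_id (k := k) V W

/-- The isomorphism `e ⊗ 1`. -/
noncomputable def whiskerRightIso {V V' : SMod g} (e : V ≅ V') (W : SMod g) :
    tensor V W ≅ tensor V' W where
  hom := tensorHom _ _ _ _ e.hom (𝟙 W)
  inv := tensorHom _ _ _ _ e.inv (𝟙 W)
  hom_inv_id := by
    rw [tensorHom_comp_of_right_even _ _ _ (id_even W), e.hom_inv_id, Category.id_comp,
      tensorHom_id]
  inv_hom_id := by
    rw [tensorHom_comp_of_right_even _ _ _ (id_even W), e.inv_hom_id, Category.id_comp,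
      tensorHom_id]

/-- The isomorphism `1 ⊗ e`. -/
noncomputable def whiskerLeftIso (V : SMod g) {W W' : SMod g} (e : W ≅ W') :
    tensor V W ≅ tensor V W' where
  hom := tensorHom _ _ _ _ (𝟙 V) e.hom
  inv := tensorHom _ _ _ _ (𝟙 V) e.inv
  hom_inv_id := by
    rw [tensorHom_comp_of_left_even _ _ _ (id_even V), e.hom_inv_id, Category.id_comp,
      tensorHom_id]
  inv_hom_id := by
    rw [tensorHom_comp_of_left_even _ _ _ (id_even V), e.inv_hom_id, Category.id_comp,
      tensorHom_id]

theorem whiskerRightIso_even {V V' : SMod g} {e : V ≅ V'} (he : e.hom ∈ homGr V V' 0)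
    (W : SMod g) : (whiskerRightIso e W).hom ∈ homGr _ _ 0 := by
  have h := tensorHom_mem he (id_even W)
  rwa [zero_add] at h

theorem whiskerLeftIso_even (V : SMod g) {W W' : SMod g} {e : W ≅ W'}
    (he : e.hom ∈ homGr W W' 0) : (whiskerLeftIso V e).hom ∈ homGr _ _ 0 := by
  have h := tensorHom_mem (id_even V) he
  rwa [zero_add] at h

end SMod

/-! ### Tensor products indexed by words -/

section Words

open SMod

variable {k : Type u} [Field k] {g : LieSuperalgebra k} (gen : Orient → SMod g)

/-- The tensor product of the modules `gen o` over the letters `o` of a word, bracketed to the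
right. There is no trailing factor `k`, so that a word of length one gives `gen o` itself. -/
noncomputable def wordObj : List Orient → SMod g
  | [] => SMod.unit g
  | [o] => gen o
  | o :: o' :: l => SMod.tensor (gen o) (wordObj (o' :: l))

/-- Adding a letter to a word tensors its module with `gen o`. This is the right unit constraint
for the empty word and the identity for all others. -/
noncomputable def consIso (o : Orient) :
    ∀ l : List Orient, SMod.tensor (gen o) (wordObj gen l) ≅ wordObj gen (o :: l)
  | [] => rUnitIso (gen o)
  | _ :: _ => Iso.refl _

theorem consIso_even (o : Orient) (l : List Orient) : (consIso gen o l).hom ∈ homGr _ _ 0 := by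
  cases l with
  | nil => exact rUnit_mem _
  | cons o' l => exact id_even _

/-- The isomorphism between the tensor product of the modules of two words and the module of the
concatenated word. -/
noncomputable def wordTensor : ∀ X Y : List Orient,
    SMod.tensor (wordObj gen X) (wordObj gen Y) ≅ wordObj gen (X ++ Y)
  | [], Y => lUnitIso (wordObj gen Y)
  | o :: l, Y =>
    whiskerRightIso (consIso gen o l).symm (wordObj gen Y) ≪≫ assocIso _ _ _ ≪≫
      whiskerLeftIso (gen o) (wordTensor l Y) ≪≫ consIso gen o (l ++ Y)

theorem wordTensor_even (X Y : List Orient) : (wordTensor gen X Y).hom ∈ homGr _ _ 0 := by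
  induction X with
  | nil => exact lUnit_mem _
  | cons o l ih =>
    have h1 : (whiskerRightIso (consIso gen o l).symm (wordObj gen Y)).hom ∈ homGr _ _ 0 :=
      whiskerRightIso_even (inv_even (consIso_even gen o l)) _
    have h2 : (whiskerLeftIso (gen o) (wordTensor gen l Y)).hom ∈ homGr _ _ 0 :=
      whiskerLeftIso_even _ ih
    exact comp_even h1 (comp_even (assoc_mem _ _ _) (comp_even h2 (consIso_even gen o _)))

theorem wordTensor_nil (Y : List Orient) (c : k) (y : (wordObj gen Y).carrier) :
    lin (wordTensor gen [] Y).hom (c ⊗ₜ[k] y) = c • y := rfl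

theorem wordTensor_consIso (o : Orient) (l Y : List Orient) (v : (gen o).carrier)
    (x : (wordObj gen l).carrier) (y : (wordObj gen Y).carrier) :
    lin (wordTensor gen (o :: l) Y).hom (lin (consIso gen o l).hom (v ⊗ₜ[k] x) ⊗ₜ[k] y) =
      lin (consIso gen o (l ++ Y)).hom (v ⊗ₜ[k] lin (wordTensor gen l Y).hom (x ⊗ₜ[k] y)) := by
  change lin (consIso gen o (l ++ Y)).hom
    (lin (tensorHom _ _ _ _ (𝟙 (gen o)) (wordTensor gen l Y).hom)
      (lin (assocIso _ _ _).hom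
        (lin (tensorHom _ _ _ _ (consIso gen o l).inv (𝟙 _)) _))) = _
  rw [tensorHom_even _ (id_even _), lin_inv_hom, lin_assoc,
    tensorHom_even _ (wordTensor_even gen l Y)]
  rfl

theorem wordTensor_single (o : Orient) (Y : List Orient) (v : (gen o).carrier)
    (y : (wordObj gen Y).carrier) :
    lin (wordTensor gen [o] Y).hom (v ⊗ₜ[k] y) = lin (consIso gen o Y).hom (v ⊗ₜ[k] y) := by
  have h := wordTensor_consIso gen o [] Y v (1 : k) y
  rw [wordTensor_nil, one_smul] at h
  have e : lin (consIso gen o []).hom (v ⊗ₜ[k] (1 : k)) = v := one_smul k v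
  rw [e] at h
  exact h

theorem wordTensor_single_cons (o o' : Orient) (l : List Orient) (v : (gen o).carrier)
    (y : (wordObj gen (o' :: l)).carrier) :
    lin (wordTensor gen [o] (o' :: l)).hom (v ⊗ₜ[k] y) = v ⊗ₜ[k] y :=
  wordTensor_single gen o (o' :: l) v y

/-- The isomorphism between the modules of equal words. -/
noncomputable def wordCast {X Y : List Orient} (h : X = Y) : wordObj gen X ⟶ wordObj gen Y :=
  eqToHom (congrArg (wordObj gen) h)

theorem wordCast_consIso (o : Orient) {X Y : List Orient} (h : X = Y) (v : (gen o).carrier)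
    (x : (wordObj gen X).carrier) :
    lin (wordCast gen (congrArg (List.cons o) h)) (lin (consIso gen o X).hom (v ⊗ₜ[k] x)) =
      lin (consIso gen o Y).hom (v ⊗ₜ[k] lin (wordCast gen h) x) := by
  subst h; rfl

/-- The module of a word is spanned by the elements obtained from scalars by repeatedly putting a
vector in front, so that additive statements need only be checked for these. -/
theorem word_induction {P : ∀ X, (wordObj gen X).carrier → Prop}
    (hadd : ∀ X x y, P X x → P X y → P X (x + y))
    (hnil : ∀ c : k, P [] c)
    (hcons : ∀ o l v x, P l x → P (o :: l) (lin (consIso gen o l).hom (v ⊗ₜ[k] x)))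
    (X : List Orient) (x : (wordObj gen X).carrier) : P X x := by
  induction X with
  | nil => exact hnil x
  | cons o l ih =>
    rw [← lin_hom_inv (consIso gen o l) x]
    generalize lin (consIso gen o l).inv x = t
    induction t using TensorProduct.induction_on with
    | zero =>
      have := hcons o l 0 0 (ih 0)
      rwa [TensorProduct.zero_tmul] at this
    | tmul v y => exact hcons o l v y (ih y)
    | add s t hs ht => rw [map_add]; exact hadd _ _ _ hs ht

/-- The associativity of `wordTensor`, on pure tensors. Both sides live over words that are equal
only propositionally, whence the cast. -/
theorem wordTensor_assoc_apply (X Y Z : List Orient) (x : (wordObj gen X).carrier)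
    (y : (wordObj gen Y).carrier) (z : (wordObj gen Z).carrier) :
    lin (wordCast gen (List.append_assoc X Y Z)) (lin (wordTensor gen (X ++ Y) Z).hom
      (lin (wordTensor gen X Y).hom (x ⊗ₜ[k] y) ⊗ₜ[k] z)) =
    lin (wordTensor gen X (Y ++ Z)).hom
      (x ⊗ₜ[k] lin (wordTensor gen Y Z).hom (y ⊗ₜ[k] z)) := by
  revert X
  apply word_induction
  · intro X x x' h h'
    simp only [TensorProduct.add_tmul, map_add, h, h']
  · intro c
    change lin (wordTensor gen Y Z).hom ((c • y) ⊗ₜ[k] z) = c • lin (wordTensor gen Y Z).hom _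
    rw [← map_smul, TensorProduct.smul_tmul']
  · intro o l v x h
    rw [wordTensor_consIso, wordTensor_consIso]
    change lin (wordCast gen (congrArg (List.cons o) (List.append_assoc l Y Z)))
      (lin (wordTensor gen (o :: (l ++ Y)) Z).hom _) = _
    rw [wordTensor_consIso]
    exact (wordCast_consIso gen o (List.append_assoc l Y Z) v _).trans (by rw [h])

theorem wordTensor_assoc (X Y Z : List Orient) :
    tensorHom _ _ _ _ (wordTensor gen X Y).hom (𝟙 (wordObj gen Z)) ≫
      (wordTensor gen (X ++ Y) Z).hom ≫ wordCast gen (List.append_assoc X Y Z) =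
    (assocIso _ _ _).hom ≫ tensorHom _ _ _ _ (𝟙 (wordObj gen X)) (wordTensor gen Y Z).hom ≫
      (wordTensor gen X (Y ++ Z)).hom := by
  apply tensor_hom_ext3
  intro _ _ _ x y z _ _ _
  simp only [lin_comp, LinearMap.comp_apply]
  rw [tensorHom_even _ (id_even _), lin_assoc, tensorHom_even _ (wordTensor_even gen Y Z)]
  exact wordTensor_assoc_apply gen X Y Z x y z

theorem wordTensor_right_unit_apply (X : List Orient) (x : (wordObj gen X).carrier)
    (c : (wordObj gen []).carrier) :
    lin (wordCast gen (List.append_nil X)) (lin (wordTensor gen X []).hom (x ⊗ₜ[k] c)) =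
      (show k from c) • x := by
  revert X
  apply word_induction
  · intro X x y h h'
    rw [TensorProduct.add_tmul, map_add, map_add, h, h', smul_add]
  · intro d
    exact mul_comm d (show k from c)
  · intro o l v x h
    rw [wordTensor_consIso]
    refine (wordCast_consIso gen o (List.append_nil l) v _).trans ?_
    rw [h, TensorProduct.tmul_smul, map_smul]

theorem wordTensor_right_unit (X : List Orient) :
    (wordTensor gen X []).hom ≫ wordCast gen (List.append_nil X) =
      (rUnitIso (wordObj gen X)).hom :=
  tensor_hom_ext fun _ _ x c _ _ => wordTensor_right_unit_apply gen X x c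

/-- The tensor product of two homomorphisms, as a homomorphism between modules of words. -/
noncomputable def wordHom {X X' Y Y' : List Orient} (f : wordObj gen X ⟶ wordObj gen X')
    (h : wordObj gen Y ⟶ wordObj gen Y') : wordObj gen (X ++ Y) ⟶ wordObj gen (X' ++ Y') :=
  (wordTensor gen X Y).inv ≫ tensorHom _ _ _ _ f h ≫ (wordTensor gen X' Y').hom

variable {gen}

theorem wordTensor_comp_wordHom {X X' Y Y' : List Orient} (f : wordObj gen X ⟶ wordObj gen X')
    (h : wordObj gen Y ⟶ wordObj gen Y') :
    (wordTensor gen X Y).hom ≫ wordHom gen f h =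
      tensorHom _ _ _ _ f h ≫ (wordTensor gen X' Y').hom := by
  rw [wordHom, Iso.hom_inv_id_assoc]

theorem wordHom_mem {X X' Y Y' : List Orient} {f : wordObj gen X ⟶ wordObj gen X'}
    {h : wordObj gen Y ⟶ wordObj gen Y'} {p q : ZMod 2} (hf : f ∈ homGr _ _ p)
    (hh : h ∈ homGr _ _ q) : wordHom gen f h ∈ homGr _ _ (p + q) := by
  have h1 := Supercategory.comp_mem (k := k) (inv_even (wordTensor_even gen X Y))
    (Supercategory.comp_mem (k := k) (tensorHom_mem hf hh) (wordTensor_even gen X' Y'))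
  rwa [zero_add, add_zero] at h1

theorem wordHom_apply {X X' Y Y' : List Orient} (f : wordObj gen X ⟶ wordObj gen X')
    {h : wordObj gen Y ⟶ wordObj gen Y'} (hh : h ∈ homGr _ _ 0) (x : (wordObj gen X).carrier)
    (y : (wordObj gen Y).carrier) :
    lin (wordHom gen f h) (lin (wordTensor gen X Y).hom (x ⊗ₜ[k] y)) =
      lin (wordTensor gen X' Y').hom (lin f x ⊗ₜ[k] lin h y) := by
  rw [← LinearMap.comp_apply, ← lin_comp, wordTensor_comp_wordHom, lin_comp, LinearMap.comp_apply,
    tensorHom_even _ hh]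

theorem wordHom_id (X Y : List Orient) :
    wordHom gen (𝟙 (wordObj gen X)) (𝟙 (wordObj gen Y)) = 𝟙 _ := by
  rw [wordHom, tensorHom_id, Category.id_comp, Iso.inv_hom_id]

theorem wordHom_interchange {X₁ X₂ X₃ Y₁ Y₂ Y₃ : List Orient} {p q : ZMod 2}
    (f : wordObj gen X₁ ⟶ wordObj gen X₂) (f' : wordObj gen X₂ ⟶ wordObj gen X₃)
    (h' : wordObj gen Y₁ ⟶ wordObj gen Y₂) (h : wordObj gen Y₂ ⟶ wordObj gen Y₃)
    (hf : f ∈ homGr _ _ p) (hh : h ∈ homGr _ _ q) :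
    wordHom gen f h' ≫ wordHom gen f' h =
      sgn k (p * q) • wordHom gen (f ≫ f') (h' ≫ h) := by
  have e := MonoidalSupercategory.interchange (k := k) f f' h' h hf hh
  change tensorHom _ _ _ _ f h' ≫ tensorHom _ _ _ _ f' h =
    sgn k (p * q) • tensorHom _ _ _ _ (f ≫ f') (h' ≫ h) at e
  simp only [wordHom, Category.assoc, Iso.hom_inv_id_assoc]
  rw [← Category.assoc (tensorHom _ _ _ _ f h'), e]
  simp only [Linear.smul_comp, Linear.comp_smul]

/-- The tensor product of homomorphisms between modules of words is strictly associative, up to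
transport along equal words: `wordTensor_assoc` turns the associativity constraint of supermodules
into a cast. -/
theorem wordHom_assoc {X X' Y Y' Z Z' : List Orient} (f : wordObj gen X ⟶ wordObj gen X')
    (h : wordObj gen Y ⟶ wordObj gen Y') (j : wordObj gen Z ⟶ wordObj gen Z') :
    wordHom gen (wordHom gen f h) j ≫ wordCast gen (List.append_assoc X' Y' Z') =
      wordCast gen (List.append_assoc X Y Z) ≫ wordHom gen f (wordHom gen h j) := by
  have e := MonoidalSupercategory.assoc_natural (k := k) f h j
  change tensorHom _ _ _ _ (tensorHom _ _ _ _ f h) j ≫ (assocIso _ _ _).hom =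
    (assocIso _ _ _).hom ≫ tensorHom _ _ _ _ f (tensorHom _ _ _ _ h j) at e
  rw [← cancel_epi (wordTensor gen (X ++ Y) Z).hom,
    ← cancel_epi (whiskerRightIso (wordTensor gen X Y) (wordObj gen Z)).hom]
  change tensorHom _ _ _ _ (wordTensor gen X Y).hom (𝟙 _) ≫ _ =
    tensorHom _ _ _ _ (wordTensor gen X Y).hom (𝟙 _) ≫ _
  calc
    _ = tensorHom _ _ _ _ ((wordTensor gen X Y).hom ≫ wordHom gen f h) (𝟙 _ ≫ j) ≫
        (wordTensor gen (X' ++ Y') Z').hom ≫ wordCast gen (List.append_assoc X' Y' Z') := by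
      rw [← tensorHom_comp_of_left_even _ _ _ (wordTensor_even gen X Y), Category.assoc,
        ← Category.assoc (wordTensor gen (X ++ Y) Z).hom, wordTensor_comp_wordHom, Category.assoc]
    _ = tensorHom _ _ _ _ (tensorHom _ _ _ _ f h) j ≫
        tensorHom _ _ _ _ (wordTensor gen X' Y').hom (𝟙 _) ≫
        (wordTensor gen (X' ++ Y') Z').hom ≫ wordCast gen (List.append_assoc X' Y' Z') := by
      rw [wordTensor_comp_wordHom, Category.id_comp,
        ← Category.assoc (tensorHom _ _ _ _ (tensorHom _ _ _ _ f h) j),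
        tensorHom_comp_of_right_even _ _ _ (id_even _), Category.comp_id]
    _ = (assocIso _ _ _).hom ≫ tensorHom _ _ _ _ f (tensorHom _ _ _ _ h j) ≫
        tensorHom _ _ _ _ (𝟙 _) (wordTensor gen Y' Z').hom ≫
          (wordTensor gen X' (Y' ++ Z')).hom := by
      rw [wordTensor_assoc, ← Category.assoc, e, Category.assoc]
    _ = (assocIso _ _ _).hom ≫ tensorHom _ _ _ _ (𝟙 _) (wordTensor gen Y Z).hom ≫
          (wordTensor gen X (Y ++ Z)).hom ≫ wordHom gen f (wordHom gen h j) := by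
      rw [wordTensor_comp_wordHom, ← Category.assoc (tensorHom _ _ _ _ f _),
        ← Category.assoc (tensorHom _ _ _ _ (𝟙 _) (wordTensor gen Y Z).hom),
        tensorHom_comp_of_right_even _ _ _ (wordTensor_even gen Y' Z'),
        tensorHom_comp_of_left_even _ _ _ (id_even _), wordTensor_comp_wordHom,
        Category.id_comp, Category.comp_id]
    _ = _ := by
      have e' := congrArg (· ≫ wordHom gen f (wordHom gen h j)) (wordTensor_assoc gen X Y Z)
      simp only [Category.assoc] at e'
      exact e'.symm

theorem wordHom_unit_left {X Y : List Orient} (f : wordObj gen X ⟶ wordObj gen Y) :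
    wordHom gen (X := []) (X' := []) (𝟙 (wordObj gen [])) f = f := by
  have e := MonoidalSupercategory.lUnit_natural (k := k) f
  exact (Iso.inv_comp_eq _).2 e

theorem wordHom_unit_right {X Y : List Orient} (f : wordObj gen X ⟶ wordObj gen Y) :
    wordHom gen (Y := []) (Y' := []) f (𝟙 (wordObj gen [])) ≫ wordCast gen (List.append_nil Y) =
      wordCast gen (List.append_nil X) ≫ f := by
  have e := MonoidalSupercategory.rUnit_natural (k := k) f
  change tensorHom _ _ _ _ f (𝟙 _) ≫ (rUnitIso _).hom = (rUnitIso _).hom ≫ f at e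
  rw [← wordTensor_right_unit, ← wordTensor_right_unit] at e
  rw [wordHom, Category.assoc, Category.assoc, Iso.inv_comp_eq]
  exact e.trans (Category.assoc _ _ _)

end Words

/-! ### The symmetric braiding of supermodules -/

theorem sgn_sq {k : Type u} [Field k] (p : ZMod 2) : sgn k (p * p) = sgn k p := by
  rcases parity_cases p with rfl | rfl <;> simp

namespace SMod

variable {k : Type u} [Field k] {g : LieSuperalgebra k}

/-- The flip `v ⊗ w ↦ (-1)^{v̄ w̄} w ⊗ v` as a linear map. -/
noncomputable def flipLin (V W : SMod g) :
    V.carrier ⊗[k] W.carrier →ₗ[k] W.carrier ⊗[k] V.carrier :=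
  ∑ q : ZMod 2, (TensorProduct.comm k V.carrier W.carrier).toLinearMap ∘ₗ
    TensorProduct.map (tw V.gr q) (pr W.gr q)

theorem flipLin_tmul (V W : SMod g) {a b : ZMod 2} {v : V.carrier} {w : W.carrier}
    (hv : v ∈ V.gr a) (hw : w ∈ W.gr b) :
    flipLin V W (v ⊗ₜ[k] w) = sgn k (a * b) • (w ⊗ₜ[k] v) := by
  rw [flipLin, LinearMap.sum_apply, Finset.sum_eq_single b]
  · rw [LinearMap.comp_apply, TensorProduct.map_tmul, pr_of_mem W.gr hw, if_pos rfl,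
      tw_of_mem V.gr b hv, LinearEquiv.coe_coe, TensorProduct.comm_tmul, TensorProduct.tmul_smul]
  · intro q _ hq
    rw [LinearMap.comp_apply, TensorProduct.map_tmul, pr_of_mem W.gr hw, if_neg hq,
      TensorProduct.tmul_zero, map_zero]
  · simp

/-- The flip `v ⊗ w ↦ (-1)^{v̄ w̄} w ⊗ v`. -/
noncomputable def flip (V W : SMod g) : tensor V W ⟶ tensor W V :=
  ofLin (flipLin V W) (by
    have key : (tensor V W).act.compr₂ (flipLin V W) =
        (tensor W V).act.compl₂ (flipLin V W) := by
      refine ext_homog (gr := g.gr) fun r x hx =>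
        ext_tensor (gr := V.gr) (gr' := W.gr) fun a b v w hv hw => ?_
      change flipLin V W (tAct V W x (v ⊗ₜ[k] w)) = tAct W V x (flipLin V W (v ⊗ₜ[k] w))
      rw [tAct_tmul V W hx hw, map_add, map_smul, flipLin_tmul V W hv (W.act_mem hw hx),
        flipLin_tmul V W (V.act_mem hv hx) hw, flipLin_tmul V W hv hw, map_smul,
        tAct_tmul W V hx hv]
      simp only [smul_add, smul_smul, ← sgn_add]
      have e : b * r + (a + r) * b = a * b := by
        linear_combination CharTwo.add_self_eq_zero (b * r)
      rw [e, add_comm, mul_add]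
    intro x t
    exact LinearMap.congr_fun₂ key x t)

theorem flip_tmul (V W : SMod g) {a b : ZMod 2} {v : V.carrier} {w : W.carrier}
    (hv : v ∈ V.gr a) (hw : w ∈ W.gr b) :
    lin (flip V W) (v ⊗ₜ[k] w) = sgn k (a * b) • (w ⊗ₜ[k] v) := flipLin_tmul V W hv hw

theorem flip_even (V W : SMod g) : flip V W ∈ homGr _ _ 0 := by
  intro p
  apply tensorGr_le
  intro a b v w h hv hw
  rw [flip_tmul V W hv hw]
  exact Submodule.smul_mem _ _ (tmul_mem' hw hv (by rw [add_zero, ← h, add_comm]))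

theorem flip_flip (V W : SMod g) : flip V W ≫ flip W V = 𝟙 _ := by
  apply tensor_hom_ext
  intro a b v w hv hw
  rw [lin_comp, LinearMap.comp_apply, flip_tmul V W hv hw, map_smul, flip_tmul W V hw hv,
    smul_smul, mul_comm b a, sgn_mul_self, one_smul]
  rfl

theorem flip_natural {V V' : SMod g} (f : V ⟶ V') (W : SMod g) :
    tensorHom V V' W W f (𝟙 W) ≫ flip V' W = flip V W ≫ tensorHom W W V V' (𝟙 W) f := by
  induction f using hom_homog with
  | hadd a b ha hb =>
    simp only [map_add, LinearMap.add_apply, Preadditive.add_comp, Preadditive.comp_add, ha, hb]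
  | h r f hf =>
    apply tensor_hom_ext
    intro a b v w hv hw
    simp only [lin_comp, LinearMap.comp_apply]
    rw [tensorHom_even _ (id_even W), lin_id, LinearMap.id_apply, flip_tmul _ _ (hf a v hv) hw,
      flip_tmul _ _ hv hw, map_smul, tensorHom_tmul _ _ hw hf, smul_smul, ← sgn_add]
    congr 2
    ring

end SMod

/-! ### Dual pairs of supermodules -/

section Dual

open SMod

variable {k : Type u} [Field k] {g : LieSuperalgebra k}

/-- A duality between supermodules `V` and `W`: an even invariant form `W ⊗ V → k` together with
finite homogeneous families in `V` and `W` that are dual bases, which is expressed by the expansion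
formulas for the elements of `V` and of `W`. -/
structure DualPair (V W : SMod g) (κ : Type*) [Fintype κ] where
  form : W.carrier →ₗ[k] V.carrier →ₗ[k] k
  form_eq_zero {p q : ZMod 2} {w : W.carrier} {v : V.carrier} : w ∈ W.gr p → v ∈ V.gr q →
    p ≠ q → form w v = 0
  /-- invariance: the form vanishes on `(w ⊗ v) · x = w ⊗ (v · x) + (-1)^{v̄ x̄} (w · x) ⊗ v` -/
  form_act {p q r : ZMod 2} {w : W.carrier} {v : V.carrier} {x : g.carrier} : w ∈ W.gr p →
    v ∈ V.gr q → x ∈ g.gr r → form w (V.act x v) + sgn k (q * r) * form (W.act x w) v = 0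
  parity : κ → ZMod 2
  vec : κ → V.carrier
  vec_mem (i : κ) : vec i ∈ V.gr (parity i)
  dvec : κ → W.carrier
  dvec_mem (i : κ) : dvec i ∈ W.gr (parity i)
  expand (v : V.carrier) : ∑ i, form (dvec i) v • vec i = v
  dual_expand (w : W.carrier) : ∑ i, form w (vec i) • dvec i = w

namespace DualPair

variable {V W : SMod g} {κ : Type*} [Fintype κ] (D : DualPair V W κ)

/-- The expansion of `v`, with signs and under a linear map. The signs need only be known at the
parity of `v`, since the other coefficients vanish. -/
theorem sum_form_vec {M : Type*} [AddCommGroup M] [Module k M] (φ : V.carrier →ₗ[k] M)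
    {p : ZMod 2} {v : V.carrier} (hv : v ∈ V.gr p) (s : κ → k) (c : k)
    (hs : ∀ i, D.parity i = p → s i = c) :
    ∑ i, (s i * D.form (D.dvec i) v) • φ (D.vec i) = c • φ v := by
  conv_rhs => rw [← D.expand v, map_sum, Finset.smul_sum]
  refine Finset.sum_congr rfl fun i _ => ?_
  rw [map_smul, smul_smul]
  by_cases h : D.parity i = p
  · rw [hs i h]
  · rw [D.form_eq_zero (D.dvec_mem i) hv h, mul_zero, mul_zero]

/-- The dual expansion of `w`, with signs and under a linear map; compare `sum_form_vec`. -/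
theorem sum_form_dvec {M : Type*} [AddCommGroup M] [Module k M] (φ : W.carrier →ₗ[k] M)
    {p : ZMod 2} {w : W.carrier} (hw : w ∈ W.gr p) (s : κ → k) (c : k)
    (hs : ∀ i, D.parity i = p → s i = c) :
    ∑ i, (s i * D.form w (D.vec i)) • φ (D.dvec i) = c • φ w := by
  conv_rhs => rw [← D.dual_expand w, map_sum, Finset.smul_sum]
  refine Finset.sum_congr rfl fun i _ => ?_
  rw [map_smul, smul_smul]
  by_cases h : D.parity i = p
  · rw [hs i h]
  · rw [D.form_eq_zero hw (D.vec_mem i) (Ne.symm h), mul_zero, mul_zero]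

/-- The evaluation `w ⊗ v ↦ B(w, v)`. -/
noncomputable def leftCap : tensor W V ⟶ SMod.unit g :=
  ofLin (TensorProduct.lift D.form) (by
    have key : (tensor W V).act.compr₂ (TensorProduct.lift D.form) = 0 := by
      refine ext_homog (gr := g.gr) fun r x hx =>
        ext_tensor (gr := W.gr) (gr' := V.gr) fun a b w v hw hv => ?_
      change TensorProduct.lift D.form (tAct W V x (w ⊗ₜ[k] v)) = 0
      rw [tAct_tmul W V hx hv, map_add, map_smul, TensorProduct.lift.tmul,
        TensorProduct.lift.tmul]
      exact D.form_act hw hv hx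
    intro x t
    exact LinearMap.congr_fun₂ key x t)

theorem leftCap_tmul (w : W.carrier) (v : V.carrier) :
    lin D.leftCap (w ⊗ₜ[k] v) = D.form w v := rfl

theorem leftCap_even : D.leftCap ∈ homGr _ _ 0 := by
  intro p
  apply tensorGr_le
  intro a b w v h hw hv
  rw [leftCap_tmul]
  by_cases hab : a = b
  · subst hab
    rw [CharTwo.add_self_eq_zero] at h
    subst h
    exact unit_mem _
  · rw [D.form_eq_zero hw hv hab]
    exact zero_mem _

/-- The evaluation `v ⊗ w ↦ (-1)^{v̄ w̄} B(w, v)`. -/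
noncomputable def rightCap : tensor V W ⟶ SMod.unit g := flip V W ≫ D.leftCap

theorem rightCap_tmul {a b : ZMod 2} {v : V.carrier} {w : W.carrier} (hv : v ∈ V.gr a)
    (hw : w ∈ W.gr b) : lin D.rightCap (v ⊗ₜ[k] w) = sgn k (a * b) * D.form w v := by
  rw [rightCap, lin_comp, LinearMap.comp_apply, flip_tmul V W hv hw, map_smul]
  rfl

theorem rightCap_even : D.rightCap ∈ homGr _ _ 0 := comp_even (flip_even V W) D.leftCap_even

/-- The invariance of the canonical element follows from the invariance of the form: the
coefficients of `v ⊗ (w · x)` and `(v · x) ⊗ w` in terms of the dual bases are transposed. -/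
theorem act_canonical {r : ZMod 2} {x : g.carrier} (hx : x ∈ g.gr r) :
    tAct V W x (∑ i, D.vec i ⊗ₜ[k] D.dvec i) = 0 := by
  have h1 : ∀ i, D.vec i ⊗ₜ[k] W.act x (D.dvec i) =
      ∑ j, D.form (W.act x (D.dvec i)) (D.vec j) • (D.vec i ⊗ₜ[k] D.dvec j) := by
    intro i
    conv_lhs => rw [← D.dual_expand (W.act x (D.dvec i))]
    rw [TensorProduct.tmul_sum]
    exact Finset.sum_congr rfl fun j _ => TensorProduct.tmul_smul _ _ _
  have h2 : ∀ i, V.act x (D.vec i) ⊗ₜ[k] D.dvec i =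
      ∑ j, D.form (D.dvec j) (V.act x (D.vec i)) • (D.vec j ⊗ₜ[k] D.dvec i) := by
    intro i
    conv_lhs => rw [← D.expand (V.act x (D.vec i))]
    rw [TensorProduct.sum_tmul]
    exact Finset.sum_congr rfl fun j _ => (TensorProduct.smul_tmul' _ _ _).symm
  rw [map_sum]
  simp only [tAct_tmul V W hx (D.dvec_mem _), h1, h2, Finset.sum_add_distrib, Finset.smul_sum]
  rw [Finset.sum_comm (f := fun i j => sgn k (D.parity i * r) •
    D.form (D.dvec j) (V.act x (D.vec i)) • (D.vec j ⊗ₜ[k] D.dvec i)), ← Finset.sum_add_distrib]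
  refine Finset.sum_eq_zero fun i _ => ?_
  rw [← Finset.sum_add_distrib]
  refine Finset.sum_eq_zero fun j _ => ?_
  rw [smul_smul, ← add_smul]
  have h := congrArg (sgn k (D.parity j * r) * ·) (D.form_act (D.dvec_mem i) (D.vec_mem j) hx)
  simp only [mul_add, ← mul_assoc, sgn_mul_self, one_mul, mul_zero] at h
  rw [add_comm, h, zero_smul]

/-- The coevaluation `1 ↦ ∑ v ⊗ v^∨`. -/
noncomputable def leftCup : SMod.unit g ⟶ tensor V W :=
  ofLin (LinearMap.toSpanSingleton k (V.carrier ⊗[k] W.carrier) (∑ i, D.vec i ⊗ₜ[k] D.dvec i)) (by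
    refine equivariant_of_homog (V := SMod.unit g) (W := tensor V W)
      (LinearMap.toSpanSingleton k (V.carrier ⊗[k] W.carrier) (∑ i, D.vec i ⊗ₜ[k] D.dvec i)) ?_
    intro p q x c hx _
    rw [unit_act, map_zero]
    change 0 = tAct V W x (c • _)
    rw [map_smul, D.act_canonical hx, smul_zero])

theorem leftCup_one : lin D.leftCup (1 : k) = ∑ i, D.vec i ⊗ₜ[k] D.dvec i := one_smul k _

theorem leftCup_even : D.leftCup ∈ homGr _ _ 0 := by
  intro p c hc
  rw [add_zero]
  by_cases hp : p = 0
  · subst hp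
    refine Submodule.smul_mem _ c (sum_mem fun i _ => ?_)
    exact tmul_mem' (D.vec_mem i) (D.dvec_mem i) (CharTwo.add_self_eq_zero _)
  · have : c = 0 := by
      change c ∈ unitGr k p at hc
      rwa [unitGr, if_neg hp, Submodule.mem_bot] at hc
    subst this
    rw [map_zero]; exact zero_mem _

/-- The coevaluation `1 ↦ ∑ (-1)^{v̄} v^∨ ⊗ v`. -/
noncomputable def rightCup : SMod.unit g ⟶ tensor W V := D.leftCup ≫ flip V W

theorem rightCup_one :
    lin D.rightCup (1 : k) = ∑ i, sgn k (D.parity i) • (D.dvec i ⊗ₜ[k] D.vec i) := by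
  rw [rightCup, lin_comp, LinearMap.comp_apply, leftCup_one, map_sum]
  refine Finset.sum_congr rfl fun i _ => ?_
  rw [flip_tmul V W (D.vec_mem i) (D.dvec_mem i), sgn_sq]

theorem rightCup_even : D.rightCup ∈ homGr _ _ 0 := comp_even D.leftCup_even (flip_even V W)

end DualPair

end Dual

/-! ### Local moves on words -/

section Moves

open SMod

variable {k : Type u} [Field k] {g : LieSuperalgebra k} (gen : Orient → SMod g)

/-- The generator `1` of the module of the empty word. -/
noncomputable def wordNil : (wordObj gen []).carrier := (1 : k)

/-- Putting a vector in front of an element of the module of a word. -/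
noncomputable def wordCons (o : Orient) (l : List Orient) :
    (gen o).carrier →ₗ[k] (wordObj gen l).carrier →ₗ[k] (wordObj gen (o :: l)).carrier :=
  (TensorProduct.mk k _ _).compr₂ (lin (consIso gen o l).hom)

theorem wordCons_nil (o : Orient) (v : (gen o).carrier) :
    wordCons gen o [] v (wordNil gen) = v := one_smul k v

variable {gen}

theorem word_ext_nil {M : Type*} [AddCommGroup M] [Module k M]
    {f h : (wordObj gen []).carrier →ₗ[k] M} (e : f (wordNil gen) = h (wordNil gen)) : f = h :=
  LinearMap.ext_ring (R := k) (f := f) (g := h) e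

theorem word_ext_cons {o : Orient} {l : List Orient} {M : Type*} [AddCommGroup M] [Module k M]
    {f h : (wordObj gen (o :: l)).carrier →ₗ[k] M}
    (e : ∀ p v, v ∈ (gen o).gr p → f ∘ₗ wordCons gen o l v = h ∘ₗ wordCons gen o l v) : f = h := by
  have e' : f ∘ₗ lin (consIso gen o l).hom = h ∘ₗ lin (consIso gen o l).hom :=
    TensorProduct.ext (ext_homog (gr := (gen o).gr) fun p v hv => e p v hv)
  ext x
  rw [← lin_hom_inv (consIso gen o l) x]
  exact LinearMap.congr_fun e' _

theorem word_ext_one {o : Orient} {Y : SMod g} {f h : wordObj gen [o] ⟶ Y}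
    (e : ∀ p v, v ∈ (gen o).gr p → lin f (wordCons gen o [] v (wordNil gen)) =
      lin h (wordCons gen o [] v (wordNil gen))) : f = h :=
  hom_ext (word_ext_cons fun p v hv => word_ext_nil (e p v hv))

theorem word_ext_two {o o' : Orient} {Y : SMod g} {f h : wordObj gen [o, o'] ⟶ Y}
    (e : ∀ p q v w, v ∈ (gen o).gr p → w ∈ (gen o').gr q →
      lin f (wordCons gen o _ v (wordCons gen o' [] w (wordNil gen))) =
      lin h (wordCons gen o _ v (wordCons gen o' [] w (wordNil gen)))) : f = h :=
  hom_ext (word_ext_cons fun p v hv => word_ext_cons fun q w hw => word_ext_nil (e p q v w hv hw))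

theorem word_ext_three {o o' o'' : Orient} {Y : SMod g} {f h : wordObj gen [o, o', o''] ⟶ Y}
    (e : ∀ p q r v w z, v ∈ (gen o).gr p → w ∈ (gen o').gr q → z ∈ (gen o'').gr r →
      lin f (wordCons gen o _ v (wordCons gen o' _ w (wordCons gen o'' [] z (wordNil gen)))) =
      lin h (wordCons gen o _ v (wordCons gen o' _ w (wordCons gen o'' [] z (wordNil gen))))) :
    f = h :=
  hom_ext (word_ext_cons fun p v hv => word_ext_cons fun q w hw => word_ext_cons fun r z hz =>
    word_ext_nil (e p q r v w z hv hw hz))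

theorem wordTensor_wordNil {Y : List Orient} (y : (wordObj gen Y).carrier) :
    lin (wordTensor gen [] Y).hom (wordNil gen ⊗ₜ[k] y) = y := one_smul k y

theorem wordTensor_wordCons {o : Orient} {l Y : List Orient} (v : (gen o).carrier)
    (x : (wordObj gen l).carrier) (y : (wordObj gen Y).carrier) :
    lin (wordTensor gen (o :: l) Y).hom (wordCons gen o l v x ⊗ₜ[k] y) =
      wordCons gen o (l ++ Y) v (lin (wordTensor gen l Y).hom (x ⊗ₜ[k] y)) :=
  wordTensor_consIso gen o l Y v x y

/-- The homomorphism `1 ⊗ f`, next to a strand on the left. -/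
noncomputable def under (o : Orient) {X Y : List Orient} (f : wordObj gen X ⟶ wordObj gen Y) :
    wordObj gen (o :: X) ⟶ wordObj gen (o :: Y) :=
  wordHom gen (X := [o]) (X' := [o]) (𝟙 _) f

theorem under_wordCons {o : Orient} {X Y : List Orient} {f : wordObj gen X ⟶ wordObj gen Y}
    (hf : f ∈ homGr _ _ 0) (v : (gen o).carrier) (x : (wordObj gen X).carrier) :
    lin (under o f) (wordCons gen o X v x) = wordCons gen o Y v (lin f x) := by
  have h := wordHom_apply (X := [o]) (X' := [o]) (𝟙 _) hf (wordCons gen o [] v (wordNil gen)) x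
  rw [lin_id, LinearMap.id_apply, wordTensor_wordCons, wordTensor_wordCons, wordTensor_wordNil,
    wordTensor_wordNil] at h
  exact h

/-- The homomorphism `1 ⊗ 1 ⊗ f`, next to two strands on the left. -/
noncomputable def under₂ (o o' : Orient) {X Y : List Orient}
    (f : wordObj gen X ⟶ wordObj gen Y) :
    wordObj gen (o :: o' :: X) ⟶ wordObj gen (o :: o' :: Y) :=
  wordHom gen (X := [o, o']) (X' := [o, o']) (𝟙 _) f

theorem under₂_wordCons {o o' : Orient} {X Y : List Orient} {f : wordObj gen X ⟶ wordObj gen Y}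
    (hf : f ∈ homGr _ _ 0) (v : (gen o).carrier) (w : (gen o').carrier)
    (x : (wordObj gen X).carrier) :
    lin (under₂ o o' f) (wordCons gen o _ v (wordCons gen o' X w x)) =
      wordCons gen o _ v (wordCons gen o' Y w (lin f x)) := by
  have h := wordHom_apply (X := [o, o']) (X' := [o, o']) (𝟙 _) hf
    (wordCons gen o [o'] v (wordCons gen o' [] w (wordNil gen))) x
  rw [lin_id, LinearMap.id_apply, wordTensor_wordCons, wordTensor_wordCons, wordTensor_wordCons,
    wordTensor_wordCons, wordTensor_wordNil, wordTensor_wordNil] at h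
  exact h

/-- The homomorphism `f ⊗ 1` for `f : V ⊗ W ⟶ V' ⊗ W'`, next to strands on the right. -/
noncomputable def atPair {o₁ o₂ o₁' o₂' : Orient}
    (f : tensor (gen o₁) (gen o₂) ⟶ tensor (gen o₁') (gen o₂')) (X : List Orient) :
    wordObj gen (o₁ :: o₂ :: X) ⟶ wordObj gen (o₁' :: o₂' :: X) :=
  wordHom gen (X := [o₁, o₂]) (X' := [o₁', o₂']) f (𝟙 (wordObj gen X))

/-- The homomorphism `f ⊗ 1` for `f : V ⊗ W ⟶ k`, next to strands on the right. -/
noncomputable def atCap {o₁ o₂ : Orient} (f : tensor (gen o₁) (gen o₂) ⟶ SMod.unit g)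
    (X : List Orient) : wordObj gen (o₁ :: o₂ :: X) ⟶ wordObj gen X :=
  wordHom gen (X := [o₁, o₂]) (X' := []) f (𝟙 (wordObj gen X))

/-- The homomorphism `f ⊗ 1` for `f : k ⟶ V ⊗ W`, next to strands on the right. -/
noncomputable def atCup {o₁ o₂ : Orient} (f : SMod.unit g ⟶ tensor (gen o₁) (gen o₂))
    (X : List Orient) : wordObj gen X ⟶ wordObj gen (o₁ :: o₂ :: X) :=
  wordHom gen (X := []) (X' := [o₁, o₂]) f (𝟙 (wordObj gen X))

theorem wordTensor_pair {o o' : Orient} {X : List Orient} (v : (gen o).carrier)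
    (w : (gen o').carrier) (x : (wordObj gen X).carrier) :
    lin (wordTensor gen [o, o'] X).hom ((v ⊗ₜ[k] w) ⊗ₜ[k] x) =
      wordCons gen o _ v (wordCons gen o' X w x) := by
  have h := wordTensor_wordCons (o := o) (l := [o']) (Y := X) v
    (wordCons gen o' [] w (wordNil gen)) x
  have h' := (wordTensor_wordCons w (wordNil gen) x).trans
    (congrArg (wordCons gen o' X w) (wordTensor_wordNil x))
  have h'' := h.trans (congrArg (wordCons gen o (o' :: X) v) h')
  rw [wordCons_nil] at h''
  exact h''

/-- `v ⊗ w ↦ v ⊗ (w ⊗ x)`, as a linear map. -/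
noncomputable def pairCons (o o' : Orient) {X : List Orient} (x : (wordObj gen X).carrier) :
    (gen o).carrier ⊗[k] (gen o').carrier →ₗ[k] (wordObj gen (o :: o' :: X)).carrier :=
  TensorProduct.lift ((wordCons gen o (o' :: X)).compl₂ ((wordCons gen o' X).flip x))

theorem pairCons_tmul (o o' : Orient) {X : List Orient} (x : (wordObj gen X).carrier)
    (v : (gen o).carrier) (w : (gen o').carrier) :
    pairCons o o' x (v ⊗ₜ[k] w) = wordCons gen o _ v (wordCons gen o' X w x) := rfl

theorem wordTensor_pairCons {o o' : Orient} {X : List Orient}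
    (t : (gen o).carrier ⊗[k] (gen o').carrier) (x : (wordObj gen X).carrier) :
    lin (wordTensor gen [o, o'] X).hom (t ⊗ₜ[k] x) = pairCons o o' x t := by
  have key : (lin (wordTensor gen [o, o'] X).hom ∘ₗ
      (TensorProduct.mk k (wordObj gen [o, o']).carrier (wordObj gen X).carrier).flip x :
        (gen o).carrier ⊗[k] (gen o').carrier →ₗ[k] _) = pairCons o o' x :=
    TensorProduct.ext' fun v w => wordTensor_pair v w x
  exact LinearMap.congr_fun key t

theorem atPair_wordCons {o₁ o₂ o₁' o₂' : Orient}
    (f : tensor (gen o₁) (gen o₂) ⟶ tensor (gen o₁') (gen o₂')) {X : List Orient}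
    (v : (gen o₁).carrier) (w : (gen o₂).carrier) (x : (wordObj gen X).carrier) :
    lin (atPair f X) (wordCons gen o₁ _ v (wordCons gen o₂ X w x)) =
      pairCons o₁' o₂' x (lin f (v ⊗ₜ[k] w)) := by
  rw [← wordTensor_pair, ← wordTensor_pairCons]
  exact wordHom_apply (X := [o₁, o₂]) (X' := [o₁', o₂']) f (id_even _) (v ⊗ₜ[k] w) x

theorem atCap_wordCons {o₁ o₂ : Orient} (f : tensor (gen o₁) (gen o₂) ⟶ SMod.unit g)
    {X : List Orient} (v : (gen o₁).carrier) (w : (gen o₂).carrier)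
    (x : (wordObj gen X).carrier) :
    lin (atCap f X) (wordCons gen o₁ _ v (wordCons gen o₂ X w x)) =
      (show k from lin f (v ⊗ₜ[k] w)) • x := by
  rw [← wordTensor_pair]
  exact wordHom_apply (X := [o₁, o₂]) (X' := []) f (id_even _) (v ⊗ₜ[k] w) x

theorem atCup_apply {o₁ o₂ : Orient} (f : SMod.unit g ⟶ tensor (gen o₁) (gen o₂))
    {X : List Orient} (x : (wordObj gen X).carrier) :
    lin (atCup f X) x = pairCons o₁ o₂ x (lin f (1 : k)) := by
  have h := wordHom_apply (X := []) (X' := [o₁, o₂]) f (id_even _) (wordNil gen) x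
  rw [wordTensor_wordNil] at h
  rw [← wordTensor_pairCons]
  exact h

theorem atPair_even {o₁ o₂ o₁' o₂' : Orient}
    {f : tensor (gen o₁) (gen o₂) ⟶ tensor (gen o₁') (gen o₂')} (hf : f ∈ homGr _ _ 0)
    (X : List Orient) : atPair f X ∈ homGr _ _ 0 := by
  have h := wordHom_mem (X := [o₁, o₂]) (X' := [o₁', o₂']) hf (id_even (wordObj gen X))
  rwa [add_zero] at h

theorem wordCons_pair {o o' : Orient} (v : (gen o).carrier) (w : (gen o').carrier) :
    wordCons gen o [o'] v (wordCons gen o' [] w (wordNil gen)) = v ⊗ₜ[k] w := by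
  rw [wordCons_nil]; rfl

/-- For two words of length one no brackets move, and `wordTensor` is the identity. -/
theorem wordTensor_letters (o o' : Orient) :
    (wordTensor gen [o] [o']).hom = 𝟙 (tensor (gen o) (gen o')) :=
  tensor_hom_ext fun _ _ v w _ _ => wordTensor_single_cons gen o o' [] v w

theorem wordTensor_letters_inv (o o' : Orient) :
    (wordTensor gen [o] [o']).inv = 𝟙 (tensor (gen o) (gen o')) := by
  have h := (wordTensor gen [o] [o']).hom_inv_id
  rw [wordTensor_letters] at h
  exact (Category.id_comp _).symm.trans h

theorem wordHom_letters {o o' : Orient} (f : gen o ⟶ gen o) (h : gen o' ⟶ gen o') :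
    wordHom gen (X := [o]) (X' := [o]) (Y := [o']) (Y' := [o']) f h =
      tensorHom (gen o) (gen o) (gen o') (gen o') f h := by
  have e := congrArg₂ (fun (a b : tensor (gen o) (gen o') ⟶ tensor (gen o) (gen o')) =>
    a ≫ tensorHom _ _ _ _ f h ≫ b) (wordTensor_letters_inv o o') (wordTensor_letters o o')
  exact e.trans ((Category.id_comp _).trans (Category.comp_id _))

end Moves

/-! ### The interpretation of the generators -/

section Interpretation

open SMod

variable {k A : Type u} [Field k] [Ring A] [Algebra k A] {g : LieSuperalgebra k}

/-- An action of the superalgebra `A` on a supermodule by endomorphisms. -/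
structure TokenAction (gA : ZMod 2 → Submodule k A) (V : SMod g) where
  hom : A →ₗ[k] (V ⟶ V)
  hom_mem {p : ZMod 2} {a : A} : a ∈ gA p → hom a ∈ homGr V V p
  hom_one : hom 1 = 𝟙 V
  hom_mul (a b : A) : hom (a * b) = hom b ≫ hom a

variable {gA : ZMod 2 → Submodule k A} {gen : Orient → SMod g} {κ : Type*} [Fintype κ]
  (D : DualPair (gen .up) (gen .down) κ) (T : TokenAction gA (gen .up))

/-- The homomorphism denoted by an expression, when the letters stand for a dual pair of
supermodules and the tokens act on the first of them. -/
noncomputable def interp : ∀ {X Y : List Orient}, Term k A X Y → (wordObj gen X ⟶ wordObj gen Y)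
  | _, _, .id X => 𝟙 (wordObj gen X)
  | _, _, .comp f h => interp f ≫ interp h
  | _, _, .tensor f h => wordHom gen (interp f) (interp h)
  | _, _, .zero _ _ => 0
  | _, _, .add f h => interp f + interp h
  | _, _, .smul c f => c • interp f
  | _, _, .cross => flip (gen .up) (gen .up)
  | _, _, .token a => T.hom a
  | _, _, .rightCup => D.rightCup
  | _, _, .rightCap => D.rightCap
  | _, _, .leftCup => D.leftCup
  | _, _, .leftCap => D.leftCap

theorem interp_mem {X Y : List Orient} {t : Term k A X Y} {p : ZMod 2}
    (h : Term.HasParity gA t p) : interp D T t ∈ homGr _ _ p := by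
  induction h with
  | id X => exact id_even _
  | comp _ _ hf hh => exact Supercategory.comp_mem (k := k) hf hh
  | tensor _ _ hf hh => exact wordHom_mem hf hh
  | zero X Y p => exact zero_mem _
  | add _ _ hf hh => exact add_mem hf hh
  | smul c _ hf => exact Submodule.smul_mem _ c hf
  | cross => exact flip_even _ _
  | token ha => exact T.hom_mem ha
  | rightCup => exact D.rightCup_even
  | rightCap => exact D.rightCap_even
  | leftCup => exact D.leftCup_even
  | leftCap => exact D.leftCap_even

theorem interp_eqTo {X Y : List Orient} (h : X = Y) :
    interp D T (.eqTo h) = wordCast gen h := by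
  subst h; rfl

/-! ### The action of the generators on pure tensors -/

theorem atPair_flip {o o' : Orient} {X : List Orient} {p q : ZMod 2} {v : (gen o).carrier}
    {w : (gen o').carrier} (hv : v ∈ (gen o).gr p) (hw : w ∈ (gen o').gr q)
    (x : (wordObj gen X).carrier) :
    lin (atPair (flip (gen o) (gen o')) X) (wordCons gen o _ v (wordCons gen o' X w x)) =
      sgn k (p * q) • wordCons gen o' _ w (wordCons gen o X v x) := by
  rw [atPair_wordCons, flip_tmul _ _ hv hw, map_smul, pairCons_tmul]

theorem interp_cross {p q : ZMod 2} {v w : (gen .up).carrier} (hv : v ∈ (gen .up).gr p)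
    (hw : w ∈ (gen .up).gr q) :
    lin (interp D T .cross) (wordCons gen .up _ v (wordCons gen .up [] w (wordNil gen))) =
      sgn k (p * q) • wordCons gen .up _ w (wordCons gen .up [] v (wordNil gen)) := by
  rw [wordCons_pair, wordCons_pair]
  exact flip_tmul _ _ hv hw

theorem interp_rightCap {p q : ZMod 2} {v : (gen .up).carrier} {w : (gen .down).carrier}
    (hv : v ∈ (gen .up).gr p) (hw : w ∈ (gen .down).gr q) :
    lin (interp D T .rightCap) (wordCons gen .up _ v (wordCons gen .down [] w (wordNil gen))) =
      (sgn k (p * q) * D.form w v) • wordNil gen := by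
  rw [wordCons_pair]
  exact (D.rightCap_tmul hv hw).trans (mul_one _).symm

theorem interp_rightCup : lin (interp D T .rightCup) (wordNil gen) =
    ∑ i, sgn k (D.parity i) • wordCons gen .down _ (D.dvec i)
      (wordCons gen .up [] (D.vec i) (wordNil gen)) := by
  simp only [wordCons_pair]
  exact D.rightCup_one

theorem interp_leftCup : lin (interp D T .leftCup) (wordNil gen) =
    ∑ i, wordCons gen .up _ (D.vec i) (wordCons gen .down [] (D.dvec i) (wordNil gen)) := by
  simp only [wordCons_pair]
  exact D.leftCup_one

theorem atCup_rightCup {X : List Orient} (x : (wordObj gen X).carrier) :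
    lin (atCup D.rightCup X) x =
      ∑ i, sgn k (D.parity i) • wordCons gen .down _ (D.dvec i)
        (wordCons gen .up X (D.vec i) x) := by
  rw [atCup_apply, DualPair.rightCup_one, map_sum]
  exact Finset.sum_congr rfl fun i _ => map_smul _ _ _

theorem atCap_leftCap {X : List Orient} (w : (gen .down).carrier) (v : (gen .up).carrier)
    (x : (wordObj gen X).carrier) :
    lin (atCap D.leftCap X) (wordCons gen .down _ w (wordCons gen .up X v x)) =
      D.form w v • x := by
  rw [atCap_wordCons]; rfl

theorem atCap_rightCap {X : List Orient} {p q : ZMod 2} {v : (gen .up).carrier}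
    {w : (gen .down).carrier} (hv : v ∈ (gen .up).gr p) (hw : w ∈ (gen .down).gr q)
    (x : (wordObj gen X).carrier) :
    lin (atCap D.rightCap X) (wordCons gen .up _ v (wordCons gen .down X w x)) =
      (sgn k (p * q) * D.form w v) • x := by
  rw [atCap_wordCons, D.rightCap_tmul hv hw]

theorem cross_even : interp D T .cross ∈ homGr _ _ 0 := interp_mem D T .cross
theorem rightCap_even : interp D T .rightCap ∈ homGr _ _ 0 := interp_mem D T .rightCap
theorem rightCup_even : interp D T .rightCup ∈ homGr _ _ 0 := interp_mem D T .rightCup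
theorem leftCup_even : interp D T .leftCup ∈ homGr _ _ 0 := interp_mem D T .leftCup

/-! ### The defining relations -/

theorem interp_cross_sq : interp D T (.comp .cross .cross) = interp D T (.id _) :=
  flip_flip _ _

theorem interp_braid :
    interp D T (.comp Term.crossL (.comp Term.crossR Term.crossL)) =
      interp D T (.comp Term.crossR (.comp Term.crossL Term.crossR)) := by
  change atPair (flip _ _) [.up] ≫ under .up (interp D T .cross) ≫ atPair (flip _ _) [.up] =
    under .up (interp D T .cross) ≫ atPair (flip _ _) [.up] ≫ under .up (interp D T .cross)
  apply word_ext_three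
  intro p q r v w z hv hw hz
  simp only [lin_comp, LinearMap.comp_apply]
  rw [atPair_flip hv hw, map_smul, under_wordCons (cross_even D T), interp_cross D T hv hz,
    under_wordCons (cross_even D T), interp_cross D T hw hz]
  simp only [map_smul]
  rw [atPair_flip hw hz, atPair_flip hv hz, map_smul, under_wordCons (cross_even D T),
    interp_cross D T hv hw]
  simp only [map_smul, smul_smul]
  congr 1
  ring

theorem interp_token_cross (a : A) :
    interp D T (.comp (.tensor (.token a) (.id [.up])) .cross) =
      interp D T (.comp .cross (.tensor (.id [.up]) (.token a))) := by
  have h := flip_natural (T.hom a) (gen .up)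
  rw [← wordHom_letters, ← wordHom_letters] at h
  exact h

theorem interp_leftCurl : interp D T Term.leftCurl = interp D T (.id _) := by
  change atCup D.rightCup [.up] ≫ under .down (interp D T .cross) ≫ atCap D.leftCap [.up] = 𝟙 _
  apply word_ext_one
  intro p v hv
  simp only [lin_comp, LinearMap.comp_apply, lin_id, LinearMap.id_apply]
  rw [atCup_rightCup, map_sum, map_sum]
  refine (Finset.sum_congr rfl fun i _ => ?_).trans
    ((D.sum_form_vec ((wordCons gen .up []).flip (wordNil gen)) hv
      (fun i => sgn k (D.parity i) * sgn k (D.parity i * p)) 1 ?_).trans (one_smul _ _))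
  · rw [map_smul, under_wordCons (cross_even D T), interp_cross D T (D.vec_mem i) hv]
    simp only [map_smul, atCap_leftCap, smul_smul, LinearMap.flip_apply]
  · rintro i rfl
    rw [sgn_sq, sgn_mul_self]

theorem interp_rightCurl : interp D T Term.rightCurl = interp D T (.id _) := by
  change under .up (interp D T .leftCup) ≫ atPair (flip _ _) [.down] ≫
    under .up (interp D T .rightCap) = 𝟙 _
  apply word_ext_one
  intro p v hv
  simp only [lin_comp, LinearMap.comp_apply, lin_id, LinearMap.id_apply]
  rw [under_wordCons (leftCup_even D T), interp_leftCup]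
  simp only [map_sum]
  refine (Finset.sum_congr rfl fun i _ => ?_).trans
    ((D.sum_form_vec ((wordCons gen .up []).flip (wordNil gen)) hv
      (fun i => sgn k (p * D.parity i) * sgn k (p * D.parity i)) 1 ?_).trans (one_smul _ _))
  · rw [atPair_flip hv (D.vec_mem i), map_smul, under_wordCons (rightCap_even D T),
      interp_rightCap D T hv (D.dvec_mem i)]
    simp only [map_smul, smul_smul, LinearMap.flip_apply, mul_assoc]
  · intro i _
    exact sgn_mul_self k _

theorem interp_zigzagUp : interp D T Term.zigzagUp = interp D T (.id _) := by
  change under .up (interp D T .rightCup) ≫ atCap D.rightCap [.up] = 𝟙 _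
  apply word_ext_one
  intro p v hv
  simp only [lin_comp, LinearMap.comp_apply, lin_id, LinearMap.id_apply]
  rw [under_wordCons (rightCup_even D T), interp_rightCup]
  simp only [map_sum, map_smul]
  refine (Finset.sum_congr rfl fun i _ => ?_).trans
    ((D.sum_form_vec ((wordCons gen .up []).flip (wordNil gen)) hv
      (fun i => sgn k (D.parity i) * sgn k (p * D.parity i)) 1 ?_).trans (one_smul _ _))
  · rw [atCap_rightCap D hv (D.dvec_mem i), smul_smul, mul_assoc, LinearMap.flip_apply]
  · rintro i rfl
    rw [sgn_sq, sgn_mul_self]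

theorem interp_zigzagDown : interp D T Term.zigzagDown = interp D T (.id _) := by
  change atCup D.rightCup [.down] ≫ under .down (interp D T .rightCap) = 𝟙 _
  apply word_ext_one
  intro p w hw
  simp only [lin_comp, LinearMap.comp_apply, lin_id, LinearMap.id_apply]
  rw [atCup_rightCup, map_sum]
  refine (Finset.sum_congr rfl fun i _ => ?_).trans
    ((D.sum_form_dvec ((wordCons gen .down []).flip (wordNil gen)) hw
      (fun i => sgn k (D.parity i) * sgn k (D.parity i * p)) 1 ?_).trans (one_smul _ _))
  · rw [map_smul, under_wordCons (rightCap_even D T), interp_rightCap D T (D.vec_mem i) hw,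
      map_smul, smul_smul, mul_assoc, LinearMap.flip_apply]
  · rintro i rfl
    rw [sgn_sq, sgn_mul_self]

/-- The right crossing is interpreted as the flip. -/
theorem interp_rightCross {p q : ZMod 2} {v : (gen .up).carrier} {w : (gen .down).carrier}
    (hv : v ∈ (gen .up).gr p) (hw : w ∈ (gen .down).gr q) :
    lin (interp D T Term.rightCross)
        (wordCons gen .up _ v (wordCons gen .down [] w (wordNil gen))) =
      sgn k (p * q) • wordCons gen .down _ w (wordCons gen .up [] v (wordNil gen)) := by
  have e : interp D T Term.rightCross = atCup D.rightCup [.up, .down] ≫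
      under .down (atPair (flip (gen .up) (gen .up)) [.down]) ≫
      under₂ .down .up (interp D T .rightCap) := rfl
  simp only [e, lin_comp, LinearMap.comp_apply]
  rw [atCup_rightCup, map_sum, map_sum]
  refine (Finset.sum_congr rfl fun i _ => ?_).trans
    (D.sum_form_dvec ((wordCons gen .down [.up]).flip (wordCons gen .up [] v (wordNil gen))) hw
      (fun i => sgn k (D.parity i) * sgn k (D.parity i * p) * sgn k (D.parity i * q))
      (sgn k (p * q)) ?_)
  · rw [map_smul, under_wordCons (atPair_even (flip_even _ _) _), atPair_flip (D.vec_mem i) hv]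
    simp only [map_smul]
    rw [under₂_wordCons (rightCap_even D T), interp_rightCap D T (D.vec_mem i) hw]
    simp only [map_smul, smul_smul, LinearMap.flip_apply, mul_assoc]
  · rintro i rfl
    rw [sgn_sq, mul_right_comm, sgn_mul_self, one_mul, mul_comm p]

/-- The left crossing is interpreted as the flip. -/
theorem interp_leftCross {p q : ZMod 2} {w : (gen .down).carrier} {v : (gen .up).carrier}
    (hw : w ∈ (gen .down).gr p) (hv : v ∈ (gen .up).gr q) :
    lin (interp D T Term.leftCross)
        (wordCons gen .down _ w (wordCons gen .up [] v (wordNil gen))) =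
      sgn k (p * q) • wordCons gen .up _ v (wordCons gen .down [] w (wordNil gen)) := by
  have e : interp D T Term.leftCross = under₂ .down .up (interp D T .leftCup) ≫
      under .down (atPair (flip (gen .up) (gen .up)) [.down]) ≫
      atCap D.leftCap [.up, .down] := rfl
  simp only [e, lin_comp, LinearMap.comp_apply]
  rw [under₂_wordCons (leftCup_even D T), interp_leftCup]
  simp only [map_sum]
  refine (Finset.sum_congr rfl fun i _ => ?_).trans
    (D.sum_form_dvec
      (wordCons gen .up [.down] v ∘ₗ (wordCons gen .down []).flip (wordNil gen)) hw
      (fun i => sgn k (q * D.parity i)) (sgn k (p * q)) ?_)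
  · rw [under_wordCons (atPair_even (flip_even _ _) _), atPair_flip hv (D.vec_mem i)]
    simp only [map_smul]
    rw [atCap_leftCap, smul_smul, LinearMap.comp_apply, LinearMap.flip_apply]
  · rintro i rfl
    rw [mul_comm]

theorem interp_left_right :
    interp D T (.comp Term.rightCross Term.leftCross) = interp D T (.id _) := by
  change interp D T Term.rightCross ≫ interp D T Term.leftCross = 𝟙 _
  apply word_ext_two
  intro p q v w hv hw
  simp only [lin_comp, LinearMap.comp_apply, lin_id, LinearMap.id_apply]
  rw [interp_rightCross D T hv hw, map_smul, interp_leftCross D T hw hv, smul_smul, mul_comm q,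
    sgn_mul_self, one_smul]

theorem interp_right_left :
    interp D T (.comp Term.leftCross Term.rightCross) = interp D T (.id _) := by
  change interp D T Term.leftCross ≫ interp D T Term.rightCross = 𝟙 _
  apply word_ext_two
  intro p q w v hw hv
  simp only [lin_comp, LinearMap.comp_apply, lin_id, LinearMap.id_apply]
  rw [interp_leftCross D T hw hv, map_smul, interp_rightCross D T hv hw, smul_smul, mul_comm q,
    sgn_mul_self, one_smul]

/-- The interpretation respects all relations of the oriented Frobenius Brauer category. -/
theorem interp_sound {X Y : List Orient} {s t : Term k A X Y} (h : Term.Rel gA s t) :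
    interp D T s = interp D T t := by
  induction h with
  | refl f => rfl
  | symm _ ih => exact ih.symm
  | trans _ _ ih ih' => exact ih.trans ih'
  | comp_congr _ _ ih ih' => simp only [interp, ih, ih']
  | tensor_congr _ _ ih ih' => simp only [interp, ih, ih']
  | add_congr _ _ ih ih' => simp only [interp, ih, ih']
  | smul_congr c _ ih => simp only [interp, ih]
  | add_comm f g => exact _root_.add_comm _ _
  | add_assoc f g h => exact _root_.add_assoc _ _ _
  | zero_add f => exact _root_.zero_add _
  | zero_smul f => exact _root_.zero_smul _ _
  | one_smul f => exact _root_.one_smul _ _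
  | mul_smul c d f => exact SemigroupAction.mul_smul _ _ _
  | smul_add c f g => exact _root_.smul_add _ _ _
  | add_smul c d f => exact _root_.add_smul _ _ _
  | id_comp f => exact Category.id_comp _
  | comp_id f => exact Category.comp_id _
  | comp_assoc f g h => exact Category.assoc _ _ _
  | add_comp f f' g => exact Preadditive.add_comp _ _ _ _ _ _
  | comp_add f g g' => exact Preadditive.comp_add _ _ _ _ _ _
  | smul_comp c f g => exact Linear.smul_comp _ _ _ _ _ _
  | comp_smul c f g => exact Linear.comp_smul _ _ _ _ _ _
  | add_tensor f f' g =>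
    simp only [interp, wordHom, map_add, LinearMap.add_apply, Preadditive.add_comp,
      Preadditive.comp_add]
  | tensor_add f g g' =>
    simp only [interp, wordHom, map_add, Preadditive.add_comp, Preadditive.comp_add]
  | smul_tensor c f g =>
    simp only [interp, wordHom, map_smul, LinearMap.smul_apply, Linear.smul_comp,
      Linear.comp_smul]
  | tensor_smul c f g =>
    simp only [interp, wordHom, map_smul, Linear.smul_comp, Linear.comp_smul]
  | tensor_id X Y => exact wordHom_id X Y
  | interchange hf _ hg _ =>
    exact wordHom_interchange _ _ _ _ (interp_mem D T hf) (interp_mem D T hg)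
  | tensor_assoc f g h =>
    simp only [interp, interp_eqTo]
    exact wordHom_assoc _ _ _
  | unit_tensor f => exact wordHom_unit_left _
  | tensor_unit f =>
    simp only [interp, interp_eqTo]
    exact wordHom_unit_right _
  | token_one => exact T.hom_one
  | token_linear c d a b =>
    change c • T.hom a + d • T.hom b = T.hom (c • a + d • b)
    rw [map_add, map_smul, map_smul]
  | token_mul a b => exact (T.hom_mul a b).symm
  | cross_sq => exact interp_cross_sq D T
  | braid => exact interp_braid D T
  | token_cross a => exact interp_token_cross D T a
  | left_right => exact interp_left_right D T
  | right_left => exact interp_right_left D T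
  | left_curl => exact interp_leftCurl D T
  | right_curl => exact interp_rightCurl D T
  | zigzag_up => exact interp_zigzagUp D T
  | zigzag_down => exact interp_zigzagDown D T

end Interpretation

/-! ### The monoidal superfunctor -/

section Functor

open SMod

variable {k A : Type u} [Field k] [Ring A] [Algebra k A] {g : LieSuperalgebra k}
  {gA : ZMod 2 → Submodule k A} [GradedAlgebra gA] {gen : Orient → SMod g} {κ : Type*} [Fintype κ]
  (D : DualPair (gen .up) (gen .down) κ) (T : TokenAction gA (gen .up))

/-- The monoidal superfunctor on the oriented Frobenius Brauer category that is determined by a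
dual pair of supermodules and an action of `A` on the first of them. -/
noncomputable def interpFunctor : MonoidalSuperfunctor k (OB gA) (SMod g) where
  obj X := wordObj gen X.word
  map {X Y} f := Quotient.lift (s := OB.setoid gA X.word Y.word) (interp D T)
    (fun _ _ h => interp_sound D T h) f
  map_id _ := rfl
  map_comp f h := by
    obtain ⟨f, rfl⟩ := OB.mk_surj f
    obtain ⟨h, rfl⟩ := OB.mk_surj h
    rfl
  map_add f h := by
    obtain ⟨f, rfl⟩ := OB.mk_surj f
    obtain ⟨h, rfl⟩ := OB.mk_surj h
    rfl
  map_smul c f := by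
    obtain ⟨f, rfl⟩ := OB.mk_surj f
    rfl
  map_mem := by
    rintro X Y p f ⟨t, ht, rfl⟩
    exact interp_mem D T ht
  unitIso := Iso.refl _
  tensorIso X Y := wordTensor gen X.word Y.word
  unitIso_mem := id_even _
  tensorIso_mem X Y := wordTensor_even gen X.word Y.word
  tensorIso_natural f h := by
    obtain ⟨f, rfl⟩ := OB.mk_surj f
    obtain ⟨h, rfl⟩ := OB.mk_surj h
    exact (wordTensor_comp_wordHom _ _).symm
  associativity X Y Z := by
    have e := wordTensor_assoc gen X.word Y.word Z.word
    rw [← interp_eqTo D T] at e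
    exact e
  left_unitality X :=
    (congrArg₂ (· ≫ ·) (tensorHom_id (SMod.unit g) (wordObj gen X.word))
      (Category.comp_id (wordTensor gen [] X.word).hom)).trans (Category.id_comp _)
  right_unitality X := by
    have e := wordTensor_right_unit gen X.word
    rw [← interp_eqTo D T] at e
    exact (congrArg₂ (· ≫ ·) (tensorHom_id (wordObj gen X.word) (SMod.unit g)) e).trans
      (Category.id_comp _)

/-- When the images of the objects are as named by definition, no transport is involved. -/
theorem tensorId_rfl {C : Type*} [Category C] [Preadditive C] [Linear k C] [Supercategory k C]
    [MonoidalSupercategory k C] {E : Type*} [Category E] [Preadditive E] [Linear k E]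
    [Supercategory k E] [MonoidalSupercategory k E] (F : MonoidalSuperfunctor k C E) (X Y : C) :
    F.tensorId (rfl : F.obj X = F.obj X) (rfl : F.obj Y = F.obj Y) = F.tensorIso X Y := by
  ext
  simp [MonoidalSuperfunctor.tensorId]

end Functor

section Existence

open SMod

variable {k A : Type u} [Field k] [Ring A] [Algebra k A] {g : LieSuperalgebra k}

/-- The modules assigned to the generating objects. -/
def letterObj (V W : SMod g) : Orient → SMod g
  | .up => V
  | .down => W

/-- A dual pair `V`, `W` of supermodules and an action of `A` on `V` determine a monoidal
superfunctor with `↑ ↦ V` and `↓ ↦ W`. -/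
theorem exists_superfunctor_of_dualPair {gA : ZMod 2 → Submodule k A} [GradedAlgebra gA]
    {V W : SMod g} {κ : Type*} [Fintype κ] (D : DualPair V W κ) (T : TokenAction gA V) :
    ∃ (ψ : MonoidalSuperfunctor k (OB gA) (SMod g)) (hu : ψ.obj (OB.up gA) = V)
      (hd : ψ.obj (OB.down gA) = W),
      (ψ.tensorId hu hu).hom ≫ ψ.map (OB.cross gA) ≫ (ψ.tensorId hu hu).inv = flip V V ∧
      (∀ a : A, eqToHom hu.symm ≫ ψ.map (OB.token gA a) ≫ eqToHom hu = T.hom a) ∧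
      ψ.unitIso.hom ≫ ψ.map (OB.rightCup gA) ≫ (ψ.tensorId hd hu).inv = D.rightCup ∧
      ψ.unitIso.hom ≫ ψ.map (OB.leftCup gA) ≫ (ψ.tensorId hu hd).inv = D.leftCup ∧
      (ψ.tensorId hu hd).hom ≫ ψ.map (OB.rightCap gA) ≫ ψ.unitIso.inv = D.rightCap ∧
      (ψ.tensorId hd hu).hom ≫ ψ.map (OB.leftCap gA) ≫ ψ.unitIso.inv = D.leftCap := by
  let ψ : MonoidalSuperfunctor k (OB gA) (SMod g) := interpFunctor (gen := letterObj V W) D T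
  have huu : ψ.tensorId (V := V) (W := V) (X := OB.up gA) (Y := OB.up gA) rfl rfl =
      Iso.refl (tensor V V) :=
    (tensorId_rfl ψ _ _).trans (Iso.ext (wordTensor_letters (gen := letterObj V W) .up .up))
  have hud : ψ.tensorId (V := V) (W := W) (X := OB.up gA) (Y := OB.down gA) rfl rfl =
      Iso.refl (tensor V W) :=
    (tensorId_rfl ψ _ _).trans (Iso.ext (wordTensor_letters (gen := letterObj V W) .up .down))
  have hdu : ψ.tensorId (V := W) (W := V) (X := OB.down gA) (Y := OB.up gA) rfl rfl =
      Iso.refl (tensor W V) :=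
    (tensorId_rfl ψ _ _).trans (Iso.ext (wordTensor_letters (gen := letterObj V W) .down .up))
  have key : ∀ {X Y : SMod g} (f : X ⟶ Y), 𝟙 X ≫ f ≫ 𝟙 Y = f := fun f => by simp
  refine ⟨ψ, rfl, rfl, ?_, fun a => key (T.hom a), ?_, ?_, ?_, ?_⟩
  · rw [huu]; exact key (flip V V)
  · rw [hdu]; exact key D.rightCup
  · rw [hud]; exact key D.leftCup
  · rw [hud]; exact key D.rightCap
  · rw [hdu]; exact key D.leftCap

end Existence

/-! ### Row and column vectors over a symmetric Frobenius superalgebra -/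

section Vectors

open SMod

variable {k A : Type u} [Field k] [Ring A] [Algebra k A] {gA : ZMod 2 → Submodule k A}
variable {ι : Type*} [DecidableEq ι]

namespace SymmetricFrobenius

variable [Fintype ι] (F : SymmetricFrobenius gA ι)

theorem sum_tr_dual_smul_basis (a : A) : ∑ b, F.tr (F.dual b * a) • F.basis b = a := by
  have h : ∀ b, F.tr (F.dual b * a) = F.basis.repr a b := by
    intro b
    conv_lhs => rw [← F.basis.sum_repr a]
    simp only [Finset.mul_sum, mul_smul_comm, map_sum, map_smul, F.tr_dual, smul_eq_mul]
    simp
  simp only [h, F.basis.sum_repr]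

/-- The dual family spans `A`: the map `a ↦ (tr (a * b))_b` has a right inverse given by the dual
family, which is also a left inverse because the dimension is finite. -/
theorem sum_tr_basis_smul_dual (a : A) : ∑ b, F.tr (a * F.basis b) • F.dual b = a := by
  let φ : A →ₗ[k] (ι → k) := LinearMap.pi fun b => F.tr ∘ₗ LinearMap.mulRight k (F.basis b)
  let σ : (ι → k) →ₗ[k] A := Fintype.linearCombination k F.dual
  have h : φ ∘ₗ σ = LinearMap.id := by
    refine LinearMap.ext fun c => funext fun b => ?_
    simp [φ, σ, Fintype.linearCombination_apply, F.tr_dual]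
  have : FiniteDimensional k A := F.basis.finiteDimensional_of_finite
  have hφ : Function.Injective φ := by
    refine (LinearMap.injective_iff_surjective_of_finrank_eq_finrank ?_).2 fun c =>
      ⟨σ c, LinearMap.congr_fun h c⟩
    rw [Module.finrank_eq_card_basis F.basis, Module.finrank_fintype_fun_eq_card]
  exact hφ (LinearMap.congr_fun h (φ a))

variable [GradedAlgebra gA]

theorem tr_mul_eq_zero {p q : ZMod 2} {a b : A} (ha : a ∈ gA p) (hb : b ∈ gA q) (h : p ≠ q) :
    F.tr (a * b) = 0 := by
  refine F.tr_odd ?_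
  have e : ∀ p q : ZMod 2, p ≠ q → p + q = 1 := by decide
  rw [← e p q h]
  exact SetLike.mul_mem_graded ha hb

/-- The dual basis vectors are homogeneous: the component of `b^∨` of the parity of `b` has the
same traces against the basis as `b^∨`, because the trace vanishes on odd elements. -/
theorem dual_mem (b : ι) : F.dual b ∈ gA (F.parity b) := by
  have h : ∀ c, F.tr (pr gA (F.parity b) (F.dual b) * F.basis c) =
      F.tr (F.dual b * F.basis c) := by
    intro c
    by_cases hc : F.parity b = F.parity c
    · have e : F.dual b = pr gA (F.parity b) (F.dual b) + pr gA (F.parity b + 1) (F.dual b) := by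
        have e' := pr_add gA (F.dual b)
        have e2 : (1 + 1 : ZMod 2) = 0 := by decide
        rcases parity_cases (F.parity b) with h | h <;> rw [h]
        · rw [zero_add, e']
        · rw [e2, add_comm, e']
      conv_rhs => rw [e]
      rw [add_mul, map_add, F.tr_mul_eq_zero (pr_mem gA (F.parity b + 1) (F.dual b))
        (F.basis_mem c) (by rw [hc]; simp), add_zero]
    · have hbc : b ≠ c := fun e => hc (by rw [e])
      rw [F.tr_mul_eq_zero (pr_mem _ _ _) (F.basis_mem c) hc, F.tr_dual, if_neg hbc]
  have e := F.sum_tr_basis_smul_dual (pr gA (F.parity b) (F.dual b))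
  simp only [h] at e
  rw [F.sum_tr_basis_smul_dual] at e
  rw [e]
  exact pr_mem _ _ _

end SymmetricFrobenius

variable [GradedAlgebra gA] [Fintype ι] (F : SymmetricFrobenius gA ι)
variable {I : Type} [Fintype I] [DecidableEq I] (par : I → ZMod 2)

theorem colVec_mem (x : ι × I) : colVec F par x ∈ (Vminus gA par).gr (rowParity F par x) :=
  Submodule.smul_mem _ _ (single_mem par (F.dual_mem x.1) x.2)

theorem form_colVec (x : ι × I) (v : (Vplus gA par).carrier) :
    form F par (colVec F par x) v = F.tr (F.dual x.1 * v x.2) := by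
  rw [form_eq, Finset.sum_eq_single x.2]
  · simp only [colVec, Pi.smul_apply, Pi.single_eq_same, smul_mul_assoc, map_smul, smul_eq_mul]
    rw [← mul_assoc, sgn_mul_self, one_mul]
  · intro l _ hl
    simp [colVec, Pi.single_eq_of_ne hl]
  · simp

theorem form_rowVec (w : (Vminus gA par).carrier) (x : ι × I) :
    form F par w (rowVec F par x) = sgn k (par x.2) * F.tr (w x.2 * F.basis x.1) := by
  rw [form_eq, Finset.sum_eq_single x.2]
  · simp only [rowVec, Pi.single_eq_same]
  · intro l _ hl
    simp [rowVec, Pi.single_eq_of_ne hl]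
  · simp

/-- The modules `V₊` and `V₋` are dual to each other through the form `B`. -/
noncomputable def vectorDualPair : DualPair (Vplus gA par) (Vminus gA par) (ι × I) where
  form := form F par
  form_eq_zero {p q w v} hw hv h := by
    rw [form_apply F par hw hv, dotProduct, map_sum, Finset.sum_eq_zero, mul_zero]
    intro i _
    exact F.tr_mul_eq_zero (hv i) (hw i) fun e => h (add_right_cancel e).symm
  form_act {p q r w v x} hw hv hx := by
    change form F par w (Matrix.vecMul v x) + sgn k (q * r) * form F par (colAct gA par x w) v = 0
    rw [form_apply F par hw (vecMul_mem gA par hv hx), colAct_apply gA par hw hx, map_neg,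
      map_smul, LinearMap.neg_apply, LinearMap.smul_apply,
      form_apply F par (mulVec_mem gA par hw hx) hv, Matrix.dotProduct_mulVec, smul_eq_mul,
      mul_neg, ← mul_assoc, ← mul_assoc, ← sgn_add, ← sgn_add]
    have e : q * r + p * r + (p + r) * q = p * (q + r) := by
      linear_combination CharTwo.add_self_eq_zero (q * r)
    rw [e, add_neg_cancel]
  parity := rowParity F par
  vec := rowVec F par
  vec_mem := rowVec_mem F par
  dvec := colVec F par
  dvec_mem := colVec_mem F par
  expand v := by
    refine (Finset.sum_congr rfl fun x _ =>
      congrArg (· • rowVec F par x) (form_colVec F par x v)).trans ?_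
    rw [Fintype.sum_prod_type_right]
    conv_rhs => rw [← Finset.univ_sum_single v]
    refine Finset.sum_congr rfl fun i _ => ?_
    conv_rhs => rw [← F.sum_tr_dual_smul_basis (v i)]
    funext j
    simp only [rowVec, Finset.sum_apply, Pi.smul_apply]
    by_cases h : j = i
    · subst h; simp
    · simp [Pi.single_eq_of_ne h]
  dual_expand w := by
    refine (Finset.sum_congr rfl fun x _ =>
      congrArg (· • colVec F par x) (form_rowVec F par w x)).trans ?_
    rw [Fintype.sum_prod_type_right]
    conv_rhs => rw [← Finset.univ_sum_single w]
    refine Finset.sum_congr rfl fun i _ => ?_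
    conv_rhs => rw [← F.sum_tr_basis_smul_dual (w i)]
    funext j
    simp only [colVec, Finset.sum_apply, Pi.smul_apply, smul_smul, mul_right_comm,
      sgn_mul_self, one_mul]
    by_cases h : j = i
    · subst h; simp
    · simp [Pi.single_eq_of_ne h]

variable (gA) in
/-- The action of `A` on row vectors by left multiplication. -/
noncomputable def vectorTokenAction : TokenAction gA (Vplus gA par) where
  hom :=
    { toFun := fun a => ofLin
        (LinearMap.pi fun i => LinearMap.mulLeft k a ∘ₗ LinearMap.proj i) (by
          intro x v
          funext j
          change a * (Matrix.vecMul v x j) = Matrix.vecMul (fun i => a * v i) x j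
          simp only [Matrix.vecMul, dotProduct, Finset.mul_sum, mul_assoc])
      map_add' := by
        intro a b
        refine hom_ext (LinearMap.ext fun v => funext fun i => ?_)
        exact add_mul a b (v i)
      map_smul' := by
        intro c a
        refine hom_ext (LinearMap.ext fun v => funext fun i => ?_)
        exact smul_mul_assoc c a (v i) }
  hom_mem {p a} ha q v hv i := by
    have h := SetLike.mul_mem_graded ha (hv i)
    rwa [← add_assoc, add_comm p q] at h
  hom_one := hom_ext (LinearMap.ext fun v => funext fun i => one_mul (v i))
  hom_mul a b := hom_ext (LinearMap.ext fun v => funext fun i => mul_assoc a b (v i))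

end Vectors

end FrobBrauer

theorem theorem5p1 {k A : Type u} [Field k] [Ring A] [Algebra k A]
    (gA : ZMod 2 → Submodule k A) [GradedAlgebra gA]
    {ι : Type*} [Fintype ι] [DecidableEq ι] (F : SymmetricFrobenius gA ι) (m n : ℕ) :
    ∃ (ψ : MonoidalSuperfunctor k (OB gA) (SMod (gl gA (indexParity m n))))
      (hu : ψ.obj (OB.up gA) = Vplus gA (indexParity m n))
      (hd : ψ.obj (OB.down gA) = Vminus gA (indexParity m n)),
      -- the upward crossing
      (∀ (p q : ZMod 2) (v w : (Vplus gA (indexParity m n)).carrier),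
        v ∈ (Vplus gA (indexParity m n)).gr p → w ∈ (Vplus gA (indexParity m n)).gr q →
        SMod.lin ((ψ.tensorId hu hu).hom ≫ ψ.map (OB.cross gA) ≫ (ψ.tensorId hu hu).inv)
          (v ⊗ₜ[k] w) = sgn k (p * q) • (w ⊗ₜ[k] v)) ∧
      -- the tokens
      (∀ (a : A) (v : (Vplus gA (indexParity m n)).carrier),
        SMod.lin (eqToHom hu.symm ≫ ψ.map (OB.token gA a) ≫ eqToHom hu) v = fun i => a * v i) ∧
      -- the right cup
      SMod.lin (ψ.unitIso.hom ≫ ψ.map (OB.rightCup gA) ≫ (ψ.tensorId hd hu).inv) (1 : k) =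
        ∑ x : ι × Fin (m + n), sgn k (rowParity F (indexParity m n) x) •
          (colVec F (indexParity m n) x ⊗ₜ[k] rowVec F (indexParity m n) x) ∧
      -- the left cup
      SMod.lin (ψ.unitIso.hom ≫ ψ.map (OB.leftCup gA) ≫ (ψ.tensorId hu hd).inv) (1 : k) =
        ∑ x : ι × Fin (m + n),
          rowVec F (indexParity m n) x ⊗ₜ[k] colVec F (indexParity m n) x ∧
      -- the right cap
      (∀ (p q : ZMod 2) (v : (Vplus gA (indexParity m n)).carrier)
        (w : (Vminus gA (indexParity m n)).carrier),
        v ∈ (Vplus gA (indexParity m n)).gr p → w ∈ (Vminus gA (indexParity m n)).gr q →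
        SMod.lin ((ψ.tensorId hu hd).hom ≫ ψ.map (OB.rightCap gA) ≫ ψ.unitIso.inv)
          (v ⊗ₜ[k] w) = sgn k (p * q) * form F (indexParity m n) w v) ∧
      -- the left cap
      (∀ (v : (Vminus gA (indexParity m n)).carrier) (w : (Vplus gA (indexParity m n)).carrier),
        SMod.lin ((ψ.tensorId hd hu).hom ≫ ψ.map (OB.leftCap gA) ≫ ψ.unitIso.inv)
          (v ⊗ₜ[k] w) = form F (indexParity m n) v w) := by
  obtain ⟨ψ, hu, hd, h_cross, h_token, h_rightCup, h_leftCup, h_rightCap, h_leftCap⟩ :=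
    exists_superfunctor_of_dualPair (vectorDualPair F (indexParity m n))
      (vectorTokenAction gA (indexParity m n))
  refine ⟨ψ, hu, hd, ?_, ?_, ?_, ?_, ?_, ?_⟩
  · intro p q v w hv hw
    rw [h_cross]
    exact SMod.flip_tmul _ _ hv hw
  · intro a v
    rw [h_token]
    rfl
  · rw [h_rightCup]
    exact (vectorDualPair F (indexParity m n)).rightCup_one
  · rw [h_leftCup]
    exact (vectorDualPair F (indexParity m n)).leftCup_one
  · intro p q v w hv hw
    rw [h_rightCap]
    exact (vectorDualPair F (indexParity m n)).rightCap_tmul hv hw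
  · intro v w
    rw [h_leftCap]
    rfl
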